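/- Let $M$ be a smooth surface with a smooth Riemannian metric $g$, let $H(\xi)=\tfrac12 g(\xi,\xi)$ be the Hamiltonian of the geodesic flow, and let a *quadratic integral* on an open set $U\subseteq M$ be a function $\xi\mapsto I(\xi,\xi)$ on $TU$, where $I$ is a smooth field of symmetric bilinear forms on $U$ (equivalently, via $g$, a quadratic form in the momenta with smooth coefficients), that is constant along every trajectory of the geodesic flow in $TU$. A *geodesic net* $\mathcal G$ on an open set $U$ is a pair of transverse smooth foliations $G_1,G_2$ of $U$ whose leaves are geodesics. Its *bisector net* $\mathcal N$ is the pair of (mutually orthogonal) foliations $N_1,N_2$ of $U$ whose leaves bisect the angles between $G_1$ and $G_2$. The net $\mathcal N$ is *conformally flat* if near every point of $U$ there are isothermal coordinates $(u,v)$ of $g$ (that is, $g=\Lambda(u,v)(du^2+dv^2)$) whose coordinate lines are the leaves of $\mathcal N$. A 3-web on $U$ is *hexagonal* if near every point where its three directions are pairwise transverse some local diffeomorphism to the plane maps its leaves to three families of parallel line segments. The *3-subwebs* of the 4-web $(G_1,G_2,N_1,N_2)$ are the four 3-webs obtained by omitting one foliation. Then: (a) For every point $m\in M$ the following are equivalent: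 1. on some neighbourhood of $m$ there is a quadratic integral that on $T_mM$ is not a multiple of $H$; 2. some neighbourhood of $m$ carries a geodesic net $\mathcal G$ with bisector net $\mathcal N$ such that one 3-subweb of the 4-web formed by $\mathcal G$ and $\mathcal N$ is hexagonal; 3. some neighbourhood of $m$ carries a geodesic net $\mathcal G$ with bisector net $\mathcal N$ such that every 3-subweb of this 4-web is hexagonal; 4. some neighbourhood of $m$ carries a geodesic net $\mathcal G$ whose bisector net $\mathcal N$ is conformally flat. (b) If on a connected open set $U$ there is a quadratic integral that is not a constant multiple of $H$, then the points of $U$ having a neighbourhood that carries a geodesic net $\mathcal G$ with bisector net $\mathcal N$ such that every 3-subweb is hexagonal and $\mathcal N$ is conformally flat are dense in $U$. (c) For every geodesic net $\mathcal G$ with bisector net $\mathcal N$ on an open set $U\subseteq M$ the following are equivalent: one 3-subweb of the 4-web formed by $\mathcal G$ and $\mathcal N$ is hexagonal on $U$; every 3-subweb is hexagonal on $U$; $\mathcal N$ is conformally flat. -/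

import Mathlib

open scoped Manifold ContDiff

noncomputable section

namespace GeodesicNets

/-- The Euclidean plane, on which surfaces are modelled. -/
abbrev Plane : Type := EuclideanSpace ℝ (Fin 2)

/-- Smooth Riemannian metrics on a surface `M`. -/
abbrev Metric (M : Type*) [TopologicalSpace M] [ChartedSpace Plane M]
    [IsManifold 𝓘(ℝ, Plane) ∞ M] :=
  Bundle.ContMDiffRiemannianMetric 𝓘(ℝ, Plane) ∞ Plane
    (fun x : M => TangentSpace 𝓘(ℝ, Plane) x)

/-- Fields of bilinear forms on the tangent planes of `M`. -/
abbrev BilinField (M : Type*) [TopologicalSpace M] [ChartedSpace Plane M] :=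
  ∀ x : M, TangentSpace 𝓘(ℝ, Plane) x →L[ℝ] TangentSpace 𝓘(ℝ, Plane) x →L[ℝ] ℝ

/-- Fields of subspaces of the tangent planes of `M`. -/
abbrev DirField (M : Type*) [TopologicalSpace M] [ChartedSpace Plane M] :=
  ∀ x : M, Submodule ℝ (TangentSpace 𝓘(ℝ, Plane) x)

variable {M : Type*} [TopologicalSpace M] [ChartedSpace Plane M]

/-- The charts of the maximal smooth atlas: the local coordinate systems of `M`, or, what is the
same, the diffeomorphisms from open subsets of `M` onto open subsets of the plane. -/
def IsCoord (φ : OpenPartialHomeomorph M Plane) : Prop :=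
  φ ∈ IsManifold.maximalAtlas 𝓘(ℝ, Plane) ∞ M

/-- The expression of a field of bilinear forms in the coordinates `φ`: the value, at the
point of `M` with coordinates `y`, on the tangent vectors with components `v` and `w`. -/
def inCoord (b : BilinField M) (φ : OpenPartialHomeomorph M Plane) (y v w : Plane) : ℝ :=
  b (φ.symm y) (mfderiv 𝓘(ℝ, Plane) 𝓘(ℝ, Plane) φ.symm y v)
    (mfderiv 𝓘(ℝ, Plane) 𝓘(ℝ, Plane) φ.symm y w)

/-- The velocity of a curve. -/
def velocity (c : ℝ → M) (t : ℝ) : TangentSpace 𝓘(ℝ, Plane) (c t) :=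
  mfderiv 𝓘(ℝ, ℝ) 𝓘(ℝ, Plane) c t (1 : ℝ)

/-! ### The geodesic flow and its quadratic integrals -/

section Metric

variable [IsManifold 𝓘(ℝ, Plane) ∞ M]

/-- `c` is a (parametrized) geodesic on the open set `s` of parameters, i.e. the projection of a
trajectory of the geodesic flow: in all local coordinates, with Hamiltonian (kinetic energy)
`H = g(ξ, ξ) / 2` and momentum `p = g(ξ, ·)`, where `ξ` is the velocity, the derivative of `p`
equals the derivative of `H` in the position at fixed velocity. -/
def IsGeodesicOn (g : Metric M) (c : ℝ → M) (s : Set ℝ) : Prop :=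
  ContMDiffOn 𝓘(ℝ, ℝ) 𝓘(ℝ, Plane) 2 c s ∧
  ∀ φ : OpenPartialHomeomorph M Plane, IsCoord φ → ∀ t ∈ s, c t ∈ φ.source → ∀ w : Plane,
    HasDerivAt (fun τ : ℝ => inCoord g.inner φ (φ (c τ)) (deriv (fun r => φ (c r)) τ) w)
      (fderiv ℝ (fun y : Plane => (1 / 2 : ℝ) *
        inCoord g.inner φ y (deriv (fun r => φ (c r)) t) (deriv (fun r => φ (c r)) t))
        (φ (c t)) w) t

/-- `b` is a quadratic first integral, on the open set `U`, of the geodesic flow of `g`: the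
function `ξ ↦ b(ξ, ξ)` on the tangent bundle of `U`, a quadratic form in the velocities (hence in
the momenta) with smooth coefficients, is constant along the trajectories of the flow. -/
structure IsQuadraticIntegralOn (g : Metric M) (b : BilinField M) (U : Set M) : Prop where
  smooth : ContMDiffOn 𝓘(ℝ, Plane) (𝓘(ℝ, Plane).prod 𝓘(ℝ, Plane →L[ℝ] Plane →L[ℝ] ℝ)) ∞
    (fun x : M => Bundle.TotalSpace.mk' (Plane →L[ℝ] Plane →L[ℝ] ℝ)
      (E := fun x : M => TangentSpace 𝓘(ℝ, Plane) x →L[ℝ] TangentSpace 𝓘(ℝ, Plane) x →L[ℝ] ℝ)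
      x (b x)) U
  symm : ∀ x ∈ U, ∀ v w : TangentSpace 𝓘(ℝ, Plane) x, b x v w = b x w v
  const : ∀ (α β : ℝ) (c : ℝ → M), IsGeodesicOn g c (Set.Ioo α β) →
    (∀ t ∈ Set.Ioo α β, c t ∈ U) →
    ∀ t₁ ∈ Set.Ioo α β, ∀ t₂ ∈ Set.Ioo α β,
      b (c t₁) (velocity c t₁) (velocity c t₁) = b (c t₂) (velocity c t₂) (velocity c t₂)

/-! ### Foliations, nets and webs

A foliation is given by the smooth field of the tangent lines of its leaves; the leaves are the
integral curves of that field. -/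

/-- `D` is a smooth field of directions on the open set `U`, i.e. it defines a foliation of `U`
by curves. -/
def IsFoliationOn (D : DirField M) (U : Set M) : Prop :=
  ∀ x ∈ U, ∃ V : Set M, IsOpen V ∧ x ∈ V ∧ V ⊆ U ∧
    ∃ X : ∀ y : M, TangentSpace 𝓘(ℝ, Plane) y,
      ContMDiffOn 𝓘(ℝ, Plane) 𝓘(ℝ, Plane).tangent ∞
        (fun y => (⟨y, X y⟩ : TangentBundle 𝓘(ℝ, Plane) M)) V ∧
      ∀ y ∈ V, X y ≠ 0 ∧ D y = Submodule.span ℝ {X y}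

/-- The leaves of the foliation `D` of `U` are (unparametrized) geodesics: through every point of
`U` passes a regular geodesic arc which is everywhere tangent to `D`, hence contained in a leaf. -/
def HasGeodesicLeavesOn (g : Metric M) (D : DirField M) (U : Set M) : Prop :=
  ∀ x ∈ U, ∃ ε : ℝ, 0 < ε ∧ ∃ c : ℝ → M, c 0 = x ∧ IsGeodesicOn g c (Set.Ioo (-ε) ε) ∧
    ∀ t ∈ Set.Ioo (-ε) ε, c t ∈ U ∧ velocity c t ≠ 0 ∧ velocity c t ∈ D (c t)

/-- The foliations `G₁`, `G₂` form a geodesic net on `U`: their leaves are geodesics, and they are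
transverse. -/
structure IsGeodesicNetOn (g : Metric M) (G₁ G₂ : DirField M) (U : Set M) : Prop where
  foliation₁ : IsFoliationOn G₁ U
  foliation₂ : IsFoliationOn G₂ U
  geodesic₁ : HasGeodesicLeavesOn g G₁ U
  geodesic₂ : HasGeodesicLeavesOn g G₂ U
  transverse : ∀ x ∈ U, G₁ x ≠ G₂ x

/-- The foliations `N₁`, `N₂` form the bisector net of the net `G₁`, `G₂` on `U`: at every point
their directions are those of the sum and of the difference of unit vectors in the directions
`G₁` and `G₂`. -/
structure IsBisectorNetOn (g : Metric M) (G₁ G₂ N₁ N₂ : DirField M) (U : Set M) : Prop where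
  foliation₁ : IsFoliationOn N₁ U
  foliation₂ : IsFoliationOn N₂ U
  bisect : ∀ x ∈ U, ∃ a ∈ G₁ x, ∃ b ∈ G₂ x, g.inner x a a = 1 ∧ g.inner x b b = 1 ∧
    N₁ x = Submodule.span ℝ {a + b} ∧ N₂ x = Submodule.span ℝ {a - b}

/-- The coordinates `ψ` are isothermal: the metric is `Λ(u, v) (du² + dv²)`. -/
def IsIsothermal (g : Metric M) (ψ : OpenPartialHomeomorph M Plane) : Prop :=
  ∃ Λ : Plane → ℝ, ∀ y ∈ ψ.target, ∀ v w : Plane,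
    inCoord g.inner ψ y v w = Λ y * inner ℝ v w

/-- The net `N₁`, `N₂` is conformally flat on `U`: near every point it is formed by the coordinate
lines of some isothermal coordinates. -/
def IsConformallyFlatOn (g : Metric M) (N₁ N₂ : DirField M) (U : Set M) : Prop :=
  ∀ x ∈ U, ∃ ψ : OpenPartialHomeomorph M Plane, IsCoord ψ ∧ x ∈ ψ.source ∧ ψ.source ⊆ U ∧
    IsIsothermal g ψ ∧
    ∀ y ∈ ψ.source,
      (N₁ y).map (mfderiv 𝓘(ℝ, Plane) 𝓘(ℝ, Plane) ψ y).toLinearMap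
        = Submodule.span ℝ {(EuclideanSpace.single 0 1 : Plane)} ∧
      (N₂ y).map (mfderiv 𝓘(ℝ, Plane) 𝓘(ℝ, Plane) ψ y).toLinearMap
        = Submodule.span ℝ {(EuclideanSpace.single 1 1 : Plane)}

end Metric

/-- The 3-web formed by the foliations `W 0`, `W 1`, `W 2` of `U` is hexagonal: near every
non-singular point (where the three directions are pairwise transverse) there is a local
diffeomorphism `ψ` to the plane that maps the leaves to three families of parallel line segments,
i.e. the differential of `ψ` maps the field of directions `W i` to a constant one. -/
def IsHexagonalOn (W : Fin 3 → DirField M) (U : Set M) : Prop :=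
  ∀ x ∈ U, (∀ i j, i ≠ j → W i x ≠ W j x) →
    ∃ ψ : OpenPartialHomeomorph M Plane, IsCoord ψ ∧ x ∈ ψ.source ∧ ψ.source ⊆ U ∧
      ∃ w : Fin 3 → Plane, ∀ i, w i ≠ 0 ∧ ∀ y ∈ ψ.source,
        (W i y).map (mfderiv 𝓘(ℝ, Plane) 𝓘(ℝ, Plane) ψ y).toLinearMap
          = Submodule.span ℝ {w i}

/-- The 3-subweb of the 4-web `G₁, G₂, N₁, N₂` obtained by omitting its `k`-th foliation. -/
def subweb (G₁ G₂ N₁ N₂ : DirField M) (k : Fin 4) : Fin 3 → DirField M :=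
  fun i => (![G₁, G₂, N₁, N₂] : Fin 4 → DirField M) (k.succAbove i)

section Metric

variable [IsManifold 𝓘(ℝ, Plane) ∞ M]

/-- Some neighbourhood `U` of `m` carries a geodesic net with a bisector net such that `P` holds
for these nets on `U`. -/
def CarriesGeodesicNetNear (g : Metric M) (m : M)
    (P : DirField M → DirField M → DirField M → DirField M → Set M → Prop) : Prop :=
  ∃ U : Set M, IsOpen U ∧ m ∈ U ∧ ∃ G₁ G₂ N₁ N₂ : DirField M,
    IsGeodesicNetOn g G₁ G₂ U ∧ IsBisectorNetOn g G₁ G₂ N₁ N₂ U ∧ P G₁ G₂ N₁ N₂ U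

/-- The geodesic flow admits, near `m`, a quadratic first integral that is not
proportional to the Hamiltonian on the tangent plane at `m`. -/
def AdmitsQuadraticIntegralNear (g : Metric M) (m : M) : Prop :=
  ∃ U : Set M, IsOpen U ∧ m ∈ U ∧ ∃ b : BilinField M, IsQuadraticIntegralOn g b U ∧
    ¬ ∃ k : ℝ, b m = k • g.inner m

end Metric

end GeodesicNets

end

/-!
The proof compares, for a geodesic net `G₁`, `G₂` with bisector net `N₁`, `N₂`, two kinds of
coordinates, and it passes between geodesic nets and integrals through Liouville's form of the
metric.

**Hexagonal subwebs.** At every point the directions `G₁`, `G₂`, `N₁`, `N₂` are spanned by `a`, `b`,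
`a + b`, `a - b`, and hence form a harmonic quadruple. Thus coordinates in which three of the
foliations are parallel make the fourth one parallel, too; after a linear change of coordinates the
four directions are those of a fixed model (`exists_parallelized_of_isHexagonalOn`). Conversely such
parallelizing coordinates make all the 3-subwebs hexagonal. So each of the hexagonality conditions
means that parallelizing coordinates exist near every point.

**Parallelizing and isothermal coordinates.** Suppose that in some coordinates the leaves of `N₁`,
`N₂` are the coordinate lines. Then the metric is `E du² + F dv²`, and the geodesic directions have
slopes `T` and `-T`. The equation of geodesics gives one equation for each of the two slopes
(`HasGeodesicLeavesOn.slope_eq`).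
* For `T = 1` (parallelizing coordinates) they state that `E² / (E + F)` depends only on `u` and
  `F² / (E + F)` only on `v`. Rescaling `u` and `v` separately makes the coordinates isothermal
  (`isConformallyFlat_of_parallelized`).
* For `E = F = Λ` (isothermal coordinates) they state that `(1 + T²) / Λ` depends only on `u` and
  `(1 + T²) / (Λ T²)` only on `v`. Rescaling `u` and `v` separately makes the slopes `±1`
  (`IsAdaptedCoord.exists_parallelized`).

Hence one or all of the subwebs are hexagonal if and only if the bisector net is conformally flat.

**From nets to integrals.** In the second case `A = Λ / (1 + T²)` depends only on `u` and
`B = Λ T² / (1 + T²)` only on `v`, so that `Λ = A + B` is in Liouville's form, and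
`Λ (B du² - A dv²)` is a quadratic integral (`IsAdaptedCoord.isQuadraticIntegralOn`).

**From integrals to nets.** Let the integral `b` not be a multiple of `g` at a point. Near this point
there is an orthogonal frame `X₁`, `X₂` of eigenvectors of `b` with respect to `g`, with eigenvalues
`μ₁ < μ₂`, normalized by `g(Xᵢ, Xᵢ) = μ₂ - μ₁`. Differentiating `b` along geodesics shows that `X₁`
and `X₂` commute (`IsEigenframe.commute`), so that the dual forms are closed and define isothermal
coordinates along the frame. For a constant `κ` between the eigenvalues the null directions of
`b - κ g` are preserved by the geodesic flow, as `b` and `g` are conserved; therefore they form a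
geodesic net, whose bisector directions are those of `X₁` and `X₂` (`exists_net_of_integral`).

**Density.** If `b` is a multiple of `g` at each point of an open set, the factor is conserved along
geodesics, hence locally constant. And if `b = k g` on a ball in some coordinates, then also near
the boundary points of the ball: geodesics starting near such a point, with velocities close to the
inward normal, enter the ball, and these velocities suffice to determine a quadratic form. By
connectedness `b = k g` on all of `U` (`IsQuadraticIntegralOn.eq_smul_of_eventually`).
-/

open scoped Manifold ContDiff

noncomputable section

open Set Filter Topology

namespace GeodesicNets

/-! ### Tensor fields in coordinates -/

section

variable {M : Type*} [TopologicalSpace M] [ChartedSpace Plane M]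

/-- The expression of a field of bilinear forms in the coordinates `φ`, as a function on the
plane with values in the bilinear forms of the plane. -/
def coordForm (b : BilinField M) (φ : OpenPartialHomeomorph M Plane) (y : Plane) :
    Plane →L[ℝ] Plane →L[ℝ] ℝ :=
  ContinuousLinearMap.bilinearComp (show Plane →L[ℝ] Plane →L[ℝ] ℝ from b (φ.symm y))
    (show Plane →L[ℝ] Plane from mfderiv 𝓘(ℝ, Plane) 𝓘(ℝ, Plane) φ.symm y)
    (show Plane →L[ℝ] Plane from mfderiv 𝓘(ℝ, Plane) 𝓘(ℝ, Plane) φ.symm y)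

/-- The differential of `φ` at `x`, as a linear map of the plane: the tangent planes of `M` are,
by definition, copies of the model `Plane`. -/
def coordDeriv (φ : OpenPartialHomeomorph M Plane) (x : M) : Plane →L[ℝ] Plane :=
  show Plane →L[ℝ] Plane from mfderiv 𝓘(ℝ, Plane) 𝓘(ℝ, Plane) φ x

/-- The differential of `φ.symm` at `y`, as a linear map of the plane. -/
def coordDerivSymm (φ : OpenPartialHomeomorph M Plane) (y : Plane) : Plane →L[ℝ] Plane :=
  show Plane →L[ℝ] Plane from mfderiv 𝓘(ℝ, Plane) 𝓘(ℝ, Plane) φ.symm y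

theorem inCoord_eq (b : BilinField M) (φ : OpenPartialHomeomorph M Plane) (y v w : Plane) :
    inCoord b φ y v w = coordForm b φ y v w := rfl

theorem IsCoord.contMDiffOn {φ : OpenPartialHomeomorph M Plane} (hφ : IsCoord φ) :
    ContMDiffOn 𝓘(ℝ, Plane) 𝓘(ℝ, Plane) ∞ φ φ.source := contMDiffOn_of_mem_maximalAtlas hφ

theorem IsCoord.contMDiffOn_symm {φ : OpenPartialHomeomorph M Plane} (hφ : IsCoord φ) :
    ContMDiffOn 𝓘(ℝ, Plane) 𝓘(ℝ, Plane) ∞ φ.symm φ.target :=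
  contMDiffOn_symm_of_mem_maximalAtlas hφ

section
variable {φ : OpenPartialHomeomorph M Plane}

theorem IsCoord.mdifferentiable (hφ : IsCoord φ) :
    φ.MDifferentiable 𝓘(ℝ, Plane) 𝓘(ℝ, Plane) :=
  ⟨hφ.contMDiffOn.mdifferentiableOn (by simp), hφ.contMDiffOn_symm.mdifferentiableOn (by simp)⟩

theorem IsCoord.symm_coordDeriv (hφ : IsCoord φ) {x : M} (hx : x ∈ φ.source) (v : Plane) :
    coordDerivSymm φ (φ x) (coordDeriv φ x v) = v :=
  DFunLike.congr_fun (hφ.mdifferentiable.symm_comp_deriv hx) v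

theorem IsCoord.coordDeriv_symm (hφ : IsCoord φ) {y : Plane} (hy : y ∈ φ.target) (v : Plane) :
    coordDeriv φ (φ.symm y) (coordDerivSymm φ y v) = v :=
  DFunLike.congr_fun (hφ.mdifferentiable.comp_symm_deriv hy) v

theorem IsCoord.coordDeriv_symm' (hφ : IsCoord φ) {x : M} (hx : x ∈ φ.source) (v : Plane) :
    coordDeriv φ x (coordDerivSymm φ (φ x) v) = v := by
  have := hφ.coordDeriv_symm (φ.map_source hx) v
  rwa [φ.left_inv hx] at this

theorem IsCoord.injective (hφ : IsCoord φ) {x : M} (hx : x ∈ φ.source) :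
    Function.Injective (coordDeriv φ x) :=
  Function.LeftInverse.injective (hφ.symm_coordDeriv hx)

/-- Change between the intrinsic and the coordinate expression of a bilinear form. -/
theorem coordForm_coordDeriv (hφ : IsCoord φ) (b : BilinField M) {x : M} (hx : x ∈ φ.source)
    (v w : Plane) :
    coordForm b φ (φ x) (coordDeriv φ x v) (coordDeriv φ x w)
      = b x (show TangentSpace 𝓘(ℝ, Plane) x from v) (show TangentSpace 𝓘(ℝ, Plane) x from w) := by
  have key : ∀ z : M, z = x → ∀ v w : Plane, (b z : Plane →L[ℝ] Plane →L[ℝ] ℝ) v w =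
      (b x : Plane →L[ℝ] Plane →L[ℝ] ℝ) v w := by
    rintro _ rfl _ _; rfl
  have h := key _ (φ.left_inv hx) (coordDerivSymm φ (φ x) (coordDeriv φ x v))
    (coordDerivSymm φ (φ x) (coordDeriv φ x w))
  have h2 : coordForm b φ (φ x) (coordDeriv φ x v) (coordDeriv φ x w) =
    (b x : Plane →L[ℝ] Plane →L[ℝ] ℝ) (coordDerivSymm φ (φ x) (coordDeriv φ x v))
    (coordDerivSymm φ (φ x) (coordDeriv φ x w)) := h
  rw [h2, hφ.symm_coordDeriv hx, hφ.symm_coordDeriv hx]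

variable [IsManifold 𝓘(ℝ, Plane) ∞ M]

/-- The differential of `φ.symm` carries smooth fields of the plane to smooth fields along
`φ.symm`. -/
theorem IsCoord.contMDiffOn_symm_field (hφ : IsCoord φ) {X : Plane → Plane} {W : Set Plane}
    (hW : W ⊆ φ.target) (hX : ContDiffOn ℝ ∞ X W) :
    ContMDiffOn 𝓘(ℝ, Plane) 𝓘(ℝ, Plane).tangent ∞
      (fun y => (⟨φ.symm y, mfderiv 𝓘(ℝ, Plane) 𝓘(ℝ, Plane) φ.symm y (X y)⟩ :
        TangentBundle 𝓘(ℝ, Plane) M)) W := by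
  have h1 := hφ.contMDiffOn_symm.contMDiffOn_tangentMapWithin (m := ∞) (by simp)
    φ.open_target.uniqueMDiffOn
  have h2 : ContMDiffOn 𝓘(ℝ, Plane) 𝓘(ℝ, Plane).tangent ∞
      (fun y : Plane => (⟨y, X y⟩ : TangentBundle 𝓘(ℝ, Plane) Plane)) W :=
    contMDiffOn_vectorSpace_iff_contDiffOn.2 hX
  refine (h1.comp h2 (fun y hy => hW hy)).congr fun y hy => ?_
  simp only [Function.comp, tangentMapWithin]
  rw [mfderivWithin_of_isOpen φ.open_target (hW hy)]

theorem IsCoord.contMDiffOn_field (hφ : IsCoord φ) {X : Plane → Plane} {W : Set Plane}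
    (hW : W ⊆ φ.target) (hX : ContDiffOn ℝ ∞ X W) :
    ContMDiffOn 𝓘(ℝ, Plane) 𝓘(ℝ, Plane).tangent ∞
      (fun y => (⟨y, mfderiv 𝓘(ℝ, Plane) 𝓘(ℝ, Plane) φ.symm (φ y) (X (φ y))⟩ :
        TangentBundle 𝓘(ℝ, Plane) M)) (φ.source ∩ φ ⁻¹' W) := by
  have h := (hφ.contMDiffOn_symm_field hW hX).comp (hφ.contMDiffOn.mono inter_subset_left)
    (t := W) (s := φ.source ∩ φ ⁻¹' W) (fun y hy => hy.2)
  refine h.congr fun y hy => ?_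
  have key : ∀ z : M, z = y → ∀ v : Plane, (⟨y, v⟩ : TangentBundle 𝓘(ℝ, Plane) M) = ⟨z, v⟩ := by
    rintro _ rfl _; rfl
  exact key _ (φ.left_inv hy.1) _

theorem IsCoord.contDiffOn_coordDeriv_field (hφ : IsCoord φ)
    {X : ∀ y : M, TangentSpace 𝓘(ℝ, Plane) y} {V : Set M} (hV : V ⊆ φ.source)
    (hX : ContMDiffOn 𝓘(ℝ, Plane) 𝓘(ℝ, Plane).tangent ∞
        (fun y => (⟨y, X y⟩ : TangentBundle 𝓘(ℝ, Plane) M)) V) :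
    ContDiffOn ℝ ∞ (fun y => coordDeriv φ (φ.symm y) (X (φ.symm y))) (φ.target ∩ φ.symm ⁻¹' V) := by
  have h1 := hφ.contMDiffOn.contMDiffOn_tangentMapWithin (m := ∞) (by simp)
    φ.open_source.uniqueMDiffOn
  have h2 := h1.comp hX (fun y hy => hV hy)
  have h3 := h2.comp (hφ.contMDiffOn_symm.mono inter_subset_left)
    (s := φ.target ∩ φ.symm ⁻¹' V) (fun y hy => hy.2)
  have h4 := (contMDiff_snd_tangentBundle_modelSpace Plane 𝓘(ℝ, Plane) (n := ∞)).comp_contMDiffOn h3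
  refine h4.contDiffOn.congr fun y hy => ?_
  simp only [Function.comp, tangentMapWithin]
  rw [mfderivWithin_of_isOpen φ.open_source (hV hy.2)]
  rfl

theorem IsCoord.contDiffOn_coordForm (hφ : IsCoord φ) {b : BilinField M} {U : Set M}
    (hb : ContMDiffOn 𝓘(ℝ, Plane) (𝓘(ℝ, Plane).prod 𝓘(ℝ, Plane →L[ℝ] Plane →L[ℝ] ℝ)) ∞
    (fun x : M => Bundle.TotalSpace.mk' (Plane →L[ℝ] Plane →L[ℝ] ℝ)
      (E := fun x : M => TangentSpace 𝓘(ℝ, Plane) x →L[ℝ] TangentSpace 𝓘(ℝ, Plane) x →L[ℝ] ℝ)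
      x (b x)) U) :
    ContDiffOn ℝ ∞ (coordForm b φ) (φ.target ∩ φ.symm ⁻¹' U) := by
  refine contDiffOn_clm_apply.2 fun v => contDiffOn_clm_apply.2 fun w => ?_
  have hc : ∀ v : Plane, ContMDiffOn 𝓘(ℝ, Plane) 𝓘(ℝ, Plane).tangent ∞
      (fun y => (⟨φ.symm y, mfderiv 𝓘(ℝ, Plane) 𝓘(ℝ, Plane) φ.symm y v⟩ :
        TangentBundle 𝓘(ℝ, Plane) M)) (φ.target ∩ φ.symm ⁻¹' U) := fun v =>
    (hφ.contMDiffOn_symm_field subset_rfl (X := fun _ => v) contDiffOn_const).mono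
      inter_subset_left
  have h1 := hb.comp (hφ.contMDiffOn_symm.mono inter_subset_left)
    (s := φ.target ∩ φ.symm ⁻¹' U) (fun y hy => hy.2)
  have : ContMDiffOn 𝓘(ℝ, Plane) (𝓘(ℝ, Plane).prod 𝓘(ℝ)) ∞
      (fun m ↦ Bundle.TotalSpace.mk' ℝ (E := Bundle.Trivial M ℝ) (φ.symm m)
        (inCoord b φ m v w)) (φ.target ∩ φ.symm ⁻¹' U) := by
    apply ContMDiffOn.clm_bundle_apply₂ (F₁ := Plane) (F₂ := Plane)
      (E₁ := fun x : M => TangentSpace 𝓘(ℝ, Plane) x)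
      (E₂ := fun x : M => TangentSpace 𝓘(ℝ, Plane) x)
      (E₃ := Bundle.Trivial M ℝ)
    · exact h1
    · exact hc v
    · exact hc w
  have h2 : ContMDiffOn 𝓘(ℝ, Plane) 𝓘(ℝ) ∞ (fun y => inCoord b φ y v w)
      (φ.target ∩ φ.symm ⁻¹' U) := by
    intro y hy
    have := this y hy
    simp only [Bundle.contMDiffWithinAt_totalSpace] at this
    exact this.2
  exact h2.contDiffOn

theorem IsCoord.contMDiffOn_of_coordForm (hφ : IsCoord φ) {b : BilinField M}
    (hb : ContDiffOn ℝ ∞ (coordForm b φ) φ.target) :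
    ContMDiffOn 𝓘(ℝ, Plane) (𝓘(ℝ, Plane).prod 𝓘(ℝ, Plane →L[ℝ] Plane →L[ℝ] ℝ)) ∞
    (fun x : M => Bundle.TotalSpace.mk' (Plane →L[ℝ] Plane →L[ℝ] ℝ)
      (E := fun x : M => TangentSpace 𝓘(ℝ, Plane) x →L[ℝ] TangentSpace 𝓘(ℝ, Plane) x →L[ℝ] ℝ)
      x (b x)) φ.source := by
  intro x₀ hx₀
  apply ContMDiffAt.contMDiffWithinAt
  rw [contMDiffAt_hom_bundle]
  refine ⟨contMDiffAt_id, ?_⟩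
  have hA : ContMDiffAt 𝓘(ℝ, Plane) 𝓘(ℝ, Plane →L[ℝ] Plane) ∞
      (inTangentCoordinates 𝓘(ℝ, Plane) 𝓘(ℝ, Plane) id φ
        (mfderiv 𝓘(ℝ, Plane) 𝓘(ℝ, Plane) φ) x₀) x₀ :=
    (hφ.contMDiffOn.contMDiffAt (φ.open_source.mem_nhds hx₀)).mfderiv_const (by simp)
  have hB : ContMDiffAt 𝓘(ℝ, Plane) 𝓘(ℝ, Plane →L[ℝ] Plane →L[ℝ] ℝ) ∞
      (fun x => coordForm b φ (φ x)) x₀ :=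
    (hb.contMDiffOn.contMDiffAt (φ.open_target.mem_nhds (φ.map_source hx₀))).comp x₀
      (hφ.contMDiffOn.contMDiffAt (φ.open_source.mem_nhds hx₀))
  have hC := ((((ContinuousLinearMap.compL ℝ Plane Plane ℝ).flip.contMDiff (n := ∞)).contMDiffAt).comp
    x₀ hA).clm_comp (hB.clm_comp hA)
  refine hC.congr_of_eventuallyEq ?_
  filter_upwards [φ.open_source.mem_nhds hx₀,
    (trivializationAt Plane (TangentSpace 𝓘(ℝ, Plane)) x₀).open_baseSet.mem_nhds
      (FiberBundle.mem_baseSet_trivializationAt' x₀)] with x hx hx'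
  ext v w
  have h0 := coordForm_coordDeriv hφ b hx
  have h1 := inCoordinates_apply_eq₂ (F₁ := Plane) (F₂ := Plane) (F₃ := ℝ)
    (E₁ := fun x : M => TangentSpace 𝓘(ℝ, Plane) x)
    (E₂ := fun x : M => TangentSpace 𝓘(ℝ, Plane) x)
    (E₃ := Bundle.Trivial M ℝ) (ϕ := b x) (v := v) (w := w) hx' hx' (Set.mem_univ _)
  have hin : ∀ v : Plane, inTangentCoordinates 𝓘(ℝ, Plane) 𝓘(ℝ, Plane) id φ
        (mfderiv 𝓘(ℝ, Plane) 𝓘(ℝ, Plane) φ) x₀ x v =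
      coordDeriv φ x ((trivializationAt Plane (TangentSpace 𝓘(ℝ, Plane)) x₀).symm x v) := by
    intro v
    change ContinuousLinearMap.inCoordinates Plane (TangentSpace 𝓘(ℝ, Plane)) Plane
      (TangentSpace 𝓘(ℝ, Plane)) x₀ x (φ x₀) (φ x) (mfderiv 𝓘(ℝ, Plane) 𝓘(ℝ, Plane) φ x) v = _
    rw [ContinuousLinearMap.inCoordinates, TangentBundle.continuousLinearMapAt_model_space,
      ← Bundle.Trivialization.symmL_apply (R := ℝ) _ hx']
    rfl
  refine h1.trans ?_
  have h3 := hin v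
  have h4 := hin w
  simp
  erw [h3, h4, h0]

end

end

/-! ### Coordinates from closed forms -/

section

variable {M : Type*} [TopologicalSpace M] [ChartedSpace Plane M]

/-- The linear endomorphism of the plane with the given components. -/
def pairCLM (w : Fin 2 → Plane →L[ℝ] ℝ) : Plane →L[ℝ] Plane :=
  ((EuclideanSpace.equiv (Fin 2) ℝ).symm : (Fin 2 → ℝ) →L[ℝ] Plane).comp
    (ContinuousLinearMap.pi w)

theorem pairCLM_apply (w : Fin 2 → Plane →L[ℝ] ℝ) (v : Plane) (i : Fin 2) :
    pairCLM w v i = w i v := rfl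

/-- Two independent closed 1-forms on the plane are locally the differentials of the components
of a diffeomorphism: Poincaré lemma and inverse function theorem. -/
theorem exists_localDiffeo_of_closed_forms {W : Set Plane} (hW : IsOpen W) {y₀ : Plane}
    (hy₀ : y₀ ∈ W) {w : Fin 2 → Plane → Plane →L[ℝ] ℝ} (hw : ∀ i, ContDiffOn ℝ ∞ (w i) W)
    (hclosed : ∀ i, ∀ y ∈ W, ∀ u v, fderiv ℝ (w i) y u v = fderiv ℝ (w i) y v u)
    (hindep : ∀ y ∈ W, ∀ v, (∀ i, w i y v = 0) → v = 0) :
    ∃ e : OpenPartialHomeomorph Plane Plane, y₀ ∈ e.source ∧ e.source ⊆ W ∧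
      ContDiffOn ℝ ∞ e e.source ∧ ContDiffOn ℝ ∞ e.symm e.target ∧
      ∀ y ∈ e.source, HasFDerivAt e (pairCLM fun i => w i y) y := by
  obtain ⟨r, hr, hB⟩ := Metric.isOpen_iff.1 hW y₀ hy₀
  set B := Metric.ball y₀ r with hBdef
  have hBo : IsOpen B := Metric.isOpen_ball
  have hex : ∀ i, ∃ f : Plane → ℝ, ∀ a ∈ B, HasFDerivAt f (w i a) a := fun i =>
    (convex_ball y₀ r).exists_forall_hasFDerivAt_of_fderiv_symmetric Metric.isOpen_ball
      (((hw i).mono hB).differentiableOn (by simp)) (fun a ha x y => hclosed i a (hB ha) x y)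
  choose f hf using hex
  let F : Plane → Plane := fun y => (EuclideanSpace.equiv (Fin 2) ℝ).symm (fun i => f i y)
  have hF : ∀ a ∈ B, HasFDerivAt F (pairCLM fun i => w i a) a := fun a ha =>
    ((EuclideanSpace.equiv (Fin 2) ℝ).symm.hasFDerivAt).comp a
      (hasFDerivAt_pi.2 fun i => hf i a ha)
  have hFs : ContDiffOn ℝ ∞ F B := by
    refine ((EuclideanSpace.equiv (Fin 2) ℝ).symm.contDiff).comp_contDiffOn
      (contDiffOn_pi.2 fun i => ?_)
    rw [contDiffOn_infty_iff_fderiv_of_isOpen hBo]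
    exact ⟨fun a ha => (hf i a ha).differentiableAt.differentiableWithinAt,
      ((hw i).mono hB).congr fun a ha => (hf i a ha).fderiv⟩
  have hequiv : ∀ a ∈ B, ∃ A : Plane ≃L[ℝ] Plane, (A : Plane →L[ℝ] Plane) = pairCLM fun i => w i a := by
    intro a ha
    have hinj : Function.Injective (pairCLM fun i => w i a : Plane →ₗ[ℝ] Plane) := by
      rw [injective_iff_map_eq_zero]
      intro v hv
      refine hindep a (hB ha) v fun i => ?_
      have := congrFun (congrArg (EuclideanSpace.equiv (Fin 2) ℝ) hv) i
      exact this
    refine ⟨(LinearEquiv.ofInjectiveEndo _ hinj).toContinuousLinearEquiv, ?_⟩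
    ext v
    rfl
  have hy₀B : y₀ ∈ B := Metric.mem_ball_self hr
  obtain ⟨A, hA⟩ := hequiv y₀ hy₀B
  have hFa : ContDiffAt ℝ ∞ F y₀ := hFs.contDiffAt (hBo.mem_nhds hy₀B)
  have hFd : HasFDerivAt F (A : Plane →L[ℝ] Plane) y₀ := by rw [hA]; exact hF y₀ hy₀B
  let e₀ := hFa.toOpenPartialHomeomorph F hFd (by simp)
  have he₀ : y₀ ∈ e₀.source := hFa.mem_toOpenPartialHomeomorph_source hFd (by simp)
  refine ⟨e₀.restrOpen B hBo, ⟨he₀, hy₀B⟩, fun y hy => hB hy.2, hFs.mono fun y hy => hy.2, ?_,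
    fun y hy => hF y hy.2⟩
  intro a ha
  have hab : (e₀.restrOpen B hBo).symm a ∈ B := ((e₀.restrOpen B hBo).map_target ha).2
  obtain ⟨A', hA'⟩ := hequiv _ hab
  apply ContDiffAt.contDiffWithinAt
  refine (e₀.restrOpen B hBo).contDiffAt_symm (f₀' := A') ha ?_ ?_
  · rw [hA']; exact hF _ hab
  · exact hFs.contDiffAt (hBo.mem_nhds hab)

variable [IsManifold 𝓘(ℝ, Plane) ∞ M] {ψ : OpenPartialHomeomorph M Plane}

theorem IsCoord.trans (hψ : IsCoord ψ) {e : OpenPartialHomeomorph Plane Plane}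
    (he : ContDiffOn ℝ ∞ e e.source) (he' : ContDiffOn ℝ ∞ e.symm e.target) :
    IsCoord (ψ.trans e) := by
  apply OpenPartialHomeomorph.mem_maximalAtlas_of_contMDiffOn
  · refine he.contMDiffOn.comp (hψ.contMDiffOn.mono ?_) ?_
    · intro y hy; exact hy.1
    · intro y hy; exact hy.2
  · refine hψ.contMDiffOn_symm.comp (he'.contMDiffOn.mono ?_) ?_
    · intro y hy; exact hy.1
    · intro y hy; exact hy.2

/-- Coordinates with prescribed closed and independent differentials, given in terms of the
coordinates `ψ`. -/
theorem exists_coord_of_closed_forms (hψ : IsCoord ψ) {x : M} (hx : x ∈ ψ.source) {W : Set Plane}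
    (hW : IsOpen W) (hxW : ψ x ∈ W) {w : Fin 2 → Plane → Plane →L[ℝ] ℝ}
    (hw : ∀ i, ContDiffOn ℝ ∞ (w i) W)
    (hclosed : ∀ i, ∀ y ∈ W, ∀ u v, fderiv ℝ (w i) y u v = fderiv ℝ (w i) y v u)
    (hindep : ∀ y ∈ W, ∀ v, (∀ i, w i y v = 0) → v = 0) :
    ∃ χ : OpenPartialHomeomorph M Plane, IsCoord χ ∧ x ∈ χ.source ∧
      (∀ y ∈ χ.source, y ∈ ψ.source ∧ ψ y ∈ W) ∧
      ∀ y ∈ χ.source, ∀ v i, coordDeriv χ y v i = w i (ψ y) (coordDeriv ψ y v) := by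
  obtain ⟨e, hxe, heW, he, he', hd⟩ := exists_localDiffeo_of_closed_forms hW hxW hw hclosed hindep
  refine ⟨ψ.trans e, hψ.trans he he', ⟨hx, hxe⟩, fun y hy => ⟨hy.1, heW hy.2⟩, fun y hy v i => ?_⟩
  have h1 : mfderiv 𝓘(ℝ, Plane) 𝓘(ℝ, Plane) (e ∘ ψ) y =
      (mfderiv 𝓘(ℝ, Plane) 𝓘(ℝ, Plane) e (ψ y)).comp (mfderiv 𝓘(ℝ, Plane) 𝓘(ℝ, Plane) ψ y) :=
    mfderiv_comp y (hd _ hy.2).differentiableAt.mdifferentiableAt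
      (hψ.mdifferentiable.mdifferentiableAt hy.1)
  have h2 : coordDeriv (ψ.trans e) y v = fderiv ℝ e (ψ y) (coordDeriv ψ y v) := by
    rw [mfderiv_eq_fderiv] at h1
    exact DFunLike.congr_fun h1 v
  rw [h2, (hd (ψ y) hy.2).fderiv, pairCLM_apply]

end

/-! ### The Euler–Lagrange equation in the plane -/

section

/-- The Euler–Lagrange equation at the parameter `t` of the curve `x` in the plane, for the
kinetic energy `G(ẋ, ẋ) / 2` of a field `G` of bilinear forms. -/
def IsExtremalAt (G : Plane → Plane →L[ℝ] Plane →L[ℝ] ℝ) (x : ℝ → Plane) (t : ℝ) : Prop :=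
  ∀ w, HasDerivAt (fun τ => G (x τ) (deriv x τ) w)
    ((1 / 2) * fderiv ℝ G (x t) w (deriv x t) (deriv x t)) t

variable {G : Plane → Plane →L[ℝ] Plane →L[ℝ] ℝ} {x : ℝ → Plane} {t : ℝ}

theorem hasDerivAt_deriv_of_contDiffAt (hx : ContDiffAt ℝ 2 x t) :
    HasDerivAt (deriv x) (deriv (deriv x) t) t :=
  ((hx.derivWithin (m := 1) (by norm_num)).differentiableAt (by simp)).hasDerivAt

theorem hasDerivAt_momentum (hG : DifferentiableAt ℝ G (x t)) (hx : ContDiffAt ℝ 2 x t) :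
    HasDerivAt (fun τ => G (x τ) (deriv x τ))
      (fderiv ℝ G (x t) (deriv x t) (deriv x t) + G (x t) (deriv (deriv x) t)) t := by
  have h1 : HasDerivAt x (deriv x t) t := (hx.differentiableAt (by simp)).hasDerivAt
  have h2 : HasDerivAt (fun τ => G (x τ)) (fderiv ℝ G (x t) (deriv x t)) t :=
    HasFDerivAt.comp_hasDerivAt (l := G) t hG.hasFDerivAt h1
  exact h2.clm_apply (hasDerivAt_deriv_of_contDiffAt hx)

theorem isExtremalAt_iff (hG : DifferentiableAt ℝ G (x t)) (hx : ContDiffAt ℝ 2 x t) :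
    IsExtremalAt G x t ↔ ∀ w, fderiv ℝ G (x t) (deriv x t) (deriv x t) w
      + G (x t) (deriv (deriv x) t) w = (1 / 2) * fderiv ℝ G (x t) w (deriv x t) (deriv x t) := by
  have h : ∀ w, HasDerivAt (fun τ => G (x τ) (deriv x τ) w)
      (fderiv ℝ G (x t) (deriv x t) (deriv x t) w + G (x t) (deriv (deriv x) t) w) t := fun w => by
    have := (hasDerivAt_momentum hG hx).clm_apply (hasDerivAt_const t w)
    simpa using this
  refine forall_congr' fun w => ⟨fun h' => (h w).unique h', fun h' => h' ▸ h w⟩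

/-- Conservation of energy. -/
theorem IsExtremalAt.hasDerivAt_energy (hG : DifferentiableAt ℝ G (x t)) (hx : ContDiffAt ℝ 2 x t)
    (hsymm : ∀ v w, G (x t) v w = G (x t) w v) (h : IsExtremalAt G x t) :
    HasDerivAt (fun τ => G (x τ) (deriv x τ) (deriv x τ)) 0 t := by
  have h1 := (hasDerivAt_momentum hG hx).clm_apply (hasDerivAt_deriv_of_contDiffAt hx)
  have h2 := (isExtremalAt_iff hG hx).1 h (deriv x t)
  refine h1.congr_deriv ?_
  rw [add_apply, hsymm (deriv x t)]
  linarith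

/-- The Euler–Lagrange equation does not depend on the coordinates. -/
theorem IsExtremalAt.change_coord {G' : Plane → Plane →L[ℝ] Plane →L[ℝ] ℝ} {x' : ℝ → Plane}
    {σ : Plane → Plane} (hG : DifferentiableAt ℝ G (x t)) (hx : ContDiffAt ℝ 2 x t)
    (hsymm : ∀ v w, G (x t) v w = G (x t) w v)
    (hG' : DifferentiableAt ℝ G' (x' t)) (hx' : ContDiffAt ℝ 2 x' t) (hσ : ContDiffAt ℝ ∞ σ (x' t))
    (hGG' : ∀ᶠ y in 𝓝 (x' t), ∀ v w, G' y v w = G (σ y) (fderiv ℝ σ y v) (fderiv ℝ σ y w))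
    (hxx' : ∀ᶠ τ in 𝓝 t, x τ = σ (x' τ)) (h : IsExtremalAt G x t) : IsExtremalAt G' x' t := by
  have hσd : DifferentiableAt ℝ σ (x' t) := hσ.differentiableAt (by simp)
  have hx't : HasDerivAt x' (deriv x' t) t := (hx'.differentiableAt (by simp)).hasDerivAt
  have hev : ∀ᶠ y in 𝓝 (x' t), DifferentiableAt ℝ σ y :=
    ((hσ.of_le (m := 1) (by simp)).eventually (by simp)).mono fun y hy =>
      hy.differentiableAt (by simp)
  have hev' : ∀ᶠ τ in 𝓝 t, DifferentiableAt ℝ x' τ :=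
    ((hx'.of_le (m := 1) (by norm_num)).eventually (by simp)).mono fun y hy =>
      hy.differentiableAt (by simp)
  have hder : ∀ᶠ τ in 𝓝 t, deriv x τ = fderiv ℝ σ (x' τ) (deriv x' τ) := by
    filter_upwards [hxx'.eventually_nhds, hx't.continuousAt.eventually hev, hev'] with τ h1 h2 h3
    have h4 : HasDerivAt (fun r => σ (x' r)) (fderiv ℝ σ (x' τ) (deriv x' τ)) τ :=
      h2.hasFDerivAt.comp_hasDerivAt τ h3.hasDerivAt
    exact (h4.congr_of_eventuallyEq h1).deriv
  have hxt : x t = σ (x' t) := hxx'.self_of_nhds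
  have hdt := hder.self_of_nhds
  have hσ2 : HasFDerivAt (fderiv ℝ σ) (fderiv ℝ (fderiv ℝ σ) (x' t)) (x' t) :=
    ((hσ.fderiv_right (m := 1) (by decide)).differentiableAt (by simp)).hasFDerivAt
  have hsd : ∀ v w, fderiv ℝ (fderiv ℝ σ) (x' t) v w = fderiv ℝ (fderiv ℝ σ) (x' t) w v :=
    hσ.isSymmSndFDerivAt (by simp; decide)
  intro w
  -- the momentum in the new coordinates
  have h1 : HasDerivAt (fun τ => fderiv ℝ σ (x' τ) w)
      (fderiv ℝ (fderiv ℝ σ) (x' t) (deriv x' t) w) t := by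
    have := (hσ2.comp_hasDerivAt t hx't).clm_apply (hasDerivAt_const t w)
    simpa using this
  have h2 := (hasDerivAt_momentum hG hx).clm_apply h1
  have h3 : (fun τ => G' (x' τ) (deriv x' τ) w) =ᶠ[𝓝 t]
      fun τ => G (x τ) (deriv x τ) (fderiv ℝ σ (x' τ) w) := by
    filter_upwards [hxx', hder, hx't.continuousAt.eventually hGG'] with τ h1 h2 h3
    rw [h3, h1, h2]
  have h4 := h2.congr_of_eventuallyEq h3
  -- the derivative of the energy in the new coordinates
  have h5 : ∀ v : Plane, HasFDerivAt (fun y => G' y v v)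
      (((fderiv ℝ G' (x' t)).flip v).flip v) (x' t) := by
    intro v
    have h := (hG'.hasFDerivAt.clm_apply (hasFDerivAt_const v (x' t))).clm_apply (hasFDerivAt_const v (x' t))
    refine h.congr_fderiv ?_
    ext u
    simp
  set v := deriv x' t with hv
  have hGσ : HasFDerivAt (fun y => G (σ y)) ((fderiv ℝ G (x t)).comp (fderiv ℝ σ (x' t))) (x' t) := by
    have hG0 : HasFDerivAt G (fderiv ℝ G (x t)) (σ (x' t)) := hxt ▸ hG.hasFDerivAt
    exact HasFDerivAt.comp (g := G) (x' t) hG0 hσd.hasFDerivAt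
  have h6 := (hσ2.clm_apply (hasFDerivAt_const v (x' t)))
  have h7 := ((hGσ.clm_apply h6).clm_apply h6).congr_of_eventuallyEq
    (hGG'.mono fun y hy => hy v v)
  have h8 := DFunLike.congr_fun ((h5 v).unique h7) w
  have h9 := (isExtremalAt_iff hG hx).1 h (fderiv ℝ σ (x' t) w)
  refine h4.congr_deriv ?_
  simp at h8
  rw [← hxt, hsd w v, hsymm (fderiv ℝ (fderiv ℝ σ) (x' t) v w)] at h8
  rw [hdt] at h9
  rw [h8, hdt]
  simp only [add_apply] at h9 ⊢
  linarith

end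

/-! ### Geodesics in coordinates -/

section

variable {M : Type*} [TopologicalSpace M] [ChartedSpace Plane M]
  {φ : OpenPartialHomeomorph M Plane}

theorem contDiffAt_coord_comp (hφ : IsCoord φ) {c : ℝ → M} {s : Set ℝ} (hs : IsOpen s)
    (hc : ContMDiffOn 𝓘(ℝ, ℝ) 𝓘(ℝ, Plane) 2 c s) {t : ℝ} (ht : t ∈ s) (htφ : c t ∈ φ.source) :
    ContDiffAt ℝ 2 (fun r => φ (c r)) t := by
  have h1 : ContMDiffAt 𝓘(ℝ, Plane) 𝓘(ℝ, Plane) 2 φ (c t) :=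
    (hφ.contMDiffOn.contMDiffAt (φ.open_source.mem_nhds htφ)).of_le (by decide)
  exact (h1.comp t (hc.contMDiffAt (hs.mem_nhds ht))).contDiffAt

theorem deriv_coord_comp (hφ : IsCoord φ) {c : ℝ → M} {t : ℝ}
    (hc : MDifferentiableAt 𝓘(ℝ, ℝ) 𝓘(ℝ, Plane) c t) (htφ : c t ∈ φ.source) :
    deriv (fun r => φ (c r)) t = coordDeriv φ (c t) (velocity c t) := by
  have h1 := mfderiv_comp t (hφ.mdifferentiable.mdifferentiableAt htφ) hc
  rw [mfderiv_eq_fderiv] at h1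
  exact DFunLike.congr_fun h1 (1 : ℝ)

theorem coordForm_velocity (hφ : IsCoord φ) (b : BilinField M) {c : ℝ → M} {t : ℝ}
    (hc : MDifferentiableAt 𝓘(ℝ, ℝ) 𝓘(ℝ, Plane) c t) (htφ : c t ∈ φ.source) :
    coordForm b φ (φ (c t)) (deriv (fun r => φ (c r)) t) (deriv (fun r => φ (c r)) t) =
      b (c t) (velocity c t) (velocity c t) := by
  rw [deriv_coord_comp hφ hc htφ]
  exact coordForm_coordDeriv hφ b htφ _ _

variable [IsManifold 𝓘(ℝ, Plane) ∞ M] {g : Metric M}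

theorem coordForm_symm (g : Metric M) (φ : OpenPartialHomeomorph M Plane) (y v w : Plane) :
    coordForm g.inner φ y v w = coordForm g.inner φ y w v := g.symm _ _ _

theorem IsCoord.coordForm_pos (hφ : IsCoord φ) (g : Metric M) {y : Plane} (hy : y ∈ φ.target)
    {v : Plane} (hv : v ≠ 0) : 0 < coordForm g.inner φ y v v := by
  refine g.pos _ _ fun h => hv ?_
  rw [← hφ.coordDeriv_symm hy v]
  exact (congrArg (coordDeriv φ (φ.symm y)) h).trans (map_zero _)

theorem IsCoord.contDiffOn_metric (hφ : IsCoord φ) (g : Metric M) :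
    ContDiffOn ℝ ∞ (coordForm g.inner φ) φ.target := by
  have h := hφ.contDiffOn_coordForm (U := univ) (g.contMDiff.contMDiffOn)
  simpa using h

theorem IsCoord.differentiableAt_metric (hφ : IsCoord φ) (g : Metric M) {y : Plane}
    (hy : y ∈ φ.target) : DifferentiableAt ℝ (coordForm g.inner φ) y :=
  ((hφ.contDiffOn_metric g).contDiffAt (φ.open_target.mem_nhds hy)).differentiableAt (by simp)

theorem fderiv_energy {G : Plane → Plane →L[ℝ] Plane →L[ℝ] ℝ} {y : Plane}
    (hG : DifferentiableAt ℝ G y) (v w : Plane) :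
    fderiv ℝ (fun y => (1 / 2 : ℝ) * G y v v) y w = (1 / 2) * fderiv ℝ G y w v v := by
  have h1 : HasFDerivAt (fun y => G y v v) (((fderiv ℝ G y).flip v).flip v) y := by
    have h := (hG.hasFDerivAt.clm_apply (hasFDerivAt_const v y)).clm_apply (hasFDerivAt_const v y)
    refine h.congr_fderiv ?_
    ext u
    simp
  rw [(h1.const_mul (1 / 2 : ℝ)).fderiv]
  simp

theorem isExtremalAt_coordForm_iff (hφ : IsCoord φ) {x : ℝ → Plane} {t : ℝ}
    (hx : x t ∈ φ.target) : IsExtremalAt (coordForm g.inner φ) x t ↔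
    ∀ w : Plane, HasDerivAt (fun τ : ℝ => inCoord g.inner φ (x τ) (deriv x τ) w)
      (fderiv ℝ (fun y : Plane => (1 / 2 : ℝ) *
        inCoord g.inner φ y (deriv x t) (deriv x t)) (x t) w) t := by
  simp only [inCoord_eq]
  refine forall_congr' fun w => ?_
  rw [fderiv_energy (hφ.differentiableAt_metric g hx)]

theorem IsGeodesicOn.mdifferentiableAt {c : ℝ → M} {s : Set ℝ} (hs : IsOpen s)
    (hc : IsGeodesicOn g c s) {t : ℝ} (ht : t ∈ s) :
    MDifferentiableAt 𝓘(ℝ, ℝ) 𝓘(ℝ, Plane) c t :=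
  (hc.1.contMDiffAt (hs.mem_nhds ht)).mdifferentiableAt (by simp)

theorem IsGeodesicOn.continuousAt {c : ℝ → M} {s : Set ℝ} (hs : IsOpen s)
    (hc : IsGeodesicOn g c s) {t : ℝ} (ht : t ∈ s) : ContinuousAt c t :=
  (hc.mdifferentiableAt hs ht).continuousAt

theorem IsGeodesicOn.isExtremalAt {c : ℝ → M} {s : Set ℝ} (hc : IsGeodesicOn g c s)
    (hφ : IsCoord φ) {t : ℝ} (ht : t ∈ s) (htφ : c t ∈ φ.source) :
    IsExtremalAt (coordForm g.inner φ) (fun r => φ (c r)) t :=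
  (isExtremalAt_coordForm_iff hφ (φ.map_source htφ)).2 fun w => hc.2 φ hφ t ht htφ w

/-- For a curve to be a geodesic it suffices that the Euler–Lagrange equation holds in one
coordinate system. -/
theorem isGeodesicOn_of_isExtremalAt (hφ : IsCoord φ) {x : ℝ → Plane} {s : Set ℝ}
    (hx : ∀ t ∈ s, x t ∈ φ.target) (hxs : ∀ t ∈ s, ContDiffAt ℝ 2 x t)
    (he : ∀ t ∈ s, IsExtremalAt (coordForm g.inner φ) x t) :
    IsGeodesicOn g (fun t => φ.symm (x t)) s := by
  have hc : ∀ t ∈ s, ContMDiffAt 𝓘(ℝ, ℝ) 𝓘(ℝ, Plane) 2 (fun t => φ.symm (x t)) t := by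
    intro t ht
    have h1 : ContMDiffAt 𝓘(ℝ, Plane) 𝓘(ℝ, Plane) 2 φ.symm (x t) :=
      (hφ.contMDiffOn_symm.contMDiffAt (φ.open_target.mem_nhds (hx t ht))).of_le (by decide)
    exact h1.comp t (hxs t ht).contMDiffAt
  refine ⟨fun t ht => (hc t ht).contMDiffWithinAt, fun φ' hφ' t ht htφ' => ?_⟩
  have hx' : ContDiffAt ℝ 2 (fun r => φ' (φ.symm (x r))) t := by
    have h1 : ContMDiffAt 𝓘(ℝ, Plane) 𝓘(ℝ, Plane) 2 φ' (φ.symm (x t)) :=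
      (hφ'.contMDiffOn.contMDiffAt (φ'.open_source.mem_nhds htφ')).of_le (by decide)
    exact (h1.comp t (hc t ht)).contDiffAt
  have htgt : φ' (φ.symm (x t)) ∈ φ'.target := φ'.map_source htφ'
  have hsrc : φ'.symm (φ' (φ.symm (x t))) ∈ φ.source := by
    rw [φ'.left_inv htφ']; exact φ.map_target (hx t ht)
  refine (isExtremalAt_coordForm_iff hφ' (x := fun r => φ' (φ.symm (x r))) htgt).1 ?_
  refine IsExtremalAt.change_coord (σ := fun y => φ (φ'.symm y))
    (hφ.differentiableAt_metric g (hx t ht)) (hxs t ht) (coordForm_symm g φ _)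
    (hφ'.differentiableAt_metric g htgt) hx' ?_ ?_ ?_ (he t ht)
  · have h1 : ContMDiffAt 𝓘(ℝ, Plane) 𝓘(ℝ, Plane) ∞ φ (φ'.symm (φ' (φ.symm (x t)))) :=
      hφ.contMDiffOn.contMDiffAt (φ.open_source.mem_nhds hsrc)
    exact (h1.comp _
      (hφ'.contMDiffOn_symm.contMDiffAt (φ'.open_target.mem_nhds htgt))).contDiffAt
  · have hnhds : φ'.target ∩ φ'.symm ⁻¹' φ.source ∈ 𝓝 (φ' (φ.symm (x t))) :=
      (φ'.continuousOn_symm.isOpen_inter_preimage φ'.open_target φ.open_source).mem_nhds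
        ⟨htgt, hsrc⟩
    filter_upwards [hnhds] with y hy v w
    have h1 : ∀ v, fderiv ℝ (fun y => φ (φ'.symm y)) y v =
        coordDeriv φ (φ'.symm y) (coordDerivSymm φ' y v) := by
      intro v
      have h2 := mfderiv_comp y (hφ.mdifferentiable.mdifferentiableAt hy.2)
        (hφ'.mdifferentiable.mdifferentiableAt_symm hy.1)
      rw [mfderiv_eq_fderiv] at h2
      exact DFunLike.congr_fun h2 v
    rw [h1, h1, coordForm_coordDeriv hφ g.inner hy.2]
    rfl
  · have hev : ∀ᶠ τ in 𝓝 t, x τ ∈ φ.target ∧ φ.symm (x τ) ∈ φ'.source := by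
      have h1 := (hxs t ht).continuousAt.eventually (φ.open_target.mem_nhds (hx t ht))
      have h2 := (hc t ht).continuousAt.eventually (φ'.open_source.mem_nhds htφ')
      exact h1.and h2
    filter_upwards [hev] with τ hτ
    rw [φ'.left_inv hτ.2, φ.right_inv hτ.1]

/-! ### Existence of geodesics -/

/-- A definite form identifies the plane with its dual. -/
theorem exists_equiv_of_pos {B : Plane →L[ℝ] Plane →L[ℝ] ℝ} (hB : ∀ v, v ≠ 0 → 0 < B v v) :
    ∃ A : Plane ≃L[ℝ] (Plane →L[ℝ] ℝ), (A : Plane →L[ℝ] Plane →L[ℝ] ℝ) = B := by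
  have hinj : Function.Injective (B : Plane →ₗ[ℝ] (Plane →L[ℝ] ℝ)) := by
    rw [injective_iff_map_eq_zero]
    intro v hv
    by_contra h
    have h1 : B v = 0 := hv
    have := hB v h
    rw [h1] at this
    simp at this
  have hdim : Module.finrank ℝ Plane = Module.finrank ℝ (Plane →L[ℝ] ℝ) := by
    rw [← (LinearMap.toContinuousLinearMap (𝕜 := ℝ) (E := Plane) (F' := ℝ)).finrank_eq]
    exact (Subspace.dual_finrank_eq (K := ℝ) (V := Plane)).symm
  refine ⟨(LinearMap.linearEquivOfInjective _ hinj hdim).toContinuousLinearEquiv, ?_⟩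
  ext v w
  rfl

/-- Picard–Lindelöf with a locally uniform time of existence and with solutions staying close to
the initial value. -/
theorem exists_forall_hasDerivAt_mem {E : Type*} [NormedAddCommGroup E] [NormedSpace ℝ E]
    [CompleteSpace E] {f : E → E} {z₀ : E} (hf : ContDiffAt ℝ 1 f z₀) {W : Set E}
    (hW : W ∈ 𝓝 z₀) : ∃ r > 0, ∃ ε > 0, ∀ z ∈ Metric.closedBall z₀ r, ∃ α : ℝ → E, α 0 = z ∧
      ∀ t ∈ Ioo (-ε) ε, HasDerivAt α (f (α t)) t ∧ α t ∈ W := by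
  obtain ⟨ε, hε, a, r, L, K, hr, hpl⟩ := IsPicardLindelof.of_contDiffAt_one hf
  obtain ⟨α, hα, hcont⟩ :=
    (hpl 0).exists_forall_mem_closedBall_eq_hasDerivWithinAt_continuousOn
  have hz₀ : z₀ ∈ Metric.closedBall z₀ (r : ℝ) := Metric.mem_closedBall_self r.2
  have h0 : (0 : ℝ) ∈ Icc (0 - ε) (0 + ε) := by constructor <;> linarith
  have hmem := hcont (z₀, 0) ⟨hz₀, h0⟩
  have hW' : W ∈ 𝓝 (α (z₀, 0)) := by rw [(hα z₀ hz₀).1]; exact hW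
  have h1 : {p | α p ∈ W} ∈ 𝓝[Metric.closedBall z₀ (r : ℝ) ×ˢ Icc (0 - ε) (0 + ε)] (z₀, 0) :=
    hmem hW'
  have h2 : Metric.closedBall z₀ (r : ℝ) ×ˢ Icc (0 - ε) (0 + ε) ∈ 𝓝 ((z₀, 0) : E × ℝ) :=
    prod_mem_nhds (Metric.closedBall_mem_nhds _ hr) (Icc_mem_nhds (by linarith) (by linarith))
  rw [nhdsWithin_eq_nhds.2 h2] at h1
  obtain ⟨δ, hδ, hball⟩ := Metric.nhds_basis_closedBall.mem_iff.1 h1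
  refine ⟨min δ r, lt_min hδ hr, min δ ε, lt_min hδ hε, fun z hz => ⟨fun t => α (z, t), ?_, ?_⟩⟩
  · exact (hα z (Metric.closedBall_subset_closedBall (min_le_right _ _) hz)).1
  · intro t ht
    have ht1 : -δ < t ∧ t < δ := ⟨by linarith [ht.1, min_le_left δ ε], by
      linarith [ht.2, min_le_left δ ε]⟩
    have ht2 : -ε < t ∧ t < ε := ⟨by linarith [ht.1, min_le_right δ ε], by
      linarith [ht.2, min_le_right δ ε]⟩
    refine ⟨((hα z (Metric.closedBall_subset_closedBall (min_le_right _ _) hz)).2 t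
      ⟨by linarith, by linarith⟩).hasDerivAt (Icc_mem_nhds (by linarith) (by linarith)), ?_⟩
    refine hball (?_ : (z, t) ∈ Metric.closedBall ((z₀, 0) : E × ℝ) δ)
    rw [← closedBall_prod_same]
    refine ⟨Metric.closedBall_subset_closedBall (min_le_left _ _) hz, ?_⟩
    rw [Metric.mem_closedBall, Real.dist_eq, abs_le]
    constructor <;> linarith

/-- The acceleration of the extremals, as a function of position and velocity. -/
def spray (G : Plane → Plane →L[ℝ] Plane →L[ℝ] ℝ) (z : Plane × Plane) : Plane :=
  (G z.1).inverse ((1 / 2 : ℝ) • ((fderiv ℝ G z.1).flip z.2).flip z.2 - fderiv ℝ G z.1 z.2 z.2)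

theorem contDiffAt_spray {G : Plane → Plane →L[ℝ] Plane →L[ℝ] ℝ} {z : Plane × Plane}
    (hG : ContDiffAt ℝ ∞ G z.1) (hpos : ∀ v, v ≠ 0 → 0 < G z.1 v v) :
    ContDiffAt ℝ ∞ (spray G) z := by
  obtain ⟨A, hA⟩ := exists_equiv_of_pos hpos
  have h1 : ContDiffAt ℝ ∞ (fun z : Plane × Plane => G z.1) z := hG.comp z contDiffAt_fst
  have hinv : ContDiffAt ℝ ∞ (fun z : Plane × Plane => (G z.1).inverse) z := by
    have := contDiffAt_map_inverse (𝕜 := ℝ) (n := ∞) A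
    rw [hA] at this
    exact this.comp z h1
  have hev : ∀ᶠ p : Plane × Plane in 𝓝 z, DifferentiableAt ℝ G p.1 := by
    have := ((hG.of_le (m := 1) (by simp)).eventually (by simp)).mono fun y hy =>
      hy.differentiableAt (by simp)
    exact continuousAt_fst.eventually this
  have hd : ∀ p : Plane × Plane, DifferentiableAt ℝ G p.1 →
      HasFDerivAt (fun q : Plane × Plane => G q.1)
        ((fderiv ℝ G p.1).comp (ContinuousLinearMap.fst ℝ Plane Plane)) p := fun p hp =>
    HasFDerivAt.comp (g := G) (f := Prod.fst) p hp.hasFDerivAt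
      (hasFDerivAt_fst (𝕜 := ℝ) (E := Plane) (F := Plane) (p := p))
  have hfl : ContDiffAt ℝ ∞ (fun z : Plane × Plane =>
      ((fderiv ℝ G z.1).flip z.2).flip z.2) z := by
    have h3 : ContDiffAt ℝ ∞ (fun p : Plane × Plane => G p.1 p.2 p.2) z :=
      (h1.clm_apply contDiffAt_snd).clm_apply contDiffAt_snd
    have h4 := (h3.fderiv_right (m := ∞) (by simp)).clm_comp
      (contDiffAt_const (c := ContinuousLinearMap.inl ℝ Plane Plane))
    refine h4.congr_of_eventuallyEq ?_
    filter_upwards [hev] with p hp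
    rw [(((hd p hp).clm_apply hasFDerivAt_snd).clm_apply hasFDerivAt_snd).fderiv]
    ext w
    simp
  have hfl' : ContDiffAt ℝ ∞ (fun z : Plane × Plane => fderiv ℝ G z.1 z.2 z.2) z := by
    have h3 : ContDiffAt ℝ ∞ (fun p : Plane × Plane => G p.1 p.2) z := h1.clm_apply contDiffAt_snd
    have h4 := (h3.fderiv_right (m := ∞) (by simp)).clm_apply
      (contDiffAt_snd.prodMk (contDiffAt_const (c := (0 : Plane))))
    refine h4.congr_of_eventuallyEq ?_
    filter_upwards [hev] with p hp
    rw [((hd p hp).clm_apply hasFDerivAt_snd).fderiv]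
    ext w
    simp
  exact hinv.clm_apply (((contDiffAt_const (c := (1 / 2 : ℝ))).smul hfl).sub hfl')

/-- The geodesics with initial data close to `(y₀, v₀)` exist on a common interval, on which the
point and the velocity remain in the given neighbourhood `W` of `(y₀, v₀)`. -/
theorem IsCoord.exists_geodesic (hφ : IsCoord φ) (g : Metric M) {y₀ v₀ : Plane}
    (hy₀ : y₀ ∈ φ.target) {W : Set (Plane × Plane)} (hW : W ∈ 𝓝 (y₀, v₀)) :
    ∃ r > 0, ∃ ε > 0, ∀ y ∈ Metric.closedBall y₀ r, ∀ v ∈ Metric.closedBall v₀ r,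
      ∃ c : ℝ → M, IsGeodesicOn g c (Ioo (-ε) ε) ∧ c 0 = φ.symm y ∧
        deriv (fun t => φ (c t)) 0 = v ∧
        ∀ t ∈ Ioo (-ε) ε, c t ∈ φ.source ∧ (φ (c t), deriv (fun t => φ (c t)) t) ∈ W := by
  set G := coordForm g.inner φ with hGdef
  have hsm := hφ.contDiffOn_metric g
  have hsp : ContDiffAt ℝ 1 (fun z : Plane × Plane => (z.2, spray G z)) (y₀, v₀) :=
    contDiffAt_snd.prodMk ((contDiffAt_spray (z := (y₀, v₀))
      (hsm.contDiffAt (φ.open_target.mem_nhds hy₀))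
      (fun v hv => hφ.coordForm_pos g hy₀ hv)).of_le (by simp))
  have hW' : W ∩ Prod.fst ⁻¹' φ.target ∈ 𝓝 (y₀, v₀) :=
    inter_mem hW (continuousAt_fst.preimage_mem_nhds (φ.open_target.mem_nhds hy₀))
  obtain ⟨r, hr, ε, hε, h⟩ := exists_forall_hasDerivAt_mem hsp hW'
  refine ⟨r, hr, ε, hε, fun y hy v hv => ?_⟩
  obtain ⟨α, hα0, hα⟩ := h (y, v) (by rw [← closedBall_prod_same]; exact ⟨hy, hv⟩)
  have hx1 : ∀ t ∈ Ioo (-ε) ε, HasDerivAt (fun t => (α t).1) (α t).2 t := fun t ht =>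
    (hasFDerivAt_fst (p := α t)).comp_hasDerivAt t (hα t ht).1
  have hx2 : ∀ t ∈ Ioo (-ε) ε, HasDerivAt (fun t => (α t).2) (spray G (α t)) t := fun t ht =>
    (hasFDerivAt_snd (p := α t)).comp_hasDerivAt t (hα t ht).1
  have ho : ∀ t ∈ Ioo (-ε) ε, Ioo (-ε) ε ∈ 𝓝 t := fun t ht => isOpen_Ioo.mem_nhds ht
  have hd1 : ∀ t ∈ Ioo (-ε) ε, deriv (fun t => (α t).1) t = (α t).2 := fun t ht => (hx1 t ht).deriv
  have hd1' : ∀ t ∈ Ioo (-ε) ε, deriv (fun t => (α t).1) =ᶠ[𝓝 t] fun t => (α t).2 := fun t ht =>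
    eventually_of_mem (ho t ht) hd1
  have htgt : ∀ t ∈ Ioo (-ε) ε, (α t).1 ∈ φ.target := fun t ht => (hα t ht).2.2
  have hc2 : ∀ t ∈ Ioo (-ε) ε, ContDiffAt ℝ 2 (fun t => (α t).1) t := by
    have h0 : ContDiffOn ℝ 1 (fun t => (α t).2) (Ioo (-ε) ε) := by
      refine (contDiffOn_succ_iff_deriv_of_isOpen (n := 0) isOpen_Ioo).2
        ⟨fun t ht => (hx2 t ht).differentiableAt.differentiableWithinAt, by simp, ?_⟩
      refine contDiffOn_zero.2 fun t ht => ContinuousAt.continuousWithinAt ?_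
      refine ContinuousAt.congr (f := fun t => spray G (α t)) ?_
        (eventuallyEq_of_mem (ho t ht) fun s hs => (hx2 s hs).deriv.symm)
      exact ((contDiffAt_spray (hsm.contDiffAt (φ.open_target.mem_nhds (htgt t ht)))
        (fun v hv => hφ.coordForm_pos g (htgt t ht) hv)).continuousAt).comp
          (hα t ht).1.continuousAt
    have h1 : ContDiffOn ℝ 2 (fun t => (α t).1) (Ioo (-ε) ε) :=
      (contDiffOn_succ_iff_deriv_of_isOpen (n := 1) isOpen_Ioo).2
        ⟨fun t ht => (hx1 t ht).differentiableAt.differentiableWithinAt, by simp, h0.congr hd1⟩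
    exact fun t ht => h1.contDiffAt (ho t ht)
  have hgeo : IsGeodesicOn g (fun t => φ.symm (α t).1) (Ioo (-ε) ε) := by
    refine isGeodesicOn_of_isExtremalAt hφ htgt hc2 fun t ht => ?_
    rw [isExtremalAt_iff (hφ.differentiableAt_metric g (htgt t ht)) (hc2 t ht)]
    intro w
    rw [hd1 t ht, (hd1' t ht).deriv_eq, (hx2 t ht).deriv]
    obtain ⟨A, hA⟩ := exists_equiv_of_pos (fun v hv => hφ.coordForm_pos g (htgt t ht) hv)
    have h1 : G (α t).1 (spray G (α t)) = (1 / 2 : ℝ) •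
        ((fderiv ℝ G (α t).1).flip (α t).2).flip (α t).2 - fderiv ℝ G (α t).1 (α t).2 (α t).2 := by
      rw [spray, hGdef, ← hA, ContinuousLinearMap.inverse_equiv]
      simp
    rw [← hGdef, h1]
    simp
  have hφc : ∀ t ∈ Ioo (-ε) ε, φ (φ.symm (α t).1) = (α t).1 := fun t ht => φ.right_inv (htgt t ht)
  have hdφ : ∀ t ∈ Ioo (-ε) ε, deriv (fun t => φ (φ.symm (α t).1)) t = (α t).2 := fun t ht => by
    rw [← hd1 t ht]
    exact (eventuallyEq_of_mem (ho t ht) hφc).deriv_eq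
  have h0 : (0 : ℝ) ∈ Ioo (-ε) ε := ⟨by linarith, hε⟩
  refine ⟨_, hgeo, by simp [hα0], by rw [hdφ 0 h0, hα0], fun t ht => ⟨φ.map_target (htgt t ht), ?_⟩⟩
  rw [hφc t ht, hdφ t ht]
  exact (hα t ht).2.1

end

/-! ### Directions in coordinates and the frame of a geodesic net -/

section

/-- The standard basis of the plane. -/
abbrev stdVec (i : Fin 2) : Plane := EuclideanSpace.single i 1

theorem eq_stdVec (v : Plane) : v = v 0 • stdVec 0 + v 1 • stdVec 1 := by
  ext i; fin_cases i <;> simp [stdVec]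

theorem span_singleton_eq_iff {z u : Plane} (hz : z ≠ 0) (hu : u ≠ 0) :
    Submodule.span ℝ {z} = Submodule.span ℝ {u} ↔ z 0 * u 1 = z 1 * u 0 := by
  constructor
  · intro h
    obtain ⟨k, rfl⟩ := Submodule.mem_span_singleton.1 (h ▸ Submodule.mem_span_singleton_self z)
    simp only [PiLp.smul_apply, smul_eq_mul]
    ring
  · intro h
    have hk : ∃ k : ℝ, k • u = z := by
      by_cases h0 : u 0 = 0
      · have h1 : u 1 ≠ 0 := fun h1 => hu (by ext i; fin_cases i <;> simp [h0, h1])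
        refine ⟨z 1 / u 1, ?_⟩
        have h2 : z 0 = 0 := by
          rw [h0, mul_zero] at h
          exact (mul_eq_zero.1 h).resolve_right h1
        ext i; fin_cases i
        · simp [h0, h2]
        · simp [h1]
      · refine ⟨z 0 / u 0, ?_⟩
        ext i; fin_cases i
        · simp [h0]
        · simp only [Fin.mk_one, PiLp.smul_apply, smul_eq_mul]
          field_simp
          linarith
    obtain ⟨k, rfl⟩ := hk
    have hk : k ≠ 0 := fun h => hz (by simp [h])
    exact Submodule.span_singleton_smul_eq (IsUnit.mk0 k hk) u

variable {M : Type*} [TopologicalSpace M] [ChartedSpace Plane M]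

/-- In the coordinates `φ`, the field `D` has at `y` the direction of the vector `v`. -/
def HasDirAt (φ : OpenPartialHomeomorph M Plane) (D : DirField M) (y : M) (v : Plane) : Prop :=
  (D y).map (mfderiv 𝓘(ℝ, Plane) 𝓘(ℝ, Plane) φ y).toLinearMap = Submodule.span ℝ {v}

variable {φ ψ χ : OpenPartialHomeomorph M Plane} {D : DirField M} {y : M} {u v : Plane}

theorem hasDirAt_iff : HasDirAt φ D y v ↔ Submodule.map (coordDeriv φ y).toLinearMap
    (show Submodule ℝ Plane from D y) = Submodule.span ℝ {v} := Iff.rfl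

theorem HasDirAt.congr_span (h : HasDirAt φ D y u)
    (huv : Submodule.span ℝ {u} = Submodule.span ℝ {v}) : HasDirAt φ D y v := h.trans huv

theorem HasDirAt.span_eq (h : HasDirAt φ D y u) (h' : HasDirAt φ D y v) :
    Submodule.span ℝ {u} = Submodule.span ℝ {v} := h.symm.trans h'

theorem hasDirAt_of_eq_span {a : Plane} (h : D y = Submodule.span ℝ {(a : TangentSpace 𝓘(ℝ, Plane) y)}) :
    HasDirAt φ D y (coordDeriv φ y a) := by
  rw [hasDirAt_iff]
  have h' : (show Submodule ℝ Plane from D y) = Submodule.span ℝ {a} := h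
  rw [h', Submodule.map_span, image_singleton]
  rfl

theorem HasDirAt.of_comp (h : HasDirAt φ D y v) (L : Plane →L[ℝ] Plane)
    (hL : ∀ u, coordDeriv χ y u = L (coordDeriv φ y u)) : HasDirAt χ D y (L v) := by
  rw [hasDirAt_iff] at h ⊢
  have h1 : (coordDeriv χ y).toLinearMap = L.toLinearMap ∘ₗ (coordDeriv φ y).toLinearMap :=
    LinearMap.ext hL
  rw [h1, Submodule.map_comp, h, Submodule.map_span, image_singleton]
  rfl

theorem HasDirAt.coordDeriv_mem (h : HasDirAt φ D y v) {a : Plane}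
    (ha : (a : TangentSpace 𝓘(ℝ, Plane) y) ∈ D y) :
    ∃ k : ℝ, coordDeriv φ y a = k • v := by
  rw [hasDirAt_iff] at h
  have h1 : coordDeriv φ y a ∈ Submodule.map (coordDeriv φ y).toLinearMap
    (show Submodule ℝ Plane from D y) := Submodule.mem_map_of_mem ha
  rw [h] at h1
  obtain ⟨k, hk⟩ := Submodule.mem_span_singleton.1 h1
  exact ⟨k, hk.symm⟩

variable [IsManifold 𝓘(ℝ, Plane) ∞ M] {g : Metric M} {G₁ G₂ N₁ N₂ : DirField M} {U : Set M}

theorem IsFoliationOn.eq_span (h : IsFoliationOn D U) (hy : y ∈ U)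
    {a : TangentSpace 𝓘(ℝ, Plane) y} (ha : a ∈ D y) (ha0 : a ≠ 0) : D y = Submodule.span ℝ {a} := by
  obtain ⟨V, -, hyV, -, X, -, hX⟩ := h y hy
  obtain ⟨hX0, hD⟩ := hX y hyV
  rw [hD] at ha ⊢
  obtain ⟨k, rfl⟩ := Submodule.mem_span_singleton.1 ha
  have hk : k ≠ 0 := fun h => ha0 (by simp [h])
  exact (Submodule.span_singleton_smul_eq (IsUnit.mk0 k hk) _).symm

/-- The components, with respect to a frame `a`, `b` with `G₁ = ⟨a⟩` and `G₂ = ⟨b⟩`, of vectors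
in the directions `G₁`, `G₂`, `N₁ = ⟨a + b⟩`, `N₂ = ⟨a - b⟩`. -/
def webCoeff (j : Fin 4) : Plane := (![!₂[1, 0], !₂[0, 1], !₂[1, 1], !₂[1, -1]] : Fin 4 → Plane) j

/-- Model directions of the 4-web: `G₁ = ⟨e₀ + e₁⟩`, `G₂ = ⟨e₀ - e₁⟩`, `N₁ = ⟨e₀⟩`, `N₂ = ⟨e₁⟩`. -/
def webModel (j : Fin 4) : Plane := (![!₂[1, 1], !₂[1, -1], !₂[1, 0], !₂[0, 1]] : Fin 4 → Plane) j

/-- At every point of a geodesic net with a bisector net there are unit vectors `a` and `b` that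
form a basis and span the directions of the net, such that `a + b` and `a - b` span those of the
bisector net. -/
theorem exists_frame (hG : IsGeodesicNetOn g G₁ G₂ U) (hN : IsBisectorNetOn g G₁ G₂ N₁ N₂ U)
    (hy : y ∈ U) : ∃ a b : Plane, (∀ p q : ℝ, p • a + q • b = 0 → p = 0 ∧ q = 0) ∧
      g.inner y (a : TangentSpace 𝓘(ℝ, Plane) y) (a : TangentSpace 𝓘(ℝ, Plane) y) = 1 ∧
      g.inner y (b : TangentSpace 𝓘(ℝ, Plane) y) (b : TangentSpace 𝓘(ℝ, Plane) y) = 1 ∧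
      ∀ j : Fin 4, (![G₁, G₂, N₁, N₂] : Fin 4 → DirField M) j y =
        Submodule.span ℝ {((webCoeff j 0 • a + webCoeff j 1 • b : Plane) :
          TangentSpace 𝓘(ℝ, Plane) y)} := by
  obtain ⟨a, ha, b, hb, haa, hbb, h1, h2⟩ := hN.bisect y hy
  have ha0 : a ≠ 0 := by rintro rfl; simp at haa
  have hb0 : b ≠ 0 := by rintro rfl; simp at hbb
  have hGa := hG.foliation₁.eq_span hy ha ha0
  have hGb := hG.foliation₂.eq_span hy hb hb0
  have hne := hG.transverse y hy
  refine ⟨a, b, ?_, haa, hbb, ?_⟩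
  · intro p q hpq
    have hpq' : p • a + q • b = 0 := hpq
    have hp : p = 0 := by
      by_contra hp
      apply hne
      have : a = (-q / p) • b := by
        have : p • a = -(q • b) := eq_neg_of_add_eq_zero_left hpq'
        rw [div_eq_inv_mul, mul_smul, neg_smul, ← this, smul_smul, inv_mul_cancel₀ hp, one_smul]
      have hq : -q / p ≠ 0 := fun h => ha0 (by rw [this, h, zero_smul])
      rw [hGa, hGb, this, Submodule.span_singleton_smul_eq (IsUnit.mk0 _ hq)]
    refine ⟨hp, ?_⟩
    rw [hp, zero_smul, zero_add] at hpq'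
    exact (smul_eq_zero.1 hpq').resolve_right hb0
  · have e : ∀ (p q : ℝ) (c : TangentSpace 𝓘(ℝ, Plane) y), p • a + q • b = c →
        ∀ D : Submodule ℝ (TangentSpace 𝓘(ℝ, Plane) y), D = Submodule.span ℝ {c} →
        D = Submodule.span ℝ {p • a + q • b} := by
      rintro p q c rfl D h; exact h
    intro j
    fin_cases j
    · exact e _ _ _ (by simp [webCoeff]) _ hGa
    · exact e _ _ _ (by simp [webCoeff]) _ hGb
    · exact e _ _ _ (by simp [webCoeff]) _ h1
    · exact e _ _ _ (by simp [webCoeff, sub_eq_add_neg]) _ h2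

end

/-! ### Hexagonal subwebs and parallelizing coordinates -/

section

variable {M : Type*} [TopologicalSpace M] [ChartedSpace Plane M]

/-- The coordinates `ψ` turn the four foliations into the model 4-web of parallel lines. -/
def IsParallelizedBy (ψ : OpenPartialHomeomorph M Plane) (G₁ G₂ N₁ N₂ : DirField M) : Prop :=
  ∀ y ∈ ψ.source, ∀ j, HasDirAt ψ ((![G₁, G₂, N₁, N₂] : Fin 4 → DirField M) j) y (webModel j)

theorem webModel_ne_zero (j : Fin 4) : webModel j ≠ 0 := by
  intro h
  have h0 := congrArg (fun v : Plane => v 0) h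
  have h1 := congrArg (fun v : Plane => v 1) h
  fin_cases j <;> simp [webModel] at h0 h1

theorem webCoeff_cross {j j' : Fin 4} (h : j ≠ j') :
    webCoeff j 0 * webCoeff j' 1 ≠ webCoeff j 1 * webCoeff j' 0 := by
  fin_cases j <;> fin_cases j' <;> simp [webCoeff] at h ⊢ <;> norm_num

/-- Parallelizing coordinates of the 4-web make all of its 3-subwebs hexagonal. -/
theorem isHexagonalOn_subweb_of_parallelized {G₁ G₂ N₁ N₂ : DirField M} {U : Set M}
    (h : ∀ x ∈ U, ∃ ψ : OpenPartialHomeomorph M Plane, IsCoord ψ ∧ x ∈ ψ.source ∧ ψ.source ⊆ U ∧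
      IsParallelizedBy ψ G₁ G₂ N₁ N₂) (k : Fin 4) : IsHexagonalOn (subweb G₁ G₂ N₁ N₂ k) U := by
  intro x hx _
  obtain ⟨ψ, hψ, hxψ, hψU, hp⟩ := h x hx
  exact ⟨ψ, hψ, hxψ, hψU, fun i => webModel (k.succAbove i),
    fun i => ⟨webModel_ne_zero _, fun y hy => hp y hy _⟩⟩

/-- The cross-ratio of the four directions is harmonic; hence three of them determine the
fourth. -/
theorem harmonic_completion {a b : Plane} (k : Fin 4)
    (h : ∀ j, j ≠ k → (webCoeff j 0 • a + webCoeff j 1 • b : Plane) 0 * webModel j 1 =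
      (webCoeff j 0 • a + webCoeff j 1 • b : Plane) 1 * webModel j 0) (j : Fin 4) :
    (webCoeff j 0 • a + webCoeff j 1 • b : Plane) 0 * webModel j 1 =
      (webCoeff j 0 • a + webCoeff j 1 • b : Plane) 1 * webModel j 0 := by
  by_cases hj : j = k
  · subst hj
    have h0 := h 0
    have h1 := h 1
    have h2 := h 2
    have h3 := h 3
    clear h
    fin_cases j <;> simp [webCoeff, webModel] at h0 h1 h2 h3 ⊢ <;> linarith
  · exact h j hj

variable [IsManifold 𝓘(ℝ, Plane) ∞ M] {g : Metric M} {G₁ G₂ N₁ N₂ : DirField M} {U : Set M}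

theorem exists_linear_map_of_frame {a b : Plane}
    (hab : ∀ p q : ℝ, p • a + q • b = 0 → p = 0 ∧ q = 0) (u v : Plane) :
    ∃ L : Plane →L[ℝ] Plane, L a = u ∧ L b = v := by
  have hli : LinearIndependent ℝ ![a, b] := LinearIndependent.pair_iff.2 hab
  let B := basisOfLinearIndependentOfCardEqFinrank hli (by simp)
  refine ⟨LinearMap.toContinuousLinearMap (B.constr ℝ ![u, v]), ?_, ?_⟩
  · have := B.constr_basis ℝ ![u, v] 0
    simpa [B] using this
  · have := B.constr_basis ℝ ![u, v] 1
    simpa [B] using this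

theorem exists_eq_frame {a b : Plane} (hab : ∀ p q : ℝ, p • a + q • b = 0 → p = 0 ∧ q = 0)
    (v : Plane) : ∃ p q : ℝ, v = p • a + q • b := by
  have hli : LinearIndependent ℝ ![a, b] := LinearIndependent.pair_iff.2 hab
  let B := basisOfLinearIndependentOfCardEqFinrank hli (by simp)
  refine ⟨B.repr v 0, B.repr v 1, ?_⟩
  have := B.sum_repr v
  rw [Fin.sum_univ_two] at this
  simpa [B] using this.symm

/-- Coordinates in which one 3-subweb is parallel, followed by a linear map, turn the whole 4-web
into the model: the three directions of the subweb are in general position at every point, and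
the omitted one is the fourth harmonic. -/
theorem exists_parallelized_of_isHexagonalOn (hG : IsGeodesicNetOn g G₁ G₂ U)
    (hN : IsBisectorNetOn g G₁ G₂ N₁ N₂ U) {k : Fin 4}
    (hk : IsHexagonalOn (subweb G₁ G₂ N₁ N₂ k) U) {x : M} (hx : x ∈ U) :
    ∃ ψ : OpenPartialHomeomorph M Plane, IsCoord ψ ∧ x ∈ ψ.source ∧ ψ.source ⊆ U ∧
      IsParallelizedBy ψ G₁ G₂ N₁ N₂ := by
  obtain ⟨a, b, hab, -, -, hW⟩ := exists_frame hG hN hx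
  have hns : ∀ i j : Fin 3, i ≠ j →
      subweb G₁ G₂ N₁ N₂ k i x ≠ subweb G₁ G₂ N₁ N₂ k j x := by
    intro i j hij heq
    have hne : k.succAbove i ≠ k.succAbove j := fun h => hij (Fin.succAbove_right_injective h)
    have h1 := (hW (k.succAbove i)).symm.trans (heq.trans (hW (k.succAbove j)))
    have h2 : (webCoeff (k.succAbove i) 0 • a + webCoeff (k.succAbove i) 1 • b : Plane) ∈
        Submodule.span ℝ {(webCoeff (k.succAbove j) 0 • a + webCoeff (k.succAbove j) 1 • b : Plane)} := by
      have h3 := Submodule.mem_span_singleton_self (R := ℝ)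
        (webCoeff (k.succAbove i) 0 • a + webCoeff (k.succAbove i) 1 • b : Plane)
      exact (show Submodule.span ℝ _ = Submodule.span ℝ _ from h1) ▸ h3
    obtain ⟨c, hc⟩ := Submodule.mem_span_singleton.1 h2
    have h4 := hab (c * webCoeff (k.succAbove j) 0 - webCoeff (k.succAbove i) 0)
      (c * webCoeff (k.succAbove j) 1 - webCoeff (k.succAbove i) 1) (by
        rw [smul_add, smul_smul, smul_smul] at hc
        rw [sub_smul, sub_smul, sub_add_sub_comm, hc, sub_self])
    apply webCoeff_cross hne
    rw [← sub_eq_zero.1 h4.1, ← sub_eq_zero.1 h4.2]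
    ring
  obtain ⟨ψ, hψ, hxψ, hψU, w, hw⟩ := hk x hx hns
  -- normalize the constant directions at the point `x` by a linear map
  have hab' : ∀ p q : ℝ, p • coordDeriv ψ x a + q • coordDeriv ψ x b = 0 → p = 0 ∧ q = 0 := by
    intro p q h
    apply hab
    apply hψ.injective hxψ
    rw [map_add, map_smul, map_smul, h, map_zero]
  obtain ⟨L, hLa, hLb⟩ := exists_linear_map_of_frame hab' !₂[1, 1] !₂[1, -1]
  have hLinj : ∀ v, L v = 0 → v = 0 := by
    intro v hv
    obtain ⟨p, q, rfl⟩ := exists_eq_frame hab' v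
    rw [map_add, map_smul, map_smul, hLa, hLb] at hv
    have h0 := congrArg (fun v : Plane => v 0) hv
    have h1 := congrArg (fun v : Plane => v 1) hv
    simp only [PiLp.add_apply, PiLp.smul_apply, PiLp.zero_apply, Matrix.cons_val_zero,
      Matrix.cons_val_one, smul_eq_mul] at h0 h1
    have hp : p = 0 := by linarith
    have hq : q = 0 := by linarith
    rw [hp, hq, zero_smul, zero_smul, add_zero]
  have hmodel : ∀ i, Submodule.span ℝ {L (w i)} = Submodule.span ℝ {webModel (k.succAbove i)} := by
    intro i
    have h1 : HasDirAt ψ (subweb G₁ G₂ N₁ N₂ k i) x (w i) := (hw i).2 x hxψ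
    have h2 := h1.span_eq (hasDirAt_of_eq_span (φ := ψ) (hW (k.succAbove i)))
    have h3 := congrArg (Submodule.map L.toLinearMap) h2
    rw [Submodule.map_span, Submodule.map_span, image_singleton, image_singleton] at h3
    refine h3.trans ?_
    simp only [map_add, map_smul, ContinuousLinearMap.coe_coe, hLa, hLb]
    generalize k.succAbove i = j
    rw [span_singleton_eq_iff _ (webModel_ne_zero j)]
    · fin_cases j <;> simp [webCoeff, webModel]
    · intro h
      have h0 := congrArg (fun v : Plane => v 0) h
      have h1 := congrArg (fun v : Plane => v 1) h
      fin_cases j <;> simp [webCoeff] at h0 h1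
  obtain ⟨χ, hχ, hxχ, hχψ, hd⟩ := exists_coord_of_closed_forms hψ hxψ isOpen_univ (mem_univ _)
    (w := fun i _ => (EuclideanSpace.proj i : Plane →L[ℝ] ℝ).comp L) (fun i => contDiffOn_const)
    (fun i y _ u v => by simp)
    (fun y _ v hv => hLinj v (by ext i; exact hv i))
  refine ⟨χ, hχ, hxχ, fun y hy => hψU (hχψ y hy).1, fun y hy => ?_⟩
  have hyU : y ∈ U := hψU (hχψ y hy).1
  have hL : ∀ v, coordDeriv χ y v = L (coordDeriv ψ y v) := fun v => by
    ext i; exact hd y hy v i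
  obtain ⟨a', b', hab'', -, -, hW'⟩ := exists_frame hG hN hyU
  have hj : ∀ j, HasDirAt χ ((![G₁, G₂, N₁, N₂] : Fin 4 → DirField M) j) y
      (webCoeff j 0 • coordDeriv χ y a' + webCoeff j 1 • coordDeriv χ y b') := by
    intro j
    have := hasDirAt_of_eq_span (φ := χ) (hW' j)
    rwa [map_add, map_smul, map_smul] at this
  have hnz : ∀ j, webCoeff j 0 • coordDeriv χ y a' + webCoeff j 1 • coordDeriv χ y b' ≠ 0 := by
    intro j h
    rw [← map_smul, ← map_smul, ← map_add] at h
    have := hab'' _ _ (hχ.injective hy (h.trans (map_zero _).symm))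
    fin_cases j <;> simp [webCoeff] at this
  intro j
  refine (hj j).congr_span ((span_singleton_eq_iff (hnz j) (webModel_ne_zero j)).2
    (harmonic_completion k (fun j hjk => ?_) j))
  rw [← span_singleton_eq_iff (hnz j) (webModel_ne_zero j)]
  obtain ⟨i, rfl⟩ := Fin.exists_succAbove_eq hjk
  rw [← hmodel i]
  exact (hj _).span_eq (HasDirAt.of_comp ((hw i).2 y (hχψ y hy).1) L hL)

end

/-! ### The slope equation of a foliation with geodesic leaves -/

section

/-- The partial derivative in the `i`-th coordinate of the plane. -/
abbrev partialDeriv (i : Fin 2) (f : Plane → ℝ) (y : Plane) : ℝ := fderiv ℝ f y (stdVec i)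

theorem fderiv_apply_eq_partialDeriv (f : Plane → ℝ) (y v : Plane) :
    fderiv ℝ f y v = v 0 * partialDeriv 0 f y + v 1 * partialDeriv 1 f y := by
  conv_lhs => rw [eq_stdVec v, map_add, map_smul, map_smul, smul_eq_mul, smul_eq_mul]

/-- If a power of `f` equals `Q / P` and the derivative of `Q / P` in the direction `v` vanishes,
so does that of `f`. -/
theorem fderiv_eq_zero_of_pow_mul_eq {f P Q : Plane → ℝ} {P' Q' : Plane →L[ℝ] ℝ} {y v : Plane}
    {n : ℕ} (hn : n ≠ 0) (hf : DifferentiableAt ℝ f y) (hP : HasFDerivAt P P' y)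
    (hQ : HasFDerivAt Q Q' y) (h : ∀ᶠ z in 𝓝 y, f z ^ n * P z = Q z) (hf0 : f y ≠ 0)
    (hP0 : P y ≠ 0) (hPQ : Q' v * P y = Q y * P' v) : fderiv ℝ f y v = 0 := by
  have h1 : HasFDerivAt (fun z => f z ^ n * P z) _ y := (hf.hasFDerivAt.pow n).mul hP
  have h2 := congrArg (fun L : Plane →L[ℝ] ℝ => L v)
    ((h1.congr_of_eventuallyEq (h.mono fun z hz => hz.symm)).unique hQ)
  have h3 := h.self_of_nhds
  simp only [add_apply, smul_apply, smul_eq_mul, nsmul_eq_mul] at h2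
  have hc : (n : ℝ) * f y ^ (n - 1) * P y ^ 2 ≠ 0 :=
    mul_ne_zero (mul_ne_zero (Nat.cast_ne_zero.2 hn) (pow_ne_zero _ hf0)) (pow_ne_zero _ hP0)
  refine (mul_eq_zero.1 (?_ : (n : ℝ) * f y ^ (n - 1) * P y ^ 2 * fderiv ℝ f y v = 0)).resolve_left hc
  rw [← h2, ← h3] at hPQ
  linear_combination hPQ

theorem fderiv_diag {G : Plane → Plane →L[ℝ] Plane →L[ℝ] ℝ} {E F : Plane → ℝ} {y : Plane}
    (hG : DifferentiableAt ℝ G y) (hE : DifferentiableAt ℝ E y) (hF : DifferentiableAt ℝ F y)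
    (hEF : ∀ᶠ y in 𝓝 y, ∀ v w, G y v w = E y * (v 0 * w 0) + F y * (v 1 * w 1)) (v w : Plane) :
    fderiv ℝ G y w v v = v 0 ^ 2 * fderiv ℝ E y w + v 1 ^ 2 * fderiv ℝ F y w := by
  have h1 := fderiv_energy hG v w
  have h2 : (fun y => (1 / 2 : ℝ) * G y v v) =ᶠ[𝓝 y]
      fun y => (1 / 2 : ℝ) * (E y * v 0 ^ 2 + F y * v 1 ^ 2) := by
    filter_upwards [hEF] with y hy
    rw [hy]; ring
  have h3 : HasFDerivAt (fun y => (1 / 2 : ℝ) * (E y * v 0 ^ 2 + F y * v 1 ^ 2)) _ y :=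
    ((hE.hasFDerivAt.mul_const (v 0 ^ 2)).add (hF.hasFDerivAt.mul_const (v 1 ^ 2))).const_mul
      (1 / 2 : ℝ)
  rw [h2.fderiv_eq, h3.fderiv] at h1
  simp only [smul_apply, add_apply, smul_eq_mul] at h1
  linarith

/-- In orthogonal coordinates, where the metric is `E du² + F dv²`, the equation satisfied by the
slope `T` of a field of directions along an integral curve that is a geodesic. -/
theorem IsExtremalAt.slope_eq {G : Plane → Plane →L[ℝ] Plane →L[ℝ] ℝ} {x : ℝ → Plane} {t : ℝ}
    {E F T : Plane → ℝ} (h : IsExtremalAt G x t) (hG : DifferentiableAt ℝ G (x t))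
    (hx : ContDiffAt ℝ 2 x t) (hE : DifferentiableAt ℝ E (x t)) (hF : DifferentiableAt ℝ F (x t))
    (hT : DifferentiableAt ℝ T (x t))
    (hEF : ∀ᶠ y in 𝓝 (x t), ∀ v w, G y v w = E y * (v 0 * w 0) + F y * (v 1 * w 1))
    (hslope : ∀ᶠ τ in 𝓝 t, deriv x τ 1 = T (x τ) * deriv x τ 0) (h0 : deriv x t ≠ 0) :
    (partialDeriv 1 E (x t) + T (x t) ^ 2 * partialDeriv 1 F (x t)) * E (x t) / 2 +
        F (x t) * T (x t) * (partialDeriv 0 E (x t) + T (x t) * partialDeriv 1 E (x t)) =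
      (partialDeriv 0 E (x t) + T (x t) ^ 2 * partialDeriv 0 F (x t)) * F (x t) * T (x t) / 2 +
        E (x t) * ((partialDeriv 0 F (x t) + T (x t) * partialDeriv 1 F (x t)) * T (x t) +
          F (x t) * (partialDeriv 0 T (x t) + T (x t) * partialDeriv 1 T (x t))) := by
  have hx1 : HasDerivAt x (deriv x t) t := (hx.differentiableAt (by simp)).hasDerivAt
  have hs := hslope.self_of_nhds
  set p := deriv x t 0 with hp
  have hp0 : p ≠ 0 := by
    intro hp0
    apply h0
    ext i
    fin_cases i
    · exact hp0
    · exact hs.trans (by rw [hp0, mul_zero]; rfl)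
  have hcomp : ∀ {f : Plane → ℝ}, DifferentiableAt ℝ f (x t) →
      HasDerivAt (fun r => f (x r)) (p * partialDeriv 0 f (x t) + T (x t) * p *
        partialDeriv 1 f (x t)) t := by
    intro f hf
    have := hf.hasFDerivAt.comp_hasDerivAt t hx1
    rw [fderiv_apply_eq_partialDeriv, hs] at this
    exact this
  -- the derivative of the metric in the position, at fixed velocity
  have hGd : ∀ w, fderiv ℝ G (x t) w (deriv x t) (deriv x t) =
      p ^ 2 * fderiv ℝ E (x t) w + (T (x t) * p) ^ 2 * fderiv ℝ F (x t) w := by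
    intro w
    rw [fderiv_diag hG hE hF hEF, hs]
  have hxc : ContinuousAt x t := hx.continuousAt
  have hP0 := h (stdVec 0)
  have hP1 := h (stdVec 1)
  rw [hGd] at hP0 hP1
  have hev' := hxc.eventually hEF
  have key : (fun r => G (x r) (deriv x r) (stdVec 1) * E (x r)) =ᶠ[𝓝 t]
      fun r => G (x r) (deriv x r) (stdVec 0) * F (x r) * T (x r) := by
    filter_upwards [hev', hslope] with r hr hr'
    rw [hr, hr, hr']
    simp [stdVec]
    ring
  have hL := (hP1.mul (hcomp hE)).congr_of_eventuallyEq key.symm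
  have huniq := hL.unique ((hP0.mul (hcomp hF)).mul (hcomp hT))
  have hv0 : G (x t) (deriv x t) (stdVec 0) = E (x t) * p := by
    rw [hEF.self_of_nhds]; simp [stdVec, hp]
  have hv1 : G (x t) (deriv x t) (stdVec 1) = F (x t) * (T (x t) * p) := by
    rw [hEF.self_of_nhds, hs]; simp [stdVec]
  rw [Pi.mul_apply, hv0, hv1] at huniq
  simp only [partialDeriv] at huniq ⊢
  have hp2 : p ^ 2 ≠ 0 := pow_ne_zero _ hp0
  apply mul_left_cancel₀ hp2
  linarith

variable {M : Type*} [TopologicalSpace M] [ChartedSpace Plane M]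
variable {D : DirField M} {ψ : OpenPartialHomeomorph M Plane}

theorem HasDirAt.of_scaling {χ : OpenPartialHomeomorph M Plane} {y : M} {a : Fin 2 → ℝ} {u : Plane}
    (h : HasDirAt ψ D y u) (hd : ∀ v i, coordDeriv χ y v i = a i * coordDeriv ψ y v i) :
    HasDirAt χ D y !₂[a 0 * u 0, a 1 * u 1] := by
  have := h.of_comp (χ := χ) (pairCLM fun i => a i • (EuclideanSpace.proj i : Plane →L[ℝ] ℝ))
    (fun v => by ext i; rw [hd]; rfl)
  convert this using 1
  ext i
  fin_cases i <;> simp [pairCLM_apply]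

variable [IsManifold 𝓘(ℝ, Plane) ∞ M] {g : Metric M} {G₁ G₂ N₁ N₂ : DirField M} {U : Set M}
variable {φ : OpenPartialHomeomorph M Plane} {E F T : Plane → ℝ} {x : M}

/-- The slope equation for the foliations with geodesic leaves. -/
theorem HasGeodesicLeavesOn.slope_eq (hD : HasGeodesicLeavesOn g D U) (hφ : IsCoord φ)
    (hφU : φ.source ⊆ U) (hx : x ∈ φ.source) (hE : DifferentiableAt ℝ E (φ x))
    (hF : DifferentiableAt ℝ F (φ x)) (hT : DifferentiableAt ℝ T (φ x))
    (hEF : ∀ y ∈ φ.target, ∀ v w, coordForm g.inner φ y v w =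
      E y * (v 0 * w 0) + F y * (v 1 * w 1))
    (hdir : ∀ y ∈ φ.source, HasDirAt φ D y !₂[1, T (φ y)]) :
    (partialDeriv 1 E (φ x) + T (φ x) ^ 2 * partialDeriv 1 F (φ x)) * E (φ x) / 2 +
        F (φ x) * T (φ x) * (partialDeriv 0 E (φ x) + T (φ x) * partialDeriv 1 E (φ x)) =
      (partialDeriv 0 E (φ x) + T (φ x) ^ 2 * partialDeriv 0 F (φ x)) * F (φ x) * T (φ x) / 2 +
        E (φ x) * ((partialDeriv 0 F (φ x) + T (φ x) * partialDeriv 1 F (φ x)) * T (φ x) +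
          F (φ x) * (partialDeriv 0 T (φ x) + T (φ x) * partialDeriv 1 T (φ x))) := by
  obtain ⟨ε, hε, c, rfl, hc, hcD⟩ := hD x (hφU hx)
  have h0 : (0 : ℝ) ∈ Ioo (-ε) ε := ⟨by linarith, hε⟩
  have hy := φ.map_source hx
  refine IsExtremalAt.slope_eq (hc.isExtremalAt hφ h0 hx) (hφ.differentiableAt_metric g hy)
    (contDiffAt_coord_comp hφ isOpen_Ioo hc.1 h0 hx) hE hF hT ?_ ?_ ?_
  · filter_upwards [φ.open_target.mem_nhds hy] with y hy using hEF y hy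
  · have h1 : ∀ᶠ t in 𝓝 (0 : ℝ), c t ∈ φ.source :=
      (hc.continuousAt isOpen_Ioo h0).preimage_mem_nhds (φ.open_source.mem_nhds hx)
    filter_upwards [h1, isOpen_Ioo.mem_nhds h0] with t ht ht'
    rw [deriv_coord_comp hφ (hc.mdifferentiableAt isOpen_Ioo ht') ht]
    obtain ⟨k, hk⟩ := (hdir _ ht).coordDeriv_mem (hcD t ht').2.2
    rw [hk]
    simp [mul_comm]
  · rw [deriv_coord_comp hφ (hc.mdifferentiableAt isOpen_Ioo h0) hx]
    intro h
    exact (hcD 0 h0).2.1 (hφ.injective hx (h.trans (map_zero _).symm))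

/-- If `a i` depends only on the `i`-th coordinate, the forms `a 0 du` and `a 1 dv` are the
differentials of new coordinates. -/
theorem exists_coord_of_scaling (hψ : IsCoord ψ) (hx : x ∈ ψ.source) {a : Fin 2 → Plane → ℝ}
    (ha : ∀ i, ContDiffOn ℝ ∞ (a i) ψ.target) (ha0 : ∀ i, ∀ y ∈ ψ.target, a i y ≠ 0)
    (had : ∀ i j, i ≠ j → ∀ y ∈ ψ.target, partialDeriv j (a i) y = 0) :
    ∃ χ : OpenPartialHomeomorph M Plane, IsCoord χ ∧ x ∈ χ.source ∧ χ.source ⊆ ψ.source ∧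
      ∀ y ∈ χ.source, ∀ v i, coordDeriv χ y v i = a i (ψ y) * coordDeriv ψ y v i := by
  obtain ⟨χ, hχ, hxχ, hχψ, hd⟩ := exists_coord_of_closed_forms hψ hx ψ.open_target
    (ψ.map_source hx) (w := fun i y => a i y • (EuclideanSpace.proj i : Plane →L[ℝ] ℝ))
    (fun i => (ha i).smul contDiffOn_const)
    (by
      intro i y hy u v
      have h1 : DifferentiableAt ℝ (a i) y :=
        ((ha i).contDiffAt (ψ.open_target.mem_nhds hy)).differentiableAt (by simp)
      rw [(h1.hasFDerivAt.smul_const (EuclideanSpace.proj i : Plane →L[ℝ] ℝ)).fderiv]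
      change fderiv ℝ (a i) y u * v i = fderiv ℝ (a i) y v * u i
      rw [fderiv_apply_eq_partialDeriv, fderiv_apply_eq_partialDeriv]
      obtain rfl | rfl : i = 0 ∨ i = 1 := by omega
      · rw [had 0 1 (by decide) y hy]; ring
      · rw [had 1 0 (by decide) y hy]; ring)
    (by
      intro y hy v hv
      ext i
      have h1 : a i y * v i = 0 := hv i
      exact (mul_eq_zero.1 h1).resolve_left (ha0 i y hy))
  exact ⟨χ, hχ, hxχ, fun y hy => (hχψ y hy).1, fun y hy v i => hd y hy v i⟩

end

/-! ### Parallelizing coordinates and isothermal coordinates -/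

section

variable {M : Type*} [TopologicalSpace M] [ChartedSpace Plane M]
/-- The restriction of a coordinate system to an open set. -/
theorem IsCoord.restr {ψ : OpenPartialHomeomorph M Plane} (hψ : IsCoord ψ) {V : Set M}
    (hV : IsOpen V) : IsCoord (ψ.restr V) :=
  restr_mem_maximalAtlas (contDiffGroupoid ∞ 𝓘(ℝ, Plane)) hψ hV

variable [IsManifold 𝓘(ℝ, Plane) ∞ M] {g : Metric M} {G₁ G₂ N₁ N₂ : DirField M} {U : Set M}
variable {ψ : OpenPartialHomeomorph M Plane} {x : M}

theorem coordForm_eq_of_diag (h : ∀ y ∈ ψ.target, coordForm g.inner ψ y (stdVec 0) (stdVec 1) = 0)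
    {y : Plane} (hy : y ∈ ψ.target) (v w : Plane) : coordForm g.inner ψ y v w =
      coordForm g.inner ψ y (stdVec 0) (stdVec 0) * (v 0 * w 0) +
      coordForm g.inner ψ y (stdVec 1) (stdVec 1) * (v 1 * w 1) := by
  have h1 := h y hy
  have h2 := h1
  rw [coordForm_symm] at h2
  conv_lhs => rw [eq_stdVec v, eq_stdVec w]
  simp only [map_add, map_smul, add_apply, smul_apply, smul_eq_mul, h1, h2]
  ring

/-- Coordinates parallelizing the 4-web are orthogonal. -/
theorem IsParallelizedBy.coordForm_offdiag (hG : IsGeodesicNetOn g G₁ G₂ U)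
    (hN : IsBisectorNetOn g G₁ G₂ N₁ N₂ U) (hψ : IsCoord ψ) (hψU : ψ.source ⊆ U)
    (hp : IsParallelizedBy ψ G₁ G₂ N₁ N₂) {y : Plane} (hy : y ∈ ψ.target) :
    coordForm g.inner ψ y (stdVec 0) (stdVec 1) = 0 := by
  obtain ⟨z, hz, rfl⟩ : ∃ z ∈ ψ.source, ψ z = y := ⟨ψ.symm y, ψ.map_target hy, ψ.right_inv hy⟩
  obtain ⟨a, b, hab, haa, hbb, hW⟩ := exists_frame hG hN (hψU hz)
  have h2 := (hp z hz 2).span_eq (hasDirAt_of_eq_span (φ := ψ) (hW 2))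
  have h3 := (hp z hz 3).span_eq (hasDirAt_of_eq_span (φ := ψ) (hW 3))
  obtain ⟨k, hk⟩ := Submodule.mem_span_singleton.1 (h2 ▸ Submodule.mem_span_singleton_self _)
  obtain ⟨l, hl⟩ := Submodule.mem_span_singleton.1 (h3 ▸ Submodule.mem_span_singleton_self _)
  have e0 : webModel 2 = stdVec 0 := by ext i; fin_cases i <;> simp [webModel, stdVec]
  have e1 : webModel 3 = stdVec 1 := by ext i; fin_cases i <;> simp [webModel, stdVec]
  have hc := coordForm_coordDeriv hψ g.inner hz
    (webCoeff 2 0 • a + webCoeff 2 1 • b) (webCoeff 3 0 • a + webCoeff 3 1 • b)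
  rw [e0] at hk
  rw [e1] at hl
  have horth : ∀ B : Plane →L[ℝ] Plane →L[ℝ] ℝ, B a a = 1 → B b b = 1 → B a b = B b a →
      B (webCoeff 2 0 • a + webCoeff 2 1 • b) (webCoeff 3 0 • a + webCoeff 3 1 • b) = 0 := by
    intro B h1 h2 h3
    simp [webCoeff, h1, h2, h3]
  have hc' := hc.trans (horth _ haa hbb (g.symm z a b))
  rw [← hk, ← hl, map_smul, map_smul, smul_apply, hc', smul_zero, smul_zero]

/-- In parallelizing coordinates the metric is `E du² + F dv²`, and the geodesic directions have the
slopes `±1`. The slope equations say that `E² / (E + F)` depends only on `u` and `F² / (E + F)`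
only on `v`. The fourth roots of these functions serve to rescale `du` and `dv`, which leads to
isothermal coordinates with the conformal factor `√(E + F)`. -/
theorem isConformallyFlat_of_parallelized (hG : IsGeodesicNetOn g G₁ G₂ U)
    (hN : IsBisectorNetOn g G₁ G₂ N₁ N₂ U) (hψ : IsCoord ψ) (hx : x ∈ ψ.source)
    (hψU : ψ.source ⊆ U) (hp : IsParallelizedBy ψ G₁ G₂ N₁ N₂) :
    ∃ χ : OpenPartialHomeomorph M Plane, IsCoord χ ∧ x ∈ χ.source ∧ χ.source ⊆ U ∧
    IsIsothermal g χ ∧ ∀ y ∈ χ.source,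
      HasDirAt χ N₁ y (stdVec 0) ∧ HasDirAt χ N₂ y (stdVec 1) := by
  set E : Plane → ℝ := fun y => coordForm g.inner ψ y (stdVec 0) (stdVec 0) with hE
  set F : Plane → ℝ := fun y => coordForm g.inner ψ y (stdVec 1) (stdVec 1) with hF
  have hdiag : ∀ y ∈ ψ.target, ∀ v w, coordForm g.inner ψ y v w =
      E y * (v 0 * w 0) + F y * (v 1 * w 1) := fun y hy v w =>
    coordForm_eq_of_diag (fun y hy => hp.coordForm_offdiag hG hN hψ hψU hy) hy v w
  have hEs : ContDiffOn ℝ ∞ E ψ.target :=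
    ((hψ.contDiffOn_metric g).clm_apply contDiffOn_const).clm_apply contDiffOn_const
  have hFs : ContDiffOn ℝ ∞ F ψ.target :=
    ((hψ.contDiffOn_metric g).clm_apply contDiffOn_const).clm_apply contDiffOn_const
  have hEpos : ∀ y ∈ ψ.target, 0 < E y := fun y hy => hψ.coordForm_pos g hy (by simp [stdVec])
  have hFpos : ∀ y ∈ ψ.target, 0 < F y := fun y hy => hψ.coordForm_pos g hy (by simp [stdVec])
  have hEd : ∀ y ∈ ψ.target, DifferentiableAt ℝ E y := fun y hy =>
    (hEs.contDiffAt (ψ.open_target.mem_nhds hy)).differentiableAt (by simp)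
  have hFd : ∀ y ∈ ψ.target, DifferentiableAt ℝ F y := fun y hy =>
    (hFs.contDiffAt (ψ.open_target.mem_nhds hy)).differentiableAt (by simp)
  have hR : ContDiffOn ℝ ∞ (fun y => √(E y + F y)) ψ.target :=
    (hEs.add hFs).sqrt fun y hy => (add_pos (hEpos y hy) (hFpos y hy)).ne'
  have hRpos : ∀ y ∈ ψ.target, 0 < √(E y + F y) := fun y hy =>
    Real.sqrt_pos.2 (add_pos (hEpos y hy) (hFpos y hy))
  -- the slopes `1` and `-1` of the two geodesic foliations
  have hids : ∀ y ∈ ψ.target,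
      E y * partialDeriv 1 E y + 2 * F y * partialDeriv 1 E y = E y * partialDeriv 1 F y ∧
      F y * partialDeriv 0 E y = F y * partialDeriv 0 F y + 2 * E y * partialDeriv 0 F y := by
    intro y hy
    obtain ⟨z, hz, rfl⟩ : ∃ z ∈ ψ.source, ψ z = y := ⟨ψ.symm y, ψ.map_target hy, ψ.right_inv hy⟩
    have h1 := hG.geodesic₁.slope_eq hψ hψU hz (hEd _ hy) (hFd _ hy)
      (T := fun _ => 1) (differentiableAt_const _) hdiag (fun y hy => hp y hy 0)
    have h2 := hG.geodesic₂.slope_eq hψ hψU hz (hEd _ hy) (hFd _ hy)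
      (T := fun _ => -1) (differentiableAt_const _) hdiag (fun y hy => hp y hy 1)
    simp only [partialDeriv, fderiv_fun_const, Pi.zero_apply, zero_apply] at h1 h2
    constructor <;> linarith
  have h0s : ContDiffOn ℝ ∞ (fun y => √(E y / √(E y + F y))) ψ.target :=
    (hEs.div hR fun y hy => (hRpos y hy).ne').sqrt
      fun y hy => (div_pos (hEpos y hy) (hRpos y hy)).ne'
  have h1s : ContDiffOn ℝ ∞ (fun y => √(F y / √(E y + F y))) ψ.target :=
    (hFs.div hR fun y hy => (hRpos y hy).ne').sqrt
      fun y hy => (div_pos (hFpos y hy) (hRpos y hy)).ne'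
  have h0pos : ∀ y ∈ ψ.target, 0 < √(E y / √(E y + F y)) := fun y hy =>
    Real.sqrt_pos.2 (div_pos (hEpos y hy) (hRpos y hy))
  have h1pos : ∀ y ∈ ψ.target, 0 < √(F y / √(E y + F y)) := fun y hy =>
    Real.sqrt_pos.2 (div_pos (hFpos y hy) (hRpos y hy))
  obtain ⟨χ, hχ, hxχ, hχψ, hd⟩ := exists_coord_of_scaling hψ hx
    (a := fun i y => (![√(E y / √(E y + F y)), √(F y / √(E y + F y))] : Fin 2 → ℝ) i)
    (by
      intro i
      fin_cases i
      · exact h0s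
      · exact h1s)
    (by
      intro i y hy
      fin_cases i
      · exact (h0pos y hy).ne'
      · exact (h1pos y hy).ne')
    (by
      intro i j hij y hy
      have hP := ((hEd y hy).hasFDerivAt.add (hFd y hy).hasFDerivAt)
      have hpow : ∀ {p : ℝ}, 0 < p → ∀ z ∈ ψ.target, √(p / √(E z + F z)) ^ 4 * (E z + F z) = p ^ 2 := by
        intro p hp z hz
        have h1 := hRpos z hz
        have h2 : √(E z + F z) ^ 2 = E z + F z :=
          Real.sq_sqrt (add_pos (hEpos z hz) (hFpos z hz)).le
        have h3 : √(p / √(E z + F z)) ^ 2 = p / √(E z + F z) := Real.sq_sqrt (by positivity)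
        calc √(p / √(E z + F z)) ^ 4 * (E z + F z) = (√(p / √(E z + F z)) ^ 2) ^ 2 * (E z + F z) := by
              ring
          _ = p ^ 2 := by rw [h3, div_pow, h2, div_mul_cancel₀ _ (add_pos (hEpos z hz) (hFpos z hz)).ne']
      have hnh := ψ.open_target.mem_nhds hy
      obtain ⟨rfl, rfl⟩ | ⟨rfl, rfl⟩ : (i = 0 ∧ j = 1) ∨ (i = 1 ∧ j = 0) := by omega
      · refine fderiv_eq_zero_of_pow_mul_eq (n := 4) (by norm_num)
          ((h0s.contDiffAt hnh).differentiableAt (by simp)) hP ((hEd y hy).hasFDerivAt.pow 2)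
          (Filter.mem_of_superset hnh fun z hz => hpow (hEpos z hz) z hz)
          (h0pos y hy).ne' (add_pos (hEpos y hy) (hFpos y hy)).ne' ?_
        have := (hids y hy).1
        simp only [partialDeriv, Pi.add_apply, add_apply, smul_apply, smul_eq_mul, nsmul_eq_mul] at this ⊢
        norm_num
        linear_combination E y * this
      · refine fderiv_eq_zero_of_pow_mul_eq (n := 4) (by norm_num)
          ((h1s.contDiffAt hnh).differentiableAt (by simp)) hP ((hFd y hy).hasFDerivAt.pow 2)
          (Filter.mem_of_superset hnh fun z hz => hpow (hFpos z hz) z hz)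
          (h1pos y hy).ne' (add_pos (hEpos y hy) (hFpos y hy)).ne' ?_
        have := (hids y hy).2
        simp only [partialDeriv, Pi.add_apply, add_apply, smul_apply, smul_eq_mul, nsmul_eq_mul] at this ⊢
        norm_num
        linear_combination -F y * this)
  refine ⟨χ, hχ, hxχ, hχψ.trans hψU, ?_, ?_⟩
  · -- rescaling `du` by `√(E / √(E + F))` divides `E` by `E / √(E + F)`; likewise for `F`
    refine ⟨fun z => √(E (ψ (χ.symm z)) + F (ψ (χ.symm z))), fun z hz v w => ?_⟩
    obtain ⟨y, hy, rfl⟩ : ∃ y ∈ χ.source, χ y = z := ⟨χ.symm z, χ.map_target hz, χ.right_inv hz⟩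
    obtain ⟨v, rfl⟩ : ∃ v', coordDeriv χ y v' = v := ⟨_, hχ.coordDeriv_symm' hy v⟩
    obtain ⟨w, rfl⟩ : ∃ w', coordDeriv χ y w' = w := ⟨_, hχ.coordDeriv_symm' hy w⟩
    have h1 := (coordForm_coordDeriv hχ g.inner hy v w).trans
      (coordForm_coordDeriv hψ g.inner (hχψ hy) v w).symm
    have hy' := ψ.map_source (hχψ hy)
    rw [inCoord_eq, h1, hdiag _ hy']
    beta_reduce
    rw [χ.left_inv hy]
    simp only [PiLp.inner_apply, Fin.sum_univ_two, hd y hy, RCLike.inner_apply, conj_trivial,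
      Matrix.cons_val_zero, Matrix.cons_val_one]
    have h2 := Real.sq_sqrt (div_pos (hEpos _ hy') (hRpos _ hy')).le
    have h3 := Real.sq_sqrt (div_pos (hFpos _ hy') (hRpos _ hy')).le
    rw [eq_div_iff (hRpos _ hy').ne'] at h2 h3
    linear_combination -(coordDeriv ψ y v 0 * coordDeriv ψ y w 0) * h2
      - (coordDeriv ψ y v 1 * coordDeriv ψ y w 1) * h3
  · intro y hy
    have hy' := ψ.map_source (hχψ hy)
    have hne : ∀ i : Fin 2, stdVec i ≠ 0 := fun i => by simp [stdVec]
    constructor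
    · refine ((hp y (hχψ hy) 2).of_scaling (hd y hy)).congr_span ?_
      rw [span_singleton_eq_iff _ (hne 0)]
      · simp [webModel, stdVec]
      · intro h
        exact (mul_ne_zero (h0pos _ hy').ne' (by simp [webModel] : webModel 2 0 ≠ 0))
          (congrArg (fun v : Plane => v 0) h)
    · refine ((hp y (hχψ hy) 3).of_scaling (hd y hy)).congr_span ?_
      rw [span_singleton_eq_iff _ (hne 1)]
      · simp [webModel, stdVec]
      · intro h
        exact (mul_ne_zero (h1pos _ hy').ne' (by simp [webModel] : webModel 3 1 ≠ 0))
          (congrArg (fun v : Plane => v 1) h)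

/-- Isothermal coordinates along the bisector net; the metric is `Λ (du² + dv²)`, and `T`, `-T`
are the slopes of the two geodesic foliations. -/
structure IsAdaptedCoord (g : Metric M) (G₁ G₂ N₁ N₂ : DirField M)
    (ψ : OpenPartialHomeomorph M Plane) (Λ T : Plane → ℝ) : Prop where
  isCoord : IsCoord ψ
  contDiffOn_factor : ContDiffOn ℝ ∞ Λ ψ.target
  contDiffOn_slope : ContDiffOn ℝ ∞ T ψ.target
  factor_pos : ∀ y ∈ ψ.target, 0 < Λ y
  slope_ne : ∀ y ∈ ψ.target, T y ≠ 0
  metric_eq : ∀ y ∈ ψ.target, ∀ v w, coordForm g.inner ψ y v w =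
    Λ y * (v 0 * w 0) + Λ y * (v 1 * w 1)
  dir₁ : ∀ y ∈ ψ.source, HasDirAt ψ G₁ y !₂[1, T (ψ y)]
  dir₂ : ∀ y ∈ ψ.source, HasDirAt ψ G₂ y !₂[1, -T (ψ y)]
  dir₃ : ∀ y ∈ ψ.source, HasDirAt ψ N₁ y (stdVec 0)
  dir₄ : ∀ y ∈ ψ.source, HasDirAt ψ N₂ y (stdVec 1)

/-- Since the directions of `N₁` and `N₂`, which are those of the coordinate axes, bisect the
angles between `G₁` and `G₂`, the reflection in an axis exchanges `G₁` and `G₂`. -/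
theorem exists_isAdaptedCoord (hG : IsGeodesicNetOn g G₁ G₂ U)
    (hN : IsBisectorNetOn g G₁ G₂ N₁ N₂ U) (hc : IsConformallyFlatOn g N₁ N₂ U) (hx : x ∈ U) :
    ∃ ψ Λ T, IsAdaptedCoord g G₁ G₂ N₁ N₂ ψ Λ T ∧ x ∈ ψ.source ∧ ψ.source ⊆ U := by
  obtain ⟨ψ₀, hψ₀, hxψ₀, hψ₀U, ⟨Λ, hΛ⟩, hdir⟩ := hc x hx
  obtain ⟨V, hV, hxV, hVU, X, hX, hXD⟩ := hG.foliation₁ x hx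
  obtain ⟨ψ, hψ, hsub, hsV, hxψ, hΛ, hdir⟩ : ∃ ψ, IsCoord ψ ∧ ψ.source ⊆ U ∧ ψ.source ⊆ V ∧
      x ∈ ψ.source ∧ (∀ y ∈ ψ.target, ∀ v w : Plane, inCoord g.inner ψ y v w = Λ y * inner ℝ v w) ∧
      ∀ y ∈ ψ.source, HasDirAt ψ N₁ y (stdVec 0) ∧ HasDirAt ψ N₂ y (stdVec 1) := by
    refine ⟨ψ₀.restr V, hψ₀.restr hV, ?_, ?_, ?_, ?_, ?_⟩
    · intro y hy; exact hψ₀U hy.1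
    · intro y hy; exact interior_subset hy.2
    · exact ⟨hxψ₀, by rwa [hV.interior_eq]⟩
    · intro y hy v w; exact hΛ y hy.1 v w
    · intro y hy; exact hdir y hy.1
  have hmetric : ∀ y ∈ ψ.target, ∀ v w, coordForm g.inner ψ y v w =
      Λ y * (v 0 * w 0) + Λ y * (v 1 * w 1) := by
    intro y hy v w
    rw [← inCoord_eq, hΛ y hy]
    simp only [PiLp.inner_apply, Fin.sum_univ_two, RCLike.inner_apply, conj_trivial]
    ring
  have hΛe : ∀ y ∈ ψ.target, Λ y = coordForm g.inner ψ y (stdVec 0) (stdVec 0) := by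
    intro y hy
    rw [hmetric y hy]
    simp [stdVec]
  set Y : Plane → Plane := fun y => coordDeriv ψ (ψ.symm y) (X (ψ.symm y)) with hYdef
  have hY : ContDiffOn ℝ ∞ Y ψ.target :=
    (hψ.contDiffOn_coordDeriv_field subset_rfl (hX.mono hsV)).mono
      fun y hy => ⟨hy, ψ.map_target hy⟩
  have hYd : ∀ y ∈ ψ.source, Y (ψ y) 0 ≠ 0 ∧ Y (ψ y) 1 ≠ 0 ∧ HasDirAt ψ G₁ y (Y (ψ y)) ∧
      HasDirAt ψ G₂ y !₂[Y (ψ y) 0, -Y (ψ y) 1] := by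
    intro y hy
    obtain ⟨a, b, hab, -, -, hW⟩ := exists_frame hG hN (hsub hy)
    have key : ∀ z, z = y → coordDeriv ψ z (X z) = coordDeriv ψ y (X y) := by rintro _ rfl; rfl
    have hY1 : Y (ψ y) = coordDeriv ψ y (X y) := key _ (ψ.left_inv hy)
    have hG1 : HasDirAt ψ G₁ y (Y (ψ y)) := by
      rw [hY1]
      exact hasDirAt_of_eq_span (hXD y (hsV hy)).2
    set α := coordDeriv ψ y a with hα
    set β := coordDeriv ψ y b with hβ
    have hj : ∀ j, HasDirAt ψ ((![G₁, G₂, N₁, N₂] : Fin 4 → DirField M) j) y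
        (webCoeff j 0 • α + webCoeff j 1 • β) := by
      intro j
      have := hasDirAt_of_eq_span (φ := ψ) (hW j)
      rwa [map_add, map_smul, map_smul] at this
    have h0 : HasDirAt ψ G₁ y α := by simpa [webCoeff] using hj 0
    have h1 : HasDirAt ψ G₂ y β := by simpa [webCoeff] using hj 1
    have h2 := (hdir y hy).1.span_eq (hj 2)
    have h3 := (hdir y hy).2.span_eq (hj 3)
    obtain ⟨k, hk⟩ := Submodule.mem_span_singleton.1 (h2 ▸ Submodule.mem_span_singleton_self _)
    obtain ⟨l, hl⟩ := Submodule.mem_span_singleton.1 (h3 ▸ Submodule.mem_span_singleton_self _)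
    have e0 := congrArg (fun v : Plane => v 0) hk
    have e1 := congrArg (fun v : Plane => v 1) hk
    have e2 := congrArg (fun v : Plane => v 0) hl
    have e3 := congrArg (fun v : Plane => v 1) hl
    simp [webCoeff, stdVec, ← sub_eq_add_neg] at e0 e1 e2 e3
    have hk0 : k ≠ 0 := by rintro rfl; simp at e0
    have hl0 : l ≠ 0 := by rintro rfl; simp at e3
    have f1 : β 1 = -α 1 := by linarith [(mul_eq_zero.1 ((mul_add k _ _).trans e1)).resolve_left hk0]
    have f2 : β 0 = α 0 := by linarith [e2.resolve_left hl0]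
    rw [f2] at e0
    rw [f1] at e3
    have hα0 : α 0 ≠ 0 := by intro h; rw [h] at e0; simp at e0
    have hα1 : α 1 ≠ 0 := by intro h; rw [h] at e3; simp at e3
    obtain ⟨m, hm⟩ := Submodule.mem_span_singleton.1
      ((h0.span_eq hG1) ▸ Submodule.mem_span_singleton_self α)
    have m0 : m * Y (ψ y) 0 = α 0 := congrArg (fun v : Plane => v 0) hm
    have m1 : m * Y (ψ y) 1 = α 1 := congrArg (fun v : Plane => v 1) hm
    have hY0 : Y (ψ y) 0 ≠ 0 := fun h => hα0 (by rw [← m0, h, mul_zero])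
    have hY1' : Y (ψ y) 1 ≠ 0 := fun h => hα1 (by rw [← m1, h, mul_zero])
    refine ⟨hY0, hY1', hG1, h1.congr_span ((span_singleton_eq_iff ?_ ?_).2 ?_)⟩
    · intro h; rw [h] at f2; exact hα0 f2.symm
    · intro h; exact hY0 (congrArg (fun v : Plane => v 0) h)
    · simp only [f1, f2, Matrix.cons_val_zero, Matrix.cons_val_one]
      rw [← m0, ← m1]; ring
  refine ⟨ψ, Λ, fun y => Y y 1 / Y y 0, ⟨hψ, ?_, ?_, ?_, ?_, hmetric, ?_, ?_,
    fun y hy => (hdir y hy).1, fun y hy => (hdir y hy).2⟩, hxψ, hsub⟩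
  · exact (((hψ.contDiffOn_metric g).clm_apply contDiffOn_const).clm_apply contDiffOn_const).congr
      hΛe
  · have hpr : ∀ i : Fin 2, ContDiffOn ℝ ∞ (fun y => Y y i) ψ.target := fun i =>
      (EuclideanSpace.proj i : Plane →L[ℝ] ℝ).contDiff.comp_contDiffOn hY
    refine (hpr 1).div (hpr 0) fun y hy => ?_
    have := (hYd _ (ψ.map_target hy)).1
    rwa [ψ.right_inv hy] at this
  · intro y hy
    rw [hΛe y hy]
    exact hψ.coordForm_pos g hy (by simp [stdVec])
  · intro y hy
    have := hYd _ (ψ.map_target hy)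
    rw [ψ.right_inv hy] at this
    exact div_ne_zero this.2.1 this.1
  · intro y hy
    obtain ⟨h0, -, h1, -⟩ := hYd y hy
    refine h1.congr_span ((span_singleton_eq_iff ?_ ?_).2 ?_)
    · intro h; exact h0 (congrArg (fun v : Plane => v 0) h)
    · intro h; exact one_ne_zero (congrArg (fun v : Plane => v 0) h)
    · simp only [Matrix.cons_val_zero, Matrix.cons_val_one]; field_simp
  · intro y hy
    obtain ⟨h0, -, -, h1⟩ := hYd y hy
    refine h1.congr_span ((span_singleton_eq_iff ?_ ?_).2 ?_)
    · intro h; exact h0 (congrArg (fun v : Plane => v 0) h)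
    · intro h; exact one_ne_zero (congrArg (fun v : Plane => v 0) h)
    · simp only [Matrix.cons_val_zero, Matrix.cons_val_one]; field_simp

namespace IsAdaptedCoord

variable {Λ T : Plane → ℝ}

theorem differentiableAt_factor (h : IsAdaptedCoord g G₁ G₂ N₁ N₂ ψ Λ T) {y : Plane}
    (hy : y ∈ ψ.target) : DifferentiableAt ℝ Λ y :=
  (h.contDiffOn_factor.contDiffAt (ψ.open_target.mem_nhds hy)).differentiableAt (by simp)

theorem differentiableAt_slope (h : IsAdaptedCoord g G₁ G₂ N₁ N₂ ψ Λ T) {y : Plane}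
    (hy : y ∈ ψ.target) : DifferentiableAt ℝ T y :=
  (h.contDiffOn_slope.contDiffAt (ψ.open_target.mem_nhds hy)).differentiableAt (by simp)

/-- The even and the odd part in `T` of the slope equation: both hold, since the slopes of the two
geodesic foliations are `T` and `-T`. -/
theorem slope_identities (h : IsAdaptedCoord g G₁ G₂ N₁ N₂ ψ Λ T) (hG : IsGeodesicNetOn g G₁ G₂ U)
    (hψU : ψ.source ⊆ U) {y : Plane} (hy : y ∈ ψ.target) :
    (1 + T y ^ 2) * partialDeriv 1 Λ y = 2 * Λ y * T y * partialDeriv 1 T y ∧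
    (1 + T y ^ 2) * partialDeriv 0 Λ y * T y = -2 * Λ y * partialDeriv 0 T y := by
  obtain ⟨z, hz, rfl⟩ : ∃ z ∈ ψ.source, ψ z = y := ⟨ψ.symm y, ψ.map_target hy, ψ.right_inv hy⟩
  have hΛ := h.differentiableAt_factor hy
  have hT := h.differentiableAt_slope hy
  have h1 := hG.geodesic₁.slope_eq h.isCoord hψU hz hΛ hΛ hT h.metric_eq h.dir₁
  have h2 := hG.geodesic₂.slope_eq h.isCoord hψU hz hΛ hΛ hT.neg h.metric_eq h.dir₂
  simp only [partialDeriv, fderiv_neg, Pi.neg_apply, neg_apply] at h1 h2 ⊢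
  have hpos := (h.factor_pos _ hy).ne'
  constructor <;> apply mul_left_cancel₀ hpos <;> linarith

/-- The functions `h = √((1 + T²) / Λ)` and `h / T` depend only on the first and only on the
second coordinate, respectively; `h du` and `(h / T) dv` give the parallelizing coordinates. -/
theorem exists_parallelized (h : IsAdaptedCoord g G₁ G₂ N₁ N₂ ψ Λ T)
    (hG : IsGeodesicNetOn g G₁ G₂ U) (hψU : ψ.source ⊆ U) (hx : x ∈ ψ.source) :
    ∃ χ : OpenPartialHomeomorph M Plane, IsCoord χ ∧ x ∈ χ.source ∧ χ.source ⊆ U ∧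
      IsParallelizedBy χ G₁ G₂ N₁ N₂ := by
  have hpos : ∀ y ∈ ψ.target, 0 < (1 + T y ^ 2) / Λ y := fun y hy =>
    div_pos (by positivity) (h.factor_pos y hy)
  have h0s : ContDiffOn ℝ ∞ (fun y => √((1 + T y ^ 2) / Λ y)) ψ.target :=
    (((contDiffOn_const (c := (1 : ℝ))).add (h.contDiffOn_slope.pow 2)).div h.contDiffOn_factor
      fun y hy => (h.factor_pos y hy).ne').sqrt fun y hy => (hpos y hy).ne'
  have h1s : ContDiffOn ℝ ∞ (fun y => √((1 + T y ^ 2) / Λ y) / T y) ψ.target :=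
    h0s.div h.contDiffOn_slope h.slope_ne
  have h00 : ∀ y ∈ ψ.target, √((1 + T y ^ 2) / Λ y) ≠ 0 := fun y hy =>
    (Real.sqrt_pos.2 (hpos y hy)).ne'
  have h10 : ∀ y ∈ ψ.target, √((1 + T y ^ 2) / Λ y) / T y ≠ 0 := fun y hy =>
    div_ne_zero (h00 y hy) (h.slope_ne y hy)
  have hsq : ∀ y ∈ ψ.target, √((1 + T y ^ 2) / Λ y) ^ 2 * Λ y = 1 + T y ^ 2 := by
    intro y hy
    rw [Real.sq_sqrt (hpos y hy).le, div_mul_cancel₀ _ (h.factor_pos y hy).ne']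
  obtain ⟨χ, hχ, hxχ, hχψ, hd⟩ := exists_coord_of_scaling h.isCoord hx
    (a := fun i y => (![√((1 + T y ^ 2) / Λ y), √((1 + T y ^ 2) / Λ y) / T y] : Fin 2 → ℝ) i)
    (by
      intro i
      fin_cases i
      · exact h0s
      · exact h1s)
    (by
      intro i y hy
      fin_cases i
      · exact h00 y hy
      · exact h10 y hy)
    (by
      intro i j hij y hy
      have hnh := ψ.open_target.mem_nhds hy
      have hΛ := (h.differentiableAt_factor hy).hasFDerivAt
      have hT := (h.differentiableAt_slope hy).hasFDerivAt
      have hQ := (hT.pow 2).const_add 1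
      have hids := h.slope_identities hG hψU hy
      obtain ⟨rfl, rfl⟩ | ⟨rfl, rfl⟩ : (i = 0 ∧ j = 1) ∨ (i = 1 ∧ j = 0) := by omega
      · refine fderiv_eq_zero_of_pow_mul_eq (n := 2) (by norm_num)
          ((h0s.contDiffAt hnh).differentiableAt (by simp)) hΛ hQ
          (Filter.mem_of_superset hnh hsq) (h00 y hy) (h.factor_pos y hy).ne' ?_
        have := hids.1
        simp only [partialDeriv, smul_apply, smul_eq_mul, nsmul_eq_mul] at this ⊢
        norm_num
        linear_combination -this
      · refine fderiv_eq_zero_of_pow_mul_eq (n := 2) (by norm_num)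
          ((h1s.contDiffAt hnh).differentiableAt (by simp)) (hΛ.mul (hT.pow 2)) hQ
          (Filter.mem_of_superset hnh fun z hz => ?_) (h10 y hy)
          (mul_ne_zero (h.factor_pos y hy).ne' (pow_ne_zero 2 (h.slope_ne y hy))) ?_
        · have h1 := hsq z hz
          have h2 := h.slope_ne z hz
          change (√((1 + T z ^ 2) / Λ z) / T z) ^ 2 * (Λ z * T z ^ 2) = 1 + T z ^ 2
          generalize √((1 + T z ^ 2) / Λ z) = r at h1 ⊢
          rw [← h1]
          field_simp
        · have := hids.2
          simp only [partialDeriv, Pi.mul_apply, add_apply, smul_apply, smul_eq_mul,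
            nsmul_eq_mul] at this ⊢
          norm_num
          linear_combination -T y * this)
  refine ⟨χ, hχ, hxχ, hχψ.trans hψU, fun y hy j => ?_⟩
  have hy' := ψ.map_source (hχψ hy)
  have hT := h.slope_ne _ hy'
  have hj : ∀ j, HasDirAt ψ ((![G₁, G₂, N₁, N₂] : Fin 4 → DirField M) j) y
      ((![!₂[1, T (ψ y)], !₂[1, -T (ψ y)], stdVec 0, stdVec 1] : Fin 4 → Plane) j) := by
    intro j
    fin_cases j
    · exact h.dir₁ y (hχψ hy)
    · exact h.dir₂ y (hχψ hy)
    · exact h.dir₃ y (hχψ hy)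
    · exact h.dir₄ y (hχψ hy)
  have a0 := h00 _ hy'
  have hs := (hj j).of_scaling (hd y hy)
  simp only [Matrix.cons_val_zero, Matrix.cons_val_one] at hs
  generalize √((1 + T (ψ y) ^ 2) / Λ (ψ y)) = r at hs a0
  generalize T (ψ y) = τ at hs hT
  refine hs.congr_span ((span_singleton_eq_iff ?_ (webModel_ne_zero j)).2 ?_)
  · intro hz
    have z0 := congrArg (fun v : Plane => v 0) hz
    have z1 := congrArg (fun v : Plane => v 1) hz
    fin_cases j <;> simp [stdVec, a0, hT] at z0 z1
  · fin_cases j <;> simp [stdVec, webModel, hT]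

end IsAdaptedCoord

end

/-! ### The integral of a geodesic net with conformally flat bisector net -/

section

variable {M : Type*} [TopologicalSpace M] [ChartedSpace Plane M]
variable {ψ : OpenPartialHomeomorph M Plane} {P Q : Plane → ℝ}

/-- The field of bilinear forms `P du² + Q dv²`, where `u`, `v` are the coordinates `ψ`. -/
def diagField (ψ : OpenPartialHomeomorph M Plane) (P Q : Plane → ℝ) : BilinField M := fun x =>
  let e : Fin 2 → Plane →L[ℝ] ℝ := fun i => (EuclideanSpace.proj i).comp (coordDeriv ψ x)
  show Plane →L[ℝ] Plane →L[ℝ] ℝ from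
    P (ψ x) • (e 0).smulRight (e 0) + Q (ψ x) • (e 1).smulRight (e 1)

theorem diagField_apply (x : M) (v w : Plane) :
    (diagField ψ P Q x : Plane →L[ℝ] Plane →L[ℝ] ℝ) v w =
      P (ψ x) * (coordDeriv ψ x v 0 * coordDeriv ψ x w 0) +
      Q (ψ x) * (coordDeriv ψ x v 1 * coordDeriv ψ x w 1) := rfl

theorem coordForm_diagField (hψ : IsCoord ψ) {y : Plane} (hy : y ∈ ψ.target) (v w : Plane) :
    coordForm (diagField ψ P Q) ψ y v w = P y * (v 0 * w 0) + Q y * (v 1 * w 1) := by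
  have h := diagField_apply (ψ := ψ) (P := P) (Q := Q) (ψ.symm y) (coordDerivSymm ψ y v)
    (coordDerivSymm ψ y w)
  rw [hψ.coordDeriv_symm hy, hψ.coordDeriv_symm hy, ψ.right_inv hy] at h
  exact h

theorem contDiffOn_coordForm_diagField (hψ : IsCoord ψ) (hP : ContDiffOn ℝ ∞ P ψ.target)
    (hQ : ContDiffOn ℝ ∞ Q ψ.target) :
    ContDiffOn ℝ ∞ (coordForm (diagField ψ P Q) ψ) ψ.target := by
  refine contDiffOn_clm_apply.2 fun v => contDiffOn_clm_apply.2 fun w => ?_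
  exact ((hP.mul contDiffOn_const).add (hQ.mul contDiffOn_const)).congr
    fun y hy => coordForm_diagField hψ hy v w

variable [IsManifold 𝓘(ℝ, Plane) ∞ M] {g : Metric M} {G₁ G₂ N₁ N₂ : DirField M} {U : Set M}
variable {Λ T : Plane → ℝ}

namespace IsAdaptedCoord

/-- Liouville's form of the metric: `Λ = A + B`, where `A = Λ / (1 + T²)` depends only on the first
coordinate and `B = Λ T² / (1 + T²)` only on the second. -/
theorem partialDeriv_liouville (h : IsAdaptedCoord g G₁ G₂ N₁ N₂ ψ Λ T)
    (hG : IsGeodesicNetOn g G₁ G₂ U) (hψU : ψ.source ⊆ U) {y : Plane} (hy : y ∈ ψ.target) :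
    DifferentiableAt ℝ (fun y => Λ y * T y ^ 2 / (1 + T y ^ 2)) y ∧
    partialDeriv 0 (fun y => Λ y * T y ^ 2 / (1 + T y ^ 2)) y = 0 ∧
    partialDeriv 1 (fun y => Λ y * T y ^ 2 / (1 + T y ^ 2)) y = partialDeriv 1 Λ y := by
  have hne : ∀ z, 1 + T z ^ 2 ≠ 0 := fun z => by positivity
  have hΛ := h.differentiableAt_factor hy
  have hT := h.differentiableAt_slope hy
  have hB : DifferentiableAt ℝ (fun y => Λ y * T y ^ 2 / (1 + T y ^ 2)) y := by
    simp only [div_eq_mul_inv]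
    exact (hΛ.fun_mul (hT.fun_pow 2)).fun_mul (((hT.fun_pow 2).const_add 1).fun_inv (hne y))
  have hids := h.slope_identities hG hψU hy
  have h1 : HasFDerivAt (fun y => Λ y * T y ^ 2 / (1 + T y ^ 2) * (1 + T y ^ 2)) _ y :=
    hB.hasFDerivAt.mul ((hT.hasFDerivAt.pow 2).const_add 1)
  have h2 : (fun y => Λ y * T y ^ 2 / (1 + T y ^ 2) * (1 + T y ^ 2)) = fun y => Λ y * T y ^ 2 :=
    funext fun z => div_mul_cancel₀ _ (hne z)
  rw [h2] at h1
  have h3 := fun w => congrArg (fun L : Plane →L[ℝ] ℝ => L w)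
    (h1.unique (hΛ.hasFDerivAt.mul (hT.hasFDerivAt.pow 2)))
  have h4 : Λ y * T y ^ 2 / (1 + T y ^ 2) * (1 + T y ^ 2) = Λ y * T y ^ 2 :=
    div_mul_cancel₀ _ (hne y)
  simp only [add_apply, smul_apply, smul_eq_mul, nsmul_eq_mul] at h3
  have h30 := h3 (stdVec 0)
  have h31 := h3 (stdVec 1)
  simp only [partialDeriv] at hids ⊢
  norm_num at h30 h31
  generalize Λ y * T y ^ 2 / (1 + T y ^ 2) = β at h30 h31 h4
  refine ⟨hB, ?_, ?_⟩
  · apply (mul_eq_zero.1 (?_ : (1 + T y ^ 2) ^ 2 * _ = 0)).resolve_left (pow_ne_zero 2 (hne y))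
    linear_combination (1 + T y ^ 2) * h30 - 2 * T y * fderiv ℝ T y (stdVec 0) * h4 +
      T y * hids.2
  · apply mul_left_cancel₀ (pow_ne_zero 2 (hne y))
    linear_combination (1 + T y ^ 2) * h31 - 2 * T y * fderiv ℝ T y (stdVec 1) * h4 - hids.1

/-- With `Λ = A + B` in Liouville's form, the integral is `Λ (B du² - A dv²)`, which equals
`B g(ξ, ξ) - p²` for the momentum `p = g(ξ, ∂/∂v)`. It is conserved: since `B` depends only on
`v` and `∂Λ/∂v = B'(v)`, its derivative along a geodesic is `B' v̇ g(ξ, ξ) - 2 p ṗ = 0`. -/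
theorem isQuadraticIntegralOn (h : IsAdaptedCoord g G₁ G₂ N₁ N₂ ψ Λ T)
    (hG : IsGeodesicNetOn g G₁ G₂ U) (hψU : ψ.source ⊆ U) :
    IsQuadraticIntegralOn g (diagField ψ (fun y => Λ y * T y ^ 2 / (1 + T y ^ 2) * Λ y)
      (fun y => Λ y * T y ^ 2 / (1 + T y ^ 2) * Λ y - Λ y ^ 2)) ψ.source := by
  set B : Plane → ℝ := fun y => Λ y * T y ^ 2 / (1 + T y ^ 2) with hBdef
  have hBs : ContDiffOn ℝ ∞ B ψ.target :=
    (h.contDiffOn_factor.mul (h.contDiffOn_slope.pow 2)).div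
      (contDiffOn_const.add (h.contDiffOn_slope.pow 2)) fun y _ => by positivity
  refine ⟨h.isCoord.contMDiffOn_of_coordForm (contDiffOn_coordForm_diagField h.isCoord
    (hBs.mul h.contDiffOn_factor) ((hBs.mul h.contDiffOn_factor).sub (h.contDiffOn_factor.pow 2))),
    ?_, ?_⟩
  · intro x _ v w
    refine (diagField_apply x v w).trans (Eq.trans ?_ (diagField_apply x w v).symm)
    ring
  · intro α β c hc hcU
    have hval : ∀ t ∈ Ioo α β, (diagField ψ (fun y => B y * Λ y) (fun y => B y * Λ y - Λ y ^ 2))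
        (c t) (velocity c t) (velocity c t) =
        B (ψ (c t)) * coordForm g.inner ψ (ψ (c t)) (deriv (fun r => ψ (c r)) t)
          (deriv (fun r => ψ (c r)) t) - (coordForm g.inner ψ (ψ (c t))
            (deriv (fun r => ψ (c r)) t) (stdVec 1)) ^ 2 := by
      intro t ht
      have hy := ψ.map_source (hcU t ht)
      rw [← coordForm_velocity h.isCoord _ (hc.mdifferentiableAt isOpen_Ioo ht) (hcU t ht),
        coordForm_diagField h.isCoord hy, h.metric_eq _ hy, h.metric_eq _ hy]
      simp [stdVec]
      ring
    have hder : ∀ t ∈ Ioo α β, HasDerivAt (fun t =>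
        B (ψ (c t)) * coordForm g.inner ψ (ψ (c t)) (deriv (fun r => ψ (c r)) t)
          (deriv (fun r => ψ (c r)) t) - (coordForm g.inner ψ (ψ (c t))
            (deriv (fun r => ψ (c r)) t) (stdVec 1)) ^ 2) 0 t := by
      intro t ht
      have hy := ψ.map_source (hcU t ht)
      have hx := contDiffAt_coord_comp h.isCoord isOpen_Ioo hc.1 ht (hcU t ht)
      have hex := hc.isExtremalAt h.isCoord ht (hcU t ht)
      have hGd := h.isCoord.differentiableAt_metric g hy
      have h1 := hex.hasDerivAt_energy hGd hx (coordForm_symm g ψ _)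
      have h2 := hex (stdVec 1)
      obtain ⟨hBd, hB0, hB1⟩ := h.partialDeriv_liouville hG hψU hy
      have h3 := hBd.hasFDerivAt.comp_hasDerivAt t (hx.differentiableAt (by simp)).hasDerivAt
      have h4 := (h3.mul h1).sub (h2.pow 2)
      refine h4.congr_deriv ?_
      rw [fderiv_apply_eq_partialDeriv, hB0, hB1, fderiv_diag hGd (h.differentiableAt_factor hy)
        (h.differentiableAt_factor hy) (Filter.mem_of_superset (ψ.open_target.mem_nhds hy)
          h.metric_eq), h.metric_eq _ hy, h.metric_eq _ hy]
      simp [stdVec]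
      ring
    intro t₁ ht₁ t₂ ht₂
    rw [hval t₁ ht₁, hval t₂ ht₂]
    exact isOpen_Ioo.is_const_of_deriv_eq_zero isPreconnected_Ioo
      (fun t ht => (hder t ht).differentiableAt.differentiableWithinAt)
      (fun t ht => (hder t ht).deriv) ht₁ ht₂

/-- The coefficients `Λ B` and `Λ B - Λ²` of the integral differ, those of `g` do not. -/
theorem admitsQuadraticIntegralNear (h : IsAdaptedCoord g G₁ G₂ N₁ N₂ ψ Λ T)
    (hG : IsGeodesicNetOn g G₁ G₂ U) (hψU : ψ.source ⊆ U) {m : M} (hm : m ∈ ψ.source) :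
    AdmitsQuadraticIntegralNear g m := by
  refine ⟨ψ.source, ψ.open_source, hm, _, h.isQuadraticIntegralOn hG hψU, ?_⟩
  rintro ⟨k, hk⟩
  have hy := ψ.map_source hm
  have hv : ∀ i : Fin 2, coordForm (diagField ψ (fun y => Λ y * T y ^ 2 / (1 + T y ^ 2) * Λ y)
      (fun y => Λ y * T y ^ 2 / (1 + T y ^ 2) * Λ y - Λ y ^ 2)) ψ (ψ m) (stdVec i) (stdVec i) =
      k * coordForm g.inner ψ (ψ m) (stdVec i) (stdVec i) := by
    intro i
    rw [← h.isCoord.coordDeriv_symm' hm (stdVec i)]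
    refine (coordForm_coordDeriv h.isCoord _ hm _ _).trans (Eq.trans ?_
      (congrArg (k * ·) (coordForm_coordDeriv h.isCoord _ hm _ _)).symm)
    rw [hk]
    rfl
  have h0 := hv 0
  have h1 := hv 1
  rw [coordForm_diagField h.isCoord hy, h.metric_eq _ hy] at h0 h1
  have e00 : stdVec 0 0 = 1 := by simp [stdVec]
  have e01 : stdVec 0 1 = 0 := by simp [stdVec]
  have e10 : stdVec 1 0 = 0 := by simp [stdVec]
  have e11 : stdVec 1 1 = 1 := by simp [stdVec]
  rw [e00, e01] at h0
  rw [e10, e11] at h1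
  have hΛ := pow_pos (h.factor_pos _ hy) 2
  linarith

end IsAdaptedCoord

end

/-! ### Eigenframes of a pair of quadratic forms -/

section

/-- A smooth frame of common eigenvectors of the symmetric forms `G` and `B`, orthogonal with
respect to both; its length is normalized by the difference of the eigenvalues `μ₁ < μ₂` of `B`
with respect to `G`. -/
structure IsEigenframe (G B : Plane → Plane →L[ℝ] Plane →L[ℝ] ℝ) (X₁ X₂ : Plane → Plane)
    (μ₁ μ₂ : Plane → ℝ) (W : Set Plane) : Prop where
  contDiffOn₁ : ContDiffOn ℝ ∞ X₁ W
  contDiffOn₂ : ContDiffOn ℝ ∞ X₂ W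
  contDiffOn_eigenvalue₁ : ContDiffOn ℝ ∞ μ₁ W
  contDiffOn_eigenvalue₂ : ContDiffOn ℝ ∞ μ₂ W
  lt : ∀ y ∈ W, μ₁ y < μ₂ y
  g₁₁ : ∀ y ∈ W, G y (X₁ y) (X₁ y) = μ₂ y - μ₁ y
  g₁₂ : ∀ y ∈ W, G y (X₁ y) (X₂ y) = 0
  g₂₂ : ∀ y ∈ W, G y (X₂ y) (X₂ y) = μ₂ y - μ₁ y
  b₁₁ : ∀ y ∈ W, B y (X₁ y) (X₁ y) = μ₁ y * (μ₂ y - μ₁ y)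
  b₁₂ : ∀ y ∈ W, B y (X₁ y) (X₂ y) = 0
  b₂₂ : ∀ y ∈ W, B y (X₂ y) (X₂ y) = μ₂ y * (μ₂ y - μ₁ y)

theorem IsEigenframe.mono {G B : Plane → Plane →L[ℝ] Plane →L[ℝ] ℝ} {X₁ X₂ : Plane → Plane}
    {μ₁ μ₂ : Plane → ℝ} {W W' : Set Plane} (h : IsEigenframe G B X₁ X₂ μ₁ μ₂ W) (hW : W' ⊆ W) :
    IsEigenframe G B X₁ X₂ μ₁ μ₂ W' :=
  ⟨h.contDiffOn₁.mono hW, h.contDiffOn₂.mono hW, h.contDiffOn_eigenvalue₁.mono hW,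
    h.contDiffOn_eigenvalue₂.mono hW, fun y hy => h.lt y (hW hy), fun y hy => h.g₁₁ y (hW hy),
    fun y hy => h.g₁₂ y (hW hy), fun y hy => h.g₂₂ y (hW hy), fun y hy => h.b₁₁ y (hW hy),
    fun y hy => h.b₁₂ y (hW hy), fun y hy => h.b₂₂ y (hW hy)⟩

variable {G B : Plane → Plane →L[ℝ] Plane →L[ℝ] ℝ} {W O : Set Plane} {y₀ : Plane}

/-- Gram–Schmidt orthonormalization of a pair of constant vectors. -/
theorem exists_orthonormal_frame (hG : ContDiffOn ℝ ∞ G O)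
    (hpos : ∀ y ∈ O, ∀ v, v ≠ 0 → 0 < G y v v) {w₁ w₂ : Plane} (hw : ∀ p q : ℝ, p • w₁ + q • w₂ = 0 → p = 0 ∧ q = 0) :
    ∃ f₁ f₂ : Plane → Plane, ContDiffOn ℝ ∞ f₁ O ∧ ContDiffOn ℝ ∞ f₂ O ∧
      (∀ y ∈ O, G y (f₁ y) (f₁ y) = 1 ∧ G y (f₁ y) (f₂ y) = 0 ∧ G y (f₂ y) (f₂ y) = 1) ∧
      ∀ y, G y w₁ w₁ = 1 → G y w₁ w₂ = 0 → G y w₂ w₂ = 1 → f₁ y = w₁ ∧ f₂ y = w₂ := by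
  have hs : ∀ v w : Plane, ContDiffOn ℝ ∞ (fun y => G y v w) O := fun v w =>
    (hG.clm_apply contDiffOn_const).clm_apply contDiffOn_const
  have hw₁ : w₁ ≠ 0 := by
    rintro rfl
    exact one_ne_zero (hw 1 0 (by simp)).1
  have h1 : ∀ y ∈ O, 0 < G y w₁ w₁ := fun y hy => hpos y hy _ hw₁
  have hu : ∀ y, G y w₁ w₁ • w₂ - G y w₁ w₂ • w₁ ≠ 0 ∨ G y w₁ w₁ = 0 := by
    intro y
    by_contra! h
    have := hw (-G y w₁ w₂) (G y w₁ w₁) (by rw [← h.1]; module)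
    exact h.2 this.2
  have h2 : ∀ y ∈ O, 0 < G y (G y w₁ w₁ • w₂ - G y w₁ w₂ • w₁)
      (G y w₁ w₁ • w₂ - G y w₁ w₂ • w₁) := fun y hy =>
    hpos y hy _ ((hu y).resolve_right (h1 y hy).ne')
  have hus : ContDiffOn ℝ ∞ (fun y => G y w₁ w₁ • w₂ - G y w₁ w₂ • w₁) O :=
    ((hs _ _).smul contDiffOn_const).sub ((hs _ _).smul contDiffOn_const)
  refine ⟨fun y => (√(G y w₁ w₁))⁻¹ • w₁, fun y =>
    (√(G y (G y w₁ w₁ • w₂ - G y w₁ w₂ • w₁) (G y w₁ w₁ • w₂ - G y w₁ w₂ • w₁)))⁻¹ •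
      (G y w₁ w₁ • w₂ - G y w₁ w₂ • w₁), ?_, ?_, ?_, ?_⟩
  · exact (((hs _ _).sqrt fun y hy => (h1 y hy).ne').inv
      fun y hy => (Real.sqrt_pos.2 (h1 y hy)).ne').smul contDiffOn_const
  · exact (((((hG.clm_apply hus).clm_apply hus).sqrt fun y hy => (h2 y hy).ne').inv
      fun y hy => (Real.sqrt_pos.2 (h2 y hy)).ne')).smul hus
  · intro y hy
    have hnorm : ∀ u : Plane, 0 < G y u u → G y ((√(G y u u))⁻¹ • u) ((√(G y u u))⁻¹ • u) = 1 := by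
      intro u hu
      simp only [map_smul, smul_apply, smul_eq_mul]
      have := Real.sq_sqrt hu.le
      have h3 := (Real.sqrt_pos.2 hu).ne'
      field_simp
      exact this.symm
    refine ⟨hnorm _ (h1 y hy), ?_, hnorm _ (h2 y hy)⟩
    simp only [map_smul, map_sub, smul_apply, sub_apply, smul_eq_mul]
    ring
  · intro y e1 e2 e3
    simp only [e1, e2, one_smul, zero_smul, sub_zero, e3, Real.sqrt_one, inv_one, and_self]

/-- Where `B` is not a multiple of `G`, an eigenframe is given by an explicit smooth formula: let
`p`, `q`, `r` be the components of `B` in a `G`-orthonormal frame, `s = (p - r) / 2`, and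
`ρ = √(s² + q²)`. The eigenvalues are `(p + r) / 2 ± ρ`, and for `τ = √(s + ρ)` the vectors with
components `(-q / τ, τ)` and `(τ, q / τ)` are eigenvectors of square length `2ρ`. -/
theorem exists_isEigenframe (hO : IsOpen O) (hy₀ : y₀ ∈ O) (hG : ContDiffOn ℝ ∞ G O)
    (hB : ContDiffOn ℝ ∞ B O) (hsymm : ∀ y ∈ O, ∀ v w, G y v w = G y w v)
    (hpos : ∀ y ∈ O, ∀ v, v ≠ 0 → 0 < G y v v) (hBsymm : ∀ y ∈ O, ∀ v w, B y v w = B y w v)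
    (hne : ¬ ∃ k : ℝ, B y₀ = k • G y₀) :
    ∃ W X₁ X₂ μ₁ μ₂, IsOpen W ∧ y₀ ∈ W ∧ W ⊆ O ∧ IsEigenframe G B X₁ X₂ μ₁ μ₂ W := by
  -- an orthonormal basis at `y₀`, ordered in such a way that the formula below is regular
  obtain ⟨w₁, w₂, h11, h12, h22, hw, hreg⟩ : ∃ w₁ w₂ : Plane, G y₀ w₁ w₁ = 1 ∧ G y₀ w₁ w₂ = 0 ∧
      G y₀ w₂ w₂ = 1 ∧ (∀ p q : ℝ, p • w₁ + q • w₂ = 0 → p = 0 ∧ q = 0) ∧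
      (B y₀ w₁ w₂ ≠ 0 ∨ B y₀ w₂ w₂ < B y₀ w₁ w₁) := by
    obtain ⟨f₁, f₂, -, -, hf, -⟩ := exists_orthonormal_frame hG hpos
      (w₁ := stdVec 0) (w₂ := stdVec 1) (by
        intro p q h
        have h0 := congrArg (fun v : Plane => v 0) h
        have h1 := congrArg (fun v : Plane => v 1) h
        simpa [stdVec] using And.intro h0 h1)
    obtain ⟨h11, h12, h22⟩ := hf y₀ hy₀
    generalize f₁ y₀ = w₁ at h11 h12 h22
    generalize f₂ y₀ = w₂ at h11 h12 h22
    have h21 : G y₀ w₂ w₁ = 0 := by rw [hsymm y₀ hy₀, h12]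
    have hw : ∀ p q : ℝ, p • w₁ + q • w₂ = 0 → p = 0 ∧ q = 0 := by
      intro p q h
      have e1 := congrArg (fun v => G y₀ v w₁) h
      have e2 := congrArg (fun v => G y₀ v w₂) h
      simpa [h11, h12, h21, h22] using And.intro e1 e2
    by_cases hq : B y₀ w₁ w₂ = 0
    · rcases lt_trichotomy (B y₀ w₁ w₁) (B y₀ w₂ w₂) with h | h | h
      · exact ⟨w₂, w₁, h22, h21, h11, fun p q hpq => (hw q p (by rw [add_comm, hpq])).symm,
          Or.inr h⟩
      · exfalso
        apply hne
        refine ⟨B y₀ w₁ w₁, ?_⟩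
        ext v w
        obtain ⟨p, q, rfl⟩ := exists_eq_frame hw v
        obtain ⟨p', q', rfl⟩ := exists_eq_frame hw w
        have hq' : B y₀ w₂ w₁ = 0 := by rw [hBsymm y₀ hy₀, hq]
        simp [h11, h12, h21, h22, hq, hq', ← h]
        ring
      · exact ⟨w₁, w₂, h11, h12, h22, hw, Or.inr h⟩
    · exact ⟨w₁, w₂, h11, h12, h22, hw, Or.inl hq⟩
  obtain ⟨f₁, f₂, hf₁, hf₂, hf, hf0⟩ := exists_orthonormal_frame hG hpos hw
  obtain ⟨e1, e2⟩ := hf0 y₀ h11 h12 h22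
  -- the components of `B` in the orthonormal frame
  set p : Plane → ℝ := fun y => B y (f₁ y) (f₁ y) with hp
  set q : Plane → ℝ := fun y => B y (f₁ y) (f₂ y) with hq
  set r : Plane → ℝ := fun y => B y (f₂ y) (f₂ y) with hr
  have hps : ContDiffOn ℝ ∞ p O := (hB.clm_apply hf₁).clm_apply hf₁
  have hqs : ContDiffOn ℝ ∞ q O := (hB.clm_apply hf₁).clm_apply hf₂
  have hrs : ContDiffOn ℝ ∞ r O := (hB.clm_apply hf₂).clm_apply hf₂
  set s : Plane → ℝ := fun y => (p y - r y) / 2 with hs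
  have hss : ContDiffOn ℝ ∞ s O := (hps.sub hrs).div_const 2
  set ρ : Plane → ℝ := fun y => √(s y ^ 2 + q y ^ 2) with hρ
  have hqc : ContinuousOn q O := hqs.continuousOn
  have hsc : ContinuousOn s O := hss.continuousOn
  have hρc : ContinuousOn ρ O := ((hsc.pow 2).add (hqc.pow 2)).sqrt
  set W : Set Plane := (O ∩ (fun y => s y + ρ y) ⁻¹' Ioi 0) ∩ (O ∩ ρ ⁻¹' Ioi 0) with hWdef
  have hWO : W ⊆ O := fun y hy => hy.1.1
  have hWpos : ∀ y ∈ W, 0 < s y + ρ y := fun y hy => hy.1.2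
  have hρpos : ∀ y ∈ W, 0 < ρ y := fun y hy => hy.2.2
  have hρsq : ∀ y, ρ y ^ 2 = s y ^ 2 + q y ^ 2 := fun y => Real.sq_sqrt (by positivity)
  have hρs : ContDiffOn ℝ ∞ ρ W := (((hss.pow 2).add (hqs.pow 2)).mono hWO).sqrt fun y hy => by
    have h1 := pow_pos (hρpos y hy) 2
    rw [hρsq] at h1
    exact h1.ne'
  set τ : Plane → ℝ := fun y => √(s y + ρ y) with hτ
  have hτs : ContDiffOn ℝ ∞ τ W := ((hss.mono hWO).add hρs).sqrt fun y hy => (hWpos y hy).ne'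
  have hτpos : ∀ y ∈ W, 0 < τ y := fun y hy => Real.sqrt_pos.2 (hWpos y hy)
  have hτsq : ∀ y ∈ W, τ y ^ 2 = s y + ρ y := fun y hy => Real.sq_sqrt (hWpos y hy).le
  have hW : IsOpen W := ((hsc.add hρc).isOpen_inter_preimage hO isOpen_Ioi).inter
    (hρc.isOpen_inter_preimage hO isOpen_Ioi)
  have hy₀W : y₀ ∈ W := by
    have hq0 : q y₀ = B y₀ w₁ w₂ := by simp only [hq, e1, e2]
    have hs0 : s y₀ = (B y₀ w₁ w₁ - B y₀ w₂ w₂) / 2 := by simp only [hs, hp, hr, e1, e2]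
    have hne0 : q y₀ ≠ 0 ∨ 0 < s y₀ := by
      rw [hq0, hs0]
      exact hreg.imp id fun h => by linarith
    have h1 : 0 ≤ ρ y₀ := Real.sqrt_nonneg _
    have h2 := hρsq y₀
    have h3 : 0 < ρ y₀ := by
      refine lt_of_le_of_ne h1 fun h => ?_
      rw [← h] at h2
      rcases hne0 with h' | h'
      · have := sq_pos_of_ne_zero h'; nlinarith [sq_nonneg (s y₀)]
      · nlinarith [sq_nonneg (q y₀)]
    refine ⟨⟨hy₀, ?_⟩, hy₀, h3⟩
    show 0 < s y₀ + ρ y₀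
    rcases hne0 with h' | h'
    · have := sq_pos_of_ne_zero h'
      by_contra hle
      nlinarith
    · linarith
  have hτs' : ContDiffOn ℝ ∞ (fun y => q y / τ y) W :=
    (hqs.mono hWO).div hτs fun y hy => (hτpos y hy).ne'
  refine ⟨W, fun y => (-(q y / τ y)) • f₁ y + τ y • f₂ y, fun y => τ y • f₁ y + (q y / τ y) • f₂ y,
    fun y => (p y + r y) / 2 - ρ y, fun y => (p y + r y) / 2 + ρ y, hW, hy₀W, hWO, ?_⟩
  have hf₁' := hf₁.mono hWO
  have hf₂' := hf₂.mono hWO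
  have htr : ContDiffOn ℝ ∞ (fun y => (p y + r y) / 2) W :=
    ((hps.add hrs).div_const 2).mono hWO
  have hform : ∀ y ∈ W, ∀ a b c d : ℝ, G y (a • f₁ y + b • f₂ y) (c • f₁ y + d • f₂ y) =
      a * c + b * d := by
    intro y hy a b c d
    obtain ⟨h1, h2, h3⟩ := hf y (hWO hy)
    have h4 := hsymm y (hWO hy) (f₂ y) (f₁ y)
    simp [h1, h2, h3, h4]
  have hformB : ∀ y ∈ W, ∀ a b c d : ℝ, B y (a • f₁ y + b • f₂ y) (c • f₁ y + d • f₂ y) =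
      a * c * p y + (a * d + b * c) * q y + b * d * r y := by
    intro y hy a b c d
    have h4 : B y (f₂ y) (f₁ y) = q y := hBsymm y (hWO hy) (f₂ y) (f₁ y)
    have hp' : B y (f₁ y) (f₁ y) = p y := rfl
    have hq' : B y (f₁ y) (f₂ y) = q y := rfl
    have hr' : B y (f₂ y) (f₂ y) = r y := rfl
    simp [h4, hp', hq', hr']
    ring
  have hquot : ∀ y ∈ W, (q y / τ y) ^ 2 = ρ y - s y := by
    intro y hy
    have h1 := hτsq y hy
    have h2 := hρsq y
    have h3 := hWpos y hy
    rw [div_pow, h1, div_eq_iff h3.ne']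
    linear_combination -h2
  have hmul : ∀ y ∈ W, q y / τ y * τ y = q y := fun y hy => div_mul_cancel₀ _ (hτpos y hy).ne'
  have hs2 : ∀ y, p y - r y = 2 * s y := fun y => by simp only [hs]; ring
  refine ⟨(hτs'.neg.smul hf₁').add (hτs.smul hf₂'), (hτs.smul hf₁').add (hτs'.smul hf₂'),
    htr.sub hρs, htr.add hρs, fun y hy => by linarith [hρpos y hy], ?_, ?_, ?_, ?_, ?_, ?_⟩
  · intro y hy
    rw [hform y hy]
    linear_combination hquot y hy + hτsq y hy
  · intro y hy
    rw [hform y hy]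
    ring
  · intro y hy
    rw [hform y hy]
    linear_combination hquot y hy + hτsq y hy
  · intro y hy
    rw [hformB y hy]
    linear_combination p y * hquot y hy + r y * hτsq y hy - 2 * q y * hmul y hy
      - s y * hs2 y + 2 * hρsq y
  · intro y hy
    rw [hformB y hy]
    linear_combination -(p y - r y) * hmul y hy + q y * hτsq y hy - q y * hquot y hy - q y * hs2 y
  · intro y hy
    rw [hformB y hy]
    linear_combination r y * hquot y hy + p y * hτsq y hy + 2 * q y * hmul y hy
      + s y * hs2 y - 2 * hρsq y

end

/-! ### The eigenframe of a quadratic integral commutes -/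

section

variable {G B : Plane → Plane →L[ℝ] Plane →L[ℝ] ℝ} {W : Set Plane} {X₁ X₂ : Plane → Plane}
  {μ₁ μ₂ : Plane → ℝ} {y : Plane}

/-- Through every point of `W` passes in every direction a solution of the Euler–Lagrange equation
of `G` along which `B` is constant to first order. -/
def IsIntegralToFirstOrder (G B : Plane → Plane →L[ℝ] Plane →L[ℝ] ℝ) (W : Set Plane) : Prop :=
  ∀ y ∈ W, ∀ ξ : Plane, ∃ x : ℝ → Plane, x 0 = y ∧ deriv x 0 = ξ ∧ ContDiffAt ℝ 2 x 0 ∧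
    IsExtremalAt G x 0 ∧ HasDerivAt (fun t => B (x t) (deriv x t) (deriv x t)) 0 0

/-- Half the Lie derivative of the form `G` along the field `X`, at `y` on the vector `ξ`. -/
def halfLieDeriv (G : Plane → Plane →L[ℝ] Plane →L[ℝ] ℝ) (X : Plane → Plane) (y ξ : Plane) : ℝ :=
  (1 / 2) * fderiv ℝ G y (X y) ξ ξ + G y ξ (fderiv ℝ X y ξ)

/-- The momentum `g(ẋ, X)` changes along an extremal at the rate `(ℒ_X G)(ẋ, ẋ) / 2`. -/
theorem IsExtremalAt.hasDerivAt_momentum_field {x : ℝ → Plane} {X : Plane → Plane} {t : ℝ}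
    (h : IsExtremalAt G x t) (hG : DifferentiableAt ℝ G (x t)) (hx : ContDiffAt ℝ 2 x t)
    (hX : DifferentiableAt ℝ X (x t)) :
    HasDerivAt (fun τ => G (x τ) (deriv x τ) (X (x τ)))
      (halfLieDeriv G X (x t) (deriv x t)) t := by
  have h1 : HasDerivAt x (deriv x t) t := (hx.differentiableAt (by simp)).hasDerivAt
  have h2 : HasDerivAt (fun τ => X (x τ)) (fderiv ℝ X (x t) (deriv x t)) t :=
    HasFDerivAt.comp_hasDerivAt (l := X) t hX.hasFDerivAt h1
  refine ((hasDerivAt_momentum hG hx).clm_apply h2).congr_deriv ?_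
  rw [add_apply, (isExtremalAt_iff hG hx).1 h]
  rfl

namespace IsEigenframe

theorem congr_zero (h : IsEigenframe G B X₁ X₂ μ₁ μ₂ W) (hy : y ∈ W) {p q : ℝ}
    (hsymm : ∀ v w, G y v w = G y w v) (hpq : p • X₁ y + q • X₂ y = 0) : p = 0 ∧ q = 0 := by
  have h12 := h.g₁₂ y hy
  have h21 := (hsymm (X₂ y) (X₁ y)).trans h12
  have hne : μ₂ y - μ₁ y ≠ 0 := (sub_pos.2 (h.lt y hy)).ne'
  have e1 := congrArg (fun v => G y v (X₁ y)) hpq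
  have e2 := congrArg (fun v => G y v (X₂ y)) hpq
  simp only [map_add, map_smul, add_apply, smul_apply, smul_eq_mul, h.g₁₁ y hy, h.g₂₂ y hy, h12,
    h21, mul_zero, add_zero, zero_add, map_zero, zero_apply] at e1 e2
  exact ⟨(mul_eq_zero.1 e1).resolve_right hne, (mul_eq_zero.1 e2).resolve_right hne⟩

theorem exists_eq (h : IsEigenframe G B X₁ X₂ μ₁ μ₂ W) (hy : y ∈ W)
    (hsymm : ∀ v w, G y v w = G y w v) (v : Plane) : ∃ p q : ℝ, v = p • X₁ y + q • X₂ y :=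
  exists_eq_frame (fun _ _ hpq => h.congr_zero hy hsymm hpq) v

theorem apply₁ (h : IsEigenframe G B X₁ X₂ μ₁ μ₂ W) (hy : y ∈ W)
    (hsymm : ∀ v w, G y v w = G y w v) (p q : ℝ) :
    G y (p • X₁ y + q • X₂ y) (X₁ y) = p * (μ₂ y - μ₁ y) := by
  have h12 := h.g₁₂ y hy
  have h21 := (hsymm (X₂ y) (X₁ y)).trans h12
  simp [h.g₁₁ y hy, h21]

theorem apply₂ (h : IsEigenframe G B X₁ X₂ μ₁ μ₂ W) (hy : y ∈ W) (p q : ℝ) :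
    G y (p • X₁ y + q • X₂ y) (X₂ y) = q * (μ₂ y - μ₁ y) := by
  simp [h.g₁₂ y hy, h.g₂₂ y hy]

theorem metric_eq (h : IsEigenframe G B X₁ X₂ μ₁ μ₂ W) (hy : y ∈ W)
    (hsymm : ∀ v w, G y v w = G y w v) (p q p' q' : ℝ) :
    G y (p • X₁ y + q • X₂ y) (p' • X₁ y + q' • X₂ y) = (p * p' + q * q') * (μ₂ y - μ₁ y) := by
  rw [map_add, map_smul, map_smul, h.apply₁ hy hsymm, h.apply₂ hy, smul_eq_mul, smul_eq_mul]
  ring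

theorem form_eq (h : IsEigenframe G B X₁ X₂ μ₁ μ₂ W) (hy : y ∈ W)
    (hBsymm : ∀ v w, B y v w = B y w v) (p q : ℝ) :
    B y (p • X₁ y + q • X₂ y) (p • X₁ y + q • X₂ y) =
      (p ^ 2 * μ₁ y + q ^ 2 * μ₂ y) * (μ₂ y - μ₁ y) := by
  have h12 := h.b₁₂ y hy
  have h21 := (hBsymm (X₂ y) (X₁ y)).trans h12
  simp [h.b₁₁ y hy, h.b₂₂ y hy, h12, h21]
  ring

/-- The form `B - μ₁ G` has rank one. -/
theorem form_eq₁ (h : IsEigenframe G B X₁ X₂ μ₁ μ₂ W) (hy : y ∈ W)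
    (hsymm : ∀ v w, G y v w = G y w v) (hBsymm : ∀ v w, B y v w = B y w v) (v : Plane) :
    B y v v = μ₁ y * G y v v + G y v (X₂ y) ^ 2 := by
  obtain ⟨p, q, rfl⟩ := h.exists_eq hy hsymm v
  rw [h.form_eq hy hBsymm, h.metric_eq hy hsymm, h.apply₂ hy]
  ring

/-- The form `B - μ₂ G` has rank one. -/
theorem form_eq₂ (h : IsEigenframe G B X₁ X₂ μ₁ μ₂ W) (hy : y ∈ W)
    (hsymm : ∀ v w, G y v w = G y w v) (hBsymm : ∀ v w, B y v w = B y w v) (v : Plane) :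
    B y v v = μ₂ y * G y v v - G y v (X₁ y) ^ 2 := by
  obtain ⟨p, q, rfl⟩ := h.exists_eq hy hsymm v
  rw [h.form_eq hy hBsymm, h.metric_eq hy hsymm, h.apply₁ hy hsymm]
  ring

/-- Differentiation of the integral, written as `μ₁ g(ξ, ξ) + g(ξ, X₂)²` and as
`μ₂ g(ξ, ξ) - g(ξ, X₁)²`, along the extremal with velocity `ξ` at `y`. -/
theorem derivative_identities
    (h : IsEigenframe G B X₁ X₂ μ₁ μ₂ W) (hW : IsOpen W) (hGd : DifferentiableOn ℝ G W)
    (hsymm : ∀ y ∈ W, ∀ v w, G y v w = G y w v) (hBsymm : ∀ y ∈ W, ∀ v w, B y v w = B y w v)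
    (hint : IsIntegralToFirstOrder G B W) (hy : y ∈ W) (ξ : Plane) :
    fderiv ℝ μ₁ y ξ * G y ξ ξ + 2 * G y ξ (X₂ y) * halfLieDeriv G X₂ y ξ = 0 ∧
    fderiv ℝ μ₂ y ξ * G y ξ ξ - 2 * G y ξ (X₁ y) * halfLieDeriv G X₁ y ξ = 0 := by
  obtain ⟨x, rfl, rfl, hx, hex, hB⟩ := hint y hy ξ
  have hn := hW.mem_nhds hy
  have hd : ∀ {E : Type} [NormedAddCommGroup E] [NormedSpace ℝ E] {f : Plane → E},
      ContDiffOn ℝ ∞ f W → DifferentiableAt ℝ f (x 0) := fun hf =>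
    (hf.contDiffAt hn).differentiableAt (by simp)
  have hG := hGd.differentiableAt hn
  have h1 : HasDerivAt x (deriv x 0) 0 := (hx.differentiableAt (by simp)).hasDerivAt
  have hK := hex.hasDerivAt_energy hG hx (hsymm _ hy)
  have hm₁ := (hd h.contDiffOn_eigenvalue₁).hasFDerivAt.comp_hasDerivAt 0 h1
  have hm₂ := (hd h.contDiffOn_eigenvalue₂).hasFDerivAt.comp_hasDerivAt 0 h1
  have hP₁ := hex.hasDerivAt_momentum_field hG hx (hd h.contDiffOn₁)
  have hP₂ := hex.hasDerivAt_momentum_field hG hx (hd h.contDiffOn₂)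
  have hev : ∀ᶠ t in 𝓝 (0 : ℝ), x t ∈ W := hx.continuousAt.preimage_mem_nhds hn
  constructor
  · have h2 := ((hm₁.mul hK).add (hP₂.pow 2)).unique
      (hB.congr_of_eventuallyEq (hev.mono fun t ht =>
        (h.form_eq₁ ht (hsymm _ ht) (hBsymm _ ht) _).symm))
    simp at h2
    linarith
  · have h2 := ((hm₂.mul hK).sub (hP₁.pow 2)).unique
      (hB.congr_of_eventuallyEq (hev.mono fun t ht =>
        (h.form_eq₂ ht (hsymm _ ht) (hBsymm _ ht) _).symm))
    simp at h2
    linarith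

/-- The eigenvectors, normalized by the difference of the eigenvalues, commute. The identities
of `derivative_identities` are equalities of cubic forms in `ξ`, hence they determine the Lie
derivatives of `G` along the frame. -/
theorem commute
    (h : IsEigenframe G B X₁ X₂ μ₁ μ₂ W) (hW : IsOpen W) (hGd : DifferentiableOn ℝ G W)
    (hsymm : ∀ y ∈ W, ∀ v w, G y v w = G y w v) (hBsymm : ∀ y ∈ W, ∀ v w, B y v w = B y w v)
    (hint : IsIntegralToFirstOrder G B W) (hy : y ∈ W) :
    fderiv ℝ X₂ y (X₁ y) = fderiv ℝ X₁ y (X₂ y) := by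
  have hid := h.derivative_identities hW hGd hsymm hBsymm hint hy
  have hn := hW.mem_nhds hy
  have hd : ∀ {E : Type} [NormedAddCommGroup E] [NormedSpace ℝ E] {f : Plane → E},
      ContDiffOn ℝ ∞ f W → DifferentiableAt ℝ f y := fun hf =>
    (hf.contDiffAt hn).differentiableAt (by simp)
  have hG := hGd.differentiableAt hn
  have hX₁ := hd h.contDiffOn₁
  have hX₂ := hd h.contDiffOn₂
  have hm₁ := hd h.contDiffOn_eigenvalue₁
  have hm₂ := hd h.contDiffOn_eigenvalue₂
  have hD : 0 < μ₂ y - μ₁ y := sub_pos.2 (h.lt y hy)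
  -- the Lie derivative is a quadratic form
  have hpar : ∀ X : Plane → Plane, ∀ u v, halfLieDeriv G X y (u + v) + halfLieDeriv G X y (u - v) =
      2 * halfLieDeriv G X y u + 2 * halfLieDeriv G X y v := by
    intro X u v
    simp only [halfLieDeriv, map_add, map_sub, add_apply, sub_apply]
    ring
  have hval : ∀ p q : ℝ,
      (p * fderiv ℝ μ₁ y (X₁ y) + q * fderiv ℝ μ₁ y (X₂ y)) * (p ^ 2 + q ^ 2) +
        2 * q * halfLieDeriv G X₂ y (p • X₁ y + q • X₂ y) = 0 ∧
      (p * fderiv ℝ μ₂ y (X₁ y) + q * fderiv ℝ μ₂ y (X₂ y)) * (p ^ 2 + q ^ 2) -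
        2 * p * halfLieDeriv G X₁ y (p • X₁ y + q • X₂ y) = 0 := by
    intro p q
    have h1 := hid (p • X₁ y + q • X₂ y)
    rw [h.metric_eq hy (hsymm y hy), h.apply₂ hy, h.apply₁ hy (hsymm y hy)] at h1
    simp only [map_add (fderiv ℝ μ₁ y), map_add (fderiv ℝ μ₂ y), map_smul, smul_eq_mul] at h1
    constructor <;> apply mul_left_cancel₀ hD.ne'
    · linear_combination h1.1
    · linear_combination h1.2
  -- compare the cubic forms on the vectors `X₁`, `X₂`, `X₁ + X₂` and `X₁ - X₂`
  have v10 := hval 1 0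
  have v01 := hval 0 1
  have v11 := hval 1 1
  have v1m := hval 1 (-1)
  have hp₁ := hpar X₁ (X₁ y) (X₂ y)
  have hp₂ := hpar X₂ (X₁ y) (X₂ y)
  simp only [one_smul, zero_smul, add_zero, zero_add, neg_smul, ← sub_eq_add_neg] at v10 v01 v11 v1m
  -- derivatives of the relations between the metric and the frame
  have hdiff : ∀ {X : Plane → Plane}, DifferentiableAt ℝ X y →
      (∀ z ∈ W, G z (X z) (X z) = μ₂ z - μ₁ z) → ∀ v, fderiv ℝ G y v (X y) (X y) +
        2 * G y (X y) (fderiv ℝ X y v) = fderiv ℝ μ₂ y v - fderiv ℝ μ₁ y v := by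
    intro X hX hXG v
    have h1 := (hG.hasFDerivAt.clm_apply hX.hasFDerivAt).clm_apply hX.hasFDerivAt
    have h2 := (h1.congr_of_eventuallyEq (f₁ := fun z => μ₂ z - μ₁ z)
      (Filter.mem_of_superset hn fun z hz => (hXG z hz).symm)).unique
      (hm₂.hasFDerivAt.sub hm₁.hasFDerivAt)
    have h3 := congrArg (fun L : Plane →L[ℝ] ℝ => L v) h2
    simp [hsymm y hy _ (X y)] at h3
    linarith
  have d1 := hdiff hX₁ h.g₁₁ (X₂ y)
  have d2 := hdiff hX₂ h.g₂₂ (X₁ y)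
  have c1 : G y (fderiv ℝ X₂ y (X₁ y) - fderiv ℝ X₁ y (X₂ y)) (X₁ y) = 0 := by
    rw [hsymm y hy, map_sub]
    have e : halfLieDeriv G X₂ y (X₁ y) = (1 / 2) * fderiv ℝ G y (X₂ y) (X₁ y) (X₁ y) +
      G y (X₁ y) (fderiv ℝ X₂ y (X₁ y)) := rfl
    linarith [v10.1, v10.2, v01.1, v01.2, v11.1, v11.2, v1m.1, v1m.2]
  have c2 : G y (fderiv ℝ X₂ y (X₁ y) - fderiv ℝ X₁ y (X₂ y)) (X₂ y) = 0 := by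
    rw [hsymm y hy, map_sub]
    have e : halfLieDeriv G X₁ y (X₂ y) = (1 / 2) * fderiv ℝ G y (X₁ y) (X₂ y) (X₂ y) +
      G y (X₂ y) (fderiv ℝ X₁ y (X₂ y)) := rfl
    linarith [v10.1, v10.2, v01.1, v01.2, v11.1, v11.2, v1m.1, v1m.2]
  rw [← sub_eq_zero]
  obtain ⟨p, q, hpq⟩ := h.exists_eq hy (hsymm y hy) (fderiv ℝ X₂ y (X₁ y) - fderiv ℝ X₁ y (X₂ y))
  rw [hpq] at c1 c2 ⊢
  rw [h.apply₁ hy (hsymm y hy)] at c1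
  rw [h.apply₂ hy] at c2
  rw [(mul_eq_zero.1 c1).resolve_right hD.ne', (mul_eq_zero.1 c2).resolve_right hD.ne']
  simp

/-- The forms dual to the commuting frame are closed. -/
theorem closed
    (h : IsEigenframe G B X₁ X₂ μ₁ μ₂ W) (hW : IsOpen W) (hGd : DifferentiableOn ℝ G W)
    (hsymm : ∀ y ∈ W, ∀ v w, G y v w = G y w v) (hBsymm : ∀ y ∈ W, ∀ v w, B y v w = B y w v)
    (hint : IsIntegralToFirstOrder G B W) (hy : y ∈ W)
    {X : Plane → Plane} (hX : X = X₁ ∨ X = X₂) (u v : Plane) :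
    fderiv ℝ (fun z => (μ₂ z - μ₁ z)⁻¹ • G z (X z)) y u v =
      fderiv ℝ (fun z => (μ₂ z - μ₁ z)⁻¹ • G z (X z)) y v u := by
  have hn := hW.mem_nhds hy
  have hd : ∀ {E : Type} [NormedAddCommGroup E] [NormedSpace ℝ E] {f : Plane → E},
      ContDiffOn ℝ ∞ f W → DifferentiableAt ℝ f y := fun hf =>
    (hf.contDiffAt hn).differentiableAt (by simp)
  have hXd : DifferentiableAt ℝ X y := by
    rcases hX with rfl | rfl
    · exact hd h.contDiffOn₁
    · exact hd h.contDiffOn₂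
  have hne : ∀ z ∈ W, μ₂ z - μ₁ z ≠ 0 := fun z hz => (sub_pos.2 (h.lt z hz)).ne'
  set θ : Plane → Plane →L[ℝ] ℝ := fun z => (μ₂ z - μ₁ z)⁻¹ • G z (X z) with hθ
  have hθd : DifferentiableAt ℝ θ y :=
    (((hd h.contDiffOn_eigenvalue₂).fun_sub (hd h.contDiffOn_eigenvalue₁)).fun_inv (hne y hy)).smul
      ((hGd.differentiableAt hn).clm_apply hXd)
  have key : ∀ {Y : Plane → Plane}, ContDiffOn ℝ ∞ Y W → (∃ c : ℝ, ∀ z ∈ W, θ z (Y z) = c) →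
      ∀ w, fderiv ℝ θ y w (Y y) + θ y (fderiv ℝ Y y w) = 0 := by
    rintro Y hY ⟨c, hc⟩ w
    have h1 := (hθd.hasFDerivAt.clm_apply (hd hY).hasFDerivAt).unique
      ((hasFDerivAt_const c y).congr_of_eventuallyEq (Filter.mem_of_superset hn hc))
    have h2 := congrArg (fun L : Plane →L[ℝ] ℝ => L w) h1
    simp at h2
    linarith
  have k1 := key h.contDiffOn₁ (by
    rcases hX with rfl | rfl
    · exact ⟨1, fun z hz => by simp [hθ, h.g₁₁ z hz, hne z hz]⟩
    · exact ⟨0, fun z hz => by simp [hθ, hsymm z hz _ (X₁ z), h.g₁₂ z hz]⟩)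
  have k2 := key h.contDiffOn₂ (by
    rcases hX with rfl | rfl
    · exact ⟨0, fun z hz => by simp [hθ, h.g₁₂ z hz]⟩
    · exact ⟨1, fun z hz => by simp [hθ, h.g₂₂ z hz, hne z hz]⟩)
  have hc := h.commute hW hGd hsymm hBsymm hint hy
  have h12 : fderiv ℝ θ y (X₁ y) (X₂ y) = fderiv ℝ θ y (X₂ y) (X₁ y) := by
    have e1 := k1 (X₂ y)
    have e2 := k2 (X₁ y)
    rw [hc] at e2
    linarith
  obtain ⟨p, q, rfl⟩ := h.exists_eq hy (hsymm y hy) u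
  obtain ⟨p', q', rfl⟩ := h.exists_eq hy (hsymm y hy) v
  simp only [map_add, map_smul, add_apply, smul_apply, smul_eq_mul, h12]
  ring

end IsEigenframe

theorem continuousAt_apply_field {X : Plane → Plane} {v : Plane} (hG : ContinuousAt G y)
    (hX : ContinuousAt X y) :
    ContinuousAt (fun p : Plane × Plane => G p.1 p.2 (X p.1)) (y, v) := by
  have h1 : ContinuousAt (fun p : Plane × Plane => G p.1) (y, v) :=
    ContinuousAt.comp (f := Prod.fst) (x := (y, v)) hG continuousAt_fst
  have h2 : ContinuousAt (fun p : Plane × Plane => X p.1) (y, v) :=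
    ContinuousAt.comp (f := Prod.fst) (x := (y, v)) hX continuousAt_fst
  exact (h1.clm_apply continuousAt_snd).clm_apply h2

/-- The field of null directions, selected by the sign `σ`, of `B - κ G`. -/
def nullField (X₁ X₂ : Plane → Plane) (μ₁ μ₂ : Plane → ℝ) (κ σ : ℝ) (y : Plane) : Plane :=
  √(μ₂ y - κ) • X₁ y + (σ * √(κ - μ₁ y)) • X₂ y

namespace IsEigenframe

variable {κ σ : ℝ}

theorem nullField_ne_zero (h : IsEigenframe G B X₁ X₂ μ₁ μ₂ W)
    (hκ : ∀ y ∈ W, μ₁ y < κ ∧ κ < μ₂ y) (hy : y ∈ W) (hsymm : ∀ v w, G y v w = G y w v) :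
    nullField X₁ X₂ μ₁ μ₂ κ σ y ≠ 0 := fun h0 =>
  (Real.sqrt_pos.2 (sub_pos.2 (hκ y hy).2)).ne' (h.congr_zero hy hsymm h0).1

theorem contDiffOn_nullField (h : IsEigenframe G B X₁ X₂ μ₁ μ₂ W)
    (hκ : ∀ y ∈ W, μ₁ y < κ ∧ κ < μ₂ y) : ContDiffOn ℝ ∞ (nullField X₁ X₂ μ₁ μ₂ κ σ) W :=
  (((h.contDiffOn_eigenvalue₂.sub contDiffOn_const).sqrt
    fun y hy => (sub_pos.2 (hκ y hy).2).ne').smul h.contDiffOn₁).add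
  ((contDiffOn_const.mul ((contDiffOn_const.sub h.contDiffOn_eigenvalue₁).sqrt
    fun y hy => (sub_pos.2 (hκ y hy).1).ne')).smul h.contDiffOn₂)

theorem apply_nullField_pos (h : IsEigenframe G B X₁ X₂ μ₁ μ₂ W)
    (hκ : ∀ y ∈ W, μ₁ y < κ ∧ κ < μ₂ y) (hσ : σ ^ 2 = 1) (hy : y ∈ W)
    (hsymm : ∀ v w, G y v w = G y w v) :
    0 < G y (nullField X₁ X₂ μ₁ μ₂ κ σ y) (X₁ y) ∧
    0 < σ * G y (nullField X₁ X₂ μ₁ μ₂ κ σ y) (X₂ y) := by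
  have hD := sub_pos.2 (h.lt y hy)
  rw [nullField, h.apply₁ hy hsymm, h.apply₂ hy]
  refine ⟨mul_pos (Real.sqrt_pos.2 (sub_pos.2 (hκ y hy).2)) hD, ?_⟩
  have := mul_pos (Real.sqrt_pos.2 (sub_pos.2 (hκ y hy).1)) hD
  calc 0 < √(κ - μ₁ y) * (μ₂ y - μ₁ y) := this
    _ = _ := by linear_combination -(√(κ - μ₁ y) * (μ₂ y - μ₁ y)) * hσ

theorem apply_nullField_self (h : IsEigenframe G B X₁ X₂ μ₁ μ₂ W)
    (hκ : ∀ y ∈ W, μ₁ y < κ ∧ κ < μ₂ y) (hσ : σ ^ 2 = 1) (hy : y ∈ W)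
    (hsymm : ∀ v w, G y v w = G y w v) (hBsymm : ∀ v w, B y v w = B y w v) :
    B y (nullField X₁ X₂ μ₁ μ₂ κ σ y) (nullField X₁ X₂ μ₁ μ₂ κ σ y) -
      κ * G y (nullField X₁ X₂ μ₁ μ₂ κ σ y) (nullField X₁ X₂ μ₁ μ₂ κ σ y) = 0 := by
  rw [nullField, h.form_eq hy hBsymm, h.metric_eq hy hsymm]
  have ha := Real.sq_sqrt (sub_pos.2 (hκ y hy).2).le
  have hb := Real.sq_sqrt (sub_pos.2 (hκ y hy).1).le
  linear_combination (μ₂ y - μ₁ y) * ((μ₁ y - κ) * ha + σ ^ 2 * (μ₂ y - κ) * hb +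
    (μ₂ y - κ) * (κ - μ₁ y) * hσ)

/-- A null vector of `B - κ G` in the quadrant of `nullField` is a multiple of it. -/
theorem exists_smul_nullField (h : IsEigenframe G B X₁ X₂ μ₁ μ₂ W)
    (hκ : ∀ y ∈ W, μ₁ y < κ ∧ κ < μ₂ y) (hσ : σ ^ 2 = 1) (hy : y ∈ W)
    (hsymm : ∀ v w, G y v w = G y w v) (hBsymm : ∀ v w, B y v w = B y w v) {v : Plane}
    (hp1 : 0 < G y v (X₁ y)) (hp2 : 0 < σ * G y v (X₂ y)) (hnull : B y v v - κ * G y v v = 0) :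
    ∃ k : ℝ, v = k • nullField X₁ X₂ μ₁ μ₂ κ σ y := by
  have hD := sub_pos.2 (h.lt y hy)
  obtain ⟨p, q, rfl⟩ := h.exists_eq hy hsymm v
  rw [h.form_eq hy hBsymm, h.metric_eq hy hsymm] at hnull
  rw [h.apply₁ hy hsymm] at hp1
  rw [h.apply₂ hy, ← mul_assoc] at hp2
  have hp : 0 < p := pos_of_mul_pos_left hp1 hD.le
  have hq : 0 < σ * q := pos_of_mul_pos_left hp2 hD.le
  have a0 := Real.sqrt_pos.2 (sub_pos.2 (hκ y hy).2)
  have b0 := Real.sqrt_pos.2 (sub_pos.2 (hκ y hy).1)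
  have a2 := Real.sq_sqrt (sub_pos.2 (hκ y hy).2).le
  have b2 := Real.sq_sqrt (sub_pos.2 (hκ y hy).1).le
  rw [nullField]
  generalize √(μ₂ y - κ) = α at a0 a2 ⊢
  generalize √(κ - μ₁ y) = β at b0 b2 ⊢
  have hsq : (p * β) ^ 2 = (σ * q * α) ^ 2 := by
    apply mul_left_cancel₀ hD.ne'
    linear_combination -hnull + (μ₂ y - μ₁ y) * (p ^ 2 * b2 - q ^ 2 * a2 - q ^ 2 * α ^ 2 * hσ)
  have hlin : p * β = σ * q * α :=
    (pow_left_inj₀ (by positivity) (by positivity) two_ne_zero).1 hsq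
  refine ⟨p / α, ?_⟩
  rw [smul_add, smul_smul, smul_smul, div_mul_cancel₀ _ a0.ne']
  congr 2
  field_simp
  linear_combination -σ * hlin - q * α * hσ

end IsEigenframe

end

/-! ### Null directions of an integral as geodesic foliations -/

section

variable {M : Type*} [TopologicalSpace M] [ChartedSpace Plane M]
variable {φ : OpenPartialHomeomorph M Plane} {X : Plane → Plane} {W : Set Plane}

/-- The vector field on `M` with components `X` in the coordinates `φ`. -/
def pullField (φ : OpenPartialHomeomorph M Plane) (X : Plane → Plane) (y : M) : Plane :=
  coordDerivSymm φ (φ y) (X (φ y))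

/-- The field of the lines spanned by `pullField φ X`. -/
def lineField (φ : OpenPartialHomeomorph M Plane) (X : Plane → Plane) : DirField M := fun y =>
  Submodule.span ℝ {(pullField φ X y : TangentSpace 𝓘(ℝ, Plane) y)}

variable {b : BilinField M}

theorem coordForm_symm_of_symm {y : Plane} (hb : ∀ v w : TangentSpace 𝓘(ℝ, Plane) (φ.symm y),
    b (φ.symm y) v w = b (φ.symm y) w v) (v w : Plane) :
    coordForm b φ y v w = coordForm b φ y w v := hb _ _

theorem coordDeriv_pullField (hφ : IsCoord φ) {y : M} (hy : y ∈ φ.source) :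
    coordDeriv φ y (pullField φ X y) = X (φ y) := hφ.coordDeriv_symm' hy _

theorem mem_lineField_of_coordDeriv (hφ : IsCoord φ) {y : M} (hy : y ∈ φ.source) {v : Plane}
    {k : ℝ} (h : coordDeriv φ y v = k • X (φ y)) :
    (v : TangentSpace 𝓘(ℝ, Plane) y) ∈ lineField φ X y := by
  have h1 : v = k • pullField φ X y := by
    rw [← hφ.symm_coordDeriv hy v, h, map_smul]
    rfl
  exact (Submodule.mem_span_singleton (R := ℝ) (M := Plane)).2 ⟨k, h1.symm⟩

variable [IsManifold 𝓘(ℝ, Plane) ∞ M] {g : Metric M} {U : Set M}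

theorem isFoliationOn_lineField (hφ : IsCoord φ) (hW : IsOpen W) (hWφ : W ⊆ φ.target)
    (hX : ContDiffOn ℝ ∞ X W) (hX0 : ∀ y ∈ W, X y ≠ 0) :
    IsFoliationOn (lineField φ X) (φ.source ∩ φ ⁻¹' W) := by
  intro x hx
  refine ⟨_, φ.isOpen_inter_preimage hW, hx, subset_rfl, pullField φ X,
    hφ.contMDiffOn_field hWφ hX, fun y hy => ⟨fun h => hX0 _ hy.2 ?_, rfl⟩⟩
  rw [← coordDeriv_pullField (X := X) hφ hy.1]
  exact (congrArg (coordDeriv φ y) h).trans (map_zero _)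

/-- The metric itself is a quadratic integral: conservation of energy. -/
theorem isQuadraticIntegralOn_metric (g : Metric M) (U : Set M) :
    IsQuadraticIntegralOn g g.inner U := by
  refine ⟨g.contMDiff.contMDiffOn, fun x _ v w => g.symm x v w, fun α β c hc _ => ?_⟩
  have hder : ∀ t ∈ Ioo α β,
      HasDerivAt (fun t => g.inner (c t) (velocity c t) (velocity c t)) 0 t := by
    intro t ht
    have hφ : IsCoord (chartAt Plane (c t)) := IsManifold.chart_mem_maximalAtlas _
    have hs := mem_chart_source Plane (c t)
    have h1 := (hc.isExtremalAt hφ ht hs).hasDerivAt_energy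
      (hφ.differentiableAt_metric g ((chartAt Plane (c t)).map_source hs))
      (contDiffAt_coord_comp hφ isOpen_Ioo hc.1 ht hs) (coordForm_symm g _ _)
    refine h1.congr_of_eventuallyEq ?_
    filter_upwards [isOpen_Ioo.mem_nhds ht, (hc.continuousAt isOpen_Ioo ht).preimage_mem_nhds
      ((chartAt Plane (c t)).open_source.mem_nhds hs)] with r hr hr'
    exact (coordForm_velocity hφ _ (hc.mdifferentiableAt isOpen_Ioo hr) hr').symm
  intro t₁ ht₁ t₂ ht₂
  exact isOpen_Ioo.is_const_of_deriv_eq_zero isPreconnected_Ioo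
    (fun t ht => (hder t ht).differentiableAt.differentiableWithinAt)
    (fun t ht => (hder t ht).deriv) ht₁ ht₂

/-- Conservation of a quadratic integral, in coordinates. -/
theorem IsQuadraticIntegralOn.coordForm_const (hb : IsQuadraticIntegralOn g b U) (hφ : IsCoord φ)
    {c : ℝ → M} {ε : ℝ} (hc : IsGeodesicOn g c (Ioo (-ε) ε))
    (hcU : ∀ t ∈ Ioo (-ε) ε, c t ∈ φ.source ∧ c t ∈ U) {t s : ℝ} (ht : t ∈ Ioo (-ε) ε)
    (hs : s ∈ Ioo (-ε) ε) :
    coordForm b φ (φ (c t)) (deriv (fun r => φ (c r)) t) (deriv (fun r => φ (c r)) t) =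
      coordForm b φ (φ (c s)) (deriv (fun r => φ (c r)) s) (deriv (fun r => φ (c r)) s) := by
  rw [coordForm_velocity hφ b (hc.mdifferentiableAt isOpen_Ioo ht) (hcU t ht).1,
    coordForm_velocity hφ b (hc.mdifferentiableAt isOpen_Ioo hs) (hcU s hs).1]
  exact hb.const _ _ c hc (fun r hr => (hcU r hr).2) t ht s hs

/-- The coordinate form of an integral satisfies the first order condition, since geodesics exist
in all directions. -/
theorem IsQuadraticIntegralOn.isIntegralToFirstOrder (hb : IsQuadraticIntegralOn g b U)
    (hφ : IsCoord φ) (hW : IsOpen W) (hWφ : W ⊆ φ.target ∩ φ.symm ⁻¹' U) :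
    IsIntegralToFirstOrder (coordForm g.inner φ) (coordForm b φ) W := by
  intro y hy ξ
  obtain ⟨r, hr, ε, hε, h⟩ := hφ.exists_geodesic g (y₀ := y) (v₀ := ξ) (hWφ hy).1
    (W := Prod.fst ⁻¹' W) (continuousAt_fst.preimage_mem_nhds (hW.mem_nhds hy))
  obtain ⟨c, hc, hc0, hv, hcW⟩ := h y (Metric.mem_closedBall_self hr.le) ξ
    (Metric.mem_closedBall_self hr.le)
  have h0 : (0 : ℝ) ∈ Ioo (-ε) ε := ⟨by linarith, hε⟩
  have hcU : ∀ t ∈ Ioo (-ε) ε, c t ∈ φ.source ∧ c t ∈ U := by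
    intro t ht
    refine ⟨(hcW t ht).1, ?_⟩
    have := (hWφ (hcW t ht).2).2
    rwa [mem_preimage, φ.left_inv (hcW t ht).1] at this
  refine ⟨fun t => φ (c t), ?_, hv, contDiffAt_coord_comp hφ isOpen_Ioo hc.1 h0 (hcW 0 h0).1,
    hc.isExtremalAt hφ h0 (hcW 0 h0).1, ?_⟩
  · show φ (c 0) = y
    rw [hc0, φ.right_inv (hWφ hy).1]
  · refine HasDerivAt.congr_of_eventuallyEq (f := fun _ => coordForm b φ (φ (c 0))
      (deriv (fun r => φ (c r)) 0) (deriv (fun r => φ (c r)) 0)) (hasDerivAt_const _ _) ?_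
    filter_upwards [isOpen_Ioo.mem_nhds h0] with t ht
    exact hb.coordForm_const hφ hc hcU ht h0

/-- Geodesics that are tangent to a null direction of `b - κ g` stay tangent to the null
directions, since `b` and `g` are conserved. For a short time the velocity stays in the same
open quadrant of the eigenframe, so that the null direction does not change its sign `σ`. -/
theorem IsEigenframe.hasGeodesicLeavesOn {X₁ X₂ : Plane → Plane} {μ₁ μ₂ : Plane → ℝ} {κ σ : ℝ}
    (h : IsEigenframe (coordForm g.inner φ) (coordForm b φ) X₁ X₂ μ₁ μ₂ W)
    (hb : IsQuadraticIntegralOn g b U) (hφ : IsCoord φ) (hW : IsOpen W)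
    (hWφ : W ⊆ φ.target ∩ φ.symm ⁻¹' U) (hκ : ∀ y ∈ W, μ₁ y < κ ∧ κ < μ₂ y) (hσ : σ ^ 2 = 1) :
    HasGeodesicLeavesOn g (lineField φ (nullField X₁ X₂ μ₁ μ₂ κ σ)) (φ.source ∩ φ ⁻¹' W) := by
  rintro x ⟨hx, hxW⟩
  have hn := hW.mem_nhds hxW
  have hsymm : ∀ y, ∀ v w, coordForm g.inner φ y v w = coordForm g.inner φ y w v :=
    coordForm_symm g φ
  have hBsymm : ∀ y ∈ W, ∀ v w, coordForm b φ y v w = coordForm b φ y w v := fun y hy =>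
    coordForm_symm_of_symm (hb.symm _ (hWφ hy).2)
  have hGc := (hφ.contDiffOn_metric g).continuousOn.continuousAt
    (φ.open_target.mem_nhds (φ.map_source hx))
  set v₀ := nullField X₁ X₂ μ₁ μ₂ κ σ (φ x) with hv₀
  obtain ⟨hpos₁, hpos₂⟩ := h.apply_nullField_pos hκ hσ hxW (hsymm _)
  have hopen : (fun p : Plane × Plane => p.1) ⁻¹' W ∩
      ((fun p : Plane × Plane => coordForm g.inner φ p.1 p.2 (X₁ p.1)) ⁻¹' Ioi 0 ∩
      (fun p : Plane × Plane => σ * coordForm g.inner φ p.1 p.2 (X₂ p.1)) ⁻¹' Ioi 0) ∈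
      𝓝 (φ x, v₀) :=
    inter_mem (continuousAt_fst.preimage_mem_nhds hn) (inter_mem
      ((continuousAt_apply_field hGc
        (h.contDiffOn₁.continuousOn.continuousAt hn)).preimage_mem_nhds (Ioi_mem_nhds hpos₁))
      ((continuousAt_const.mul (continuousAt_apply_field hGc
        (h.contDiffOn₂.continuousOn.continuousAt hn))).preimage_mem_nhds (Ioi_mem_nhds hpos₂)))
  obtain ⟨r, hr, ε, hε, hgeo⟩ := hφ.exists_geodesic g (φ.map_source hx) hopen
  obtain ⟨c, hc, hc0, hv, hcW⟩ := hgeo (φ x) (Metric.mem_closedBall_self hr.le) v₀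
    (Metric.mem_closedBall_self hr.le)
  rw [φ.left_inv hx] at hc0
  have h0 : (0 : ℝ) ∈ Ioo (-ε) ε := ⟨by linarith, hε⟩
  have hcU : ∀ t ∈ Ioo (-ε) ε, c t ∈ φ.source ∧ c t ∈ U := by
    intro t ht
    refine ⟨(hcW t ht).1, ?_⟩
    have := (hWφ (hcW t ht).2.1).2
    rwa [mem_preimage, φ.left_inv (hcW t ht).1] at this
  refine ⟨ε, hε, c, hc0, hc, fun t ht => ⟨⟨(hcW t ht).1, (hcW t ht).2.1⟩, ?_⟩⟩
  obtain ⟨hts, htW, hp1, hp2⟩ := hcW t ht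
  have hconst := hb.coordForm_const hφ hc hcU ht h0
  have hconst' := (isQuadraticIntegralOn_metric g U).coordForm_const hφ hc hcU ht h0
  have hvel := deriv_coord_comp hφ (hc.mdifferentiableAt isOpen_Ioo ht) hts
  have hxz : φ (c 0) = φ x := by rw [hc0]
  rw [hv, hxz] at hconst hconst'
  have hnull : coordForm b φ (φ (c t)) (deriv (fun r => φ (c r)) t) (deriv (fun r => φ (c r)) t) -
      κ * coordForm g.inner φ (φ (c t)) (deriv (fun r => φ (c r)) t)
        (deriv (fun r => φ (c r)) t) = 0 := by
    rw [hconst, hconst', h.apply_nullField_self hκ hσ hxW (hsymm _) (hBsymm _ hxW)]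
  obtain ⟨k, hk⟩ := h.exists_smul_nullField hκ hσ htW (hsymm _) (hBsymm _ htW) hp1 hp2 hnull
  refine ⟨fun hz => ?_, mem_lineField_of_coordDeriv hφ hts (hvel.symm.trans hk)⟩
  have h2 : deriv (fun r => φ (c r)) t = 0 :=
    hvel.trans ((congrArg (coordDeriv φ (c t)) hz).trans (map_zero _))
  have h3 : 0 < coordForm g.inner φ (φ (c t)) (deriv (fun r => φ (c r)) t) (X₁ (φ (c t))) := hp1
  rw [h2, map_zero] at h3
  exact lt_irrefl _ h3

end

/-! ### The geodesic net of an integral -/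

section

variable {M : Type*} [TopologicalSpace M] [ChartedSpace Plane M]
variable {φ : OpenPartialHomeomorph M Plane} {W : Set Plane}
variable [IsManifold 𝓘(ℝ, Plane) ∞ M] {g : Metric M} {b : BilinField M} {U : Set M}

theorem eq_smul_of_coordForm (hφ : IsCoord φ) {m : M} (hm : m ∈ φ.source) {k : ℝ}
    (hk : coordForm b φ (φ m) = k • coordForm g.inner φ (φ m)) : b m = k • g.inner m := by
  refine ContinuousLinearMap.ext fun v => ContinuousLinearMap.ext fun w => ?_
  refine (coordForm_coordDeriv hφ b hm v w).symm.trans ?_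
  rw [hk]
  exact congrArg (k * ·) (coordForm_coordDeriv hφ g.inner hm v w)

/-- The closed forms dual to the commuting eigenframe give isothermal coordinates. -/
theorem IsEigenframe.isConformallyFlatOn {X₁ X₂ : Plane → Plane} {μ₁ μ₂ : Plane → ℝ}
    (h : IsEigenframe (coordForm g.inner φ) (coordForm b φ) X₁ X₂ μ₁ μ₂ W)
    (hb : IsQuadraticIntegralOn g b U) (hφ : IsCoord φ) (hW : IsOpen W)
    (hWφ : W ⊆ φ.target ∩ φ.symm ⁻¹' U) :
    IsConformallyFlatOn g (lineField φ X₁) (lineField φ X₂) (φ.source ∩ φ ⁻¹' W) := by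
  rintro x ⟨hx, hxW⟩
  have hsymm : ∀ y, ∀ v w, coordForm g.inner φ y v w = coordForm g.inner φ y w v :=
    coordForm_symm g φ
  have hBsymm : ∀ y ∈ W, ∀ v w, coordForm b φ y v w = coordForm b φ y w v := fun y hy =>
    coordForm_symm_of_symm (hb.symm _ (hWφ hy).2)
  have hGs : ContDiffOn ℝ ∞ (coordForm g.inner φ) W :=
    (hφ.contDiffOn_metric g).mono fun y hy => (hWφ hy).1
  have hne : ∀ y ∈ W, μ₂ y - μ₁ y ≠ 0 := fun y hy => (sub_pos.2 (h.lt y hy)).ne'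
  have hw : ∀ y ∈ W, ∀ p q : ℝ,
      (μ₂ y - μ₁ y)⁻¹ * coordForm g.inner φ y (X₁ y) (p • X₁ y + q • X₂ y) = p ∧
      (μ₂ y - μ₁ y)⁻¹ * coordForm g.inner φ y (X₂ y) (p • X₁ y + q • X₂ y) = q := by
    intro y hy p q
    rw [hsymm y (X₁ y), hsymm y (X₂ y), h.apply₁ hy (hsymm y), h.apply₂ hy]
    have := hne y hy
    constructor <;> field_simp
  obtain ⟨χ, hχ, hxχ, hχφ, hd⟩ := exists_coord_of_closed_forms hφ hx hW hxW
    (w := fun i y => (μ₂ y - μ₁ y)⁻¹ • coordForm g.inner φ y ((![X₁, X₂] : Fin 2 → Plane → Plane) i y))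
    (by
      intro i
      have hs := (h.contDiffOn_eigenvalue₂.sub h.contDiffOn_eigenvalue₁).inv hne
      fin_cases i
      · exact hs.smul (hGs.clm_apply h.contDiffOn₁)
      · exact hs.smul (hGs.clm_apply h.contDiffOn₂))
    (by
      intro i y hy u v
      refine h.closed hW (hGs.differentiableOn (by simp)) (fun y _ => hsymm y) hBsymm
        (hb.isIntegralToFirstOrder hφ hW hWφ) hy ?_ u v
      fin_cases i
      · exact Or.inl rfl
      · exact Or.inr rfl)
    (by
      intro y hy v hv
      obtain ⟨p, q, rfl⟩ := h.exists_eq hy (hsymm y) v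
      obtain ⟨h1, h2⟩ := hw y hy p q
      have hp : p = 0 := h1.symm.trans (hv 0)
      have hq : q = 0 := h2.symm.trans (hv 1)
      simp [hp, hq])
  have hd0 : ∀ y ∈ χ.source, ∀ v p q, coordDeriv φ y v = p • X₁ (φ y) + q • X₂ (φ y) →
      coordDeriv χ y v 0 = p ∧ coordDeriv χ y v 1 = q := by
    intro y hy v p q hv
    obtain ⟨h1, h2⟩ := hw _ (hχφ y hy).2 p q
    refine ⟨(hd y hy v 0).trans ?_, (hd y hy v 1).trans ?_⟩
    · rw [hv]; exact h1
    · rw [hv]; exact h2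
  refine ⟨χ, hχ, hxχ, hχφ, ⟨fun z => μ₂ (φ (χ.symm z)) - μ₁ (φ (χ.symm z)), fun z hz v w => ?_⟩,
    fun y hy => ?_⟩
  · obtain ⟨y, hy, rfl⟩ : ∃ y ∈ χ.source, χ y = z := ⟨χ.symm z, χ.map_target hz, χ.right_inv hz⟩
    obtain ⟨v, rfl⟩ : ∃ v', coordDeriv χ y v' = v := ⟨_, hχ.coordDeriv_symm' hy v⟩
    obtain ⟨w, rfl⟩ : ∃ w', coordDeriv χ y w' = w := ⟨_, hχ.coordDeriv_symm' hy w⟩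
    have h1 := (coordForm_coordDeriv hχ g.inner hy v w).trans
      (coordForm_coordDeriv hφ g.inner (hχφ y hy).1 v w).symm
    obtain ⟨p, q, hpq⟩ := h.exists_eq (hχφ y hy).2 (hsymm _) (coordDeriv φ y v)
    obtain ⟨p', q', hpq'⟩ := h.exists_eq (hχφ y hy).2 (hsymm _) (coordDeriv φ y w)
    obtain ⟨e0, e1⟩ := hd0 y hy v p q hpq
    obtain ⟨e0', e1'⟩ := hd0 y hy w p' q' hpq'
    rw [inCoord_eq, h1, hpq, hpq', h.metric_eq (hχφ y hy).2 (hsymm _)]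
    beta_reduce
    rw [χ.left_inv hy]
    simp only [PiLp.inner_apply, Fin.sum_univ_two, RCLike.inner_apply, conj_trivial, e0, e1, e0',
      e1']
    ring
  · have hdir : ∀ (X : Plane → Plane) (i : Fin 2),
        coordDeriv χ y (pullField φ X y) = stdVec i → HasDirAt χ (lineField φ X) y (stdVec i) := by
      intro X i hX
      have h1 : HasDirAt χ (lineField φ X) y (coordDeriv χ y (pullField φ X y)) :=
        hasDirAt_of_eq_span rfl
      rwa [hX] at h1
    constructor
    · refine hdir X₁ 0 ?_
      obtain ⟨e0, e1⟩ := hd0 y hy (pullField φ X₁ y) 1 0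
        ((coordDeriv_pullField hφ (hχφ y hy).1).trans (by simp))
      ext i
      fin_cases i
      · simpa [stdVec] using e0
      · simpa [stdVec] using e1
    · refine hdir X₂ 1 ?_
      obtain ⟨e0, e1⟩ := hd0 y hy (pullField φ X₂ y) 0 1
        ((coordDeriv_pullField hφ (hχφ y hy).1).trans (by simp))
      ext i
      fin_cases i
      · simpa [stdVec] using e0
      · simpa [stdVec] using e1

/-- The null directions of `b - κ g` have the same bisectors for all `κ`: the eigendirections. -/
theorem IsEigenframe.isBisectorNetOn {X₁ X₂ : Plane → Plane} {μ₁ μ₂ : Plane → ℝ} {κ : ℝ}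
    (h : IsEigenframe (coordForm g.inner φ) (coordForm b φ) X₁ X₂ μ₁ μ₂ W)
    (hφ : IsCoord φ) (hW : IsOpen W) (hWφ : W ⊆ φ.target)
    (hκ : ∀ y ∈ W, μ₁ y < κ ∧ κ < μ₂ y) :
    IsBisectorNetOn g (lineField φ (nullField X₁ X₂ μ₁ μ₂ κ 1))
      (lineField φ (nullField X₁ X₂ μ₁ μ₂ κ (-1))) (lineField φ X₁) (lineField φ X₂)
      (φ.source ∩ φ ⁻¹' W) := by
  have hsymm : ∀ y, ∀ v w, coordForm g.inner φ y v w = coordForm g.inner φ y w v :=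
    coordForm_symm g φ
  have hne₁ : ∀ y ∈ W, X₁ y ≠ 0 := fun y hy h0 =>
    one_ne_zero (h.congr_zero (p := 1) (q := 0) hy (hsymm y) (by simp [h0])).1
  have hne₂ : ∀ y ∈ W, X₂ y ≠ 0 := fun y hy h0 =>
    one_ne_zero (h.congr_zero (p := 0) (q := 1) hy (hsymm y) (by simp [h0])).2
  refine ⟨isFoliationOn_lineField hφ hW hWφ h.contDiffOn₁ hne₁,
    isFoliationOn_lineField hφ hW hWφ h.contDiffOn₂ hne₂, ?_⟩
  rintro x ⟨hx, hxW⟩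
  have hD := sub_pos.2 (h.lt _ hxW)
  have ha := Real.sqrt_pos.2 (sub_pos.2 (hκ _ hxW).2)
  have hb := Real.sqrt_pos.2 (sub_pos.2 (hκ _ hxW).1)
  have ha2 := Real.sq_sqrt (sub_pos.2 (hκ _ hxW).2).le
  have hb2 := Real.sq_sqrt (sub_pos.2 (hκ _ hxW).1).le
  set Y : ℝ → Plane := fun σ => (μ₂ (φ x) - μ₁ (φ x))⁻¹ •
    pullField φ (nullField X₁ X₂ μ₁ μ₂ κ σ) x with hY
  have hYd : ∀ σ, coordDeriv φ x (Y σ) = (μ₂ (φ x) - μ₁ (φ x))⁻¹ •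
      nullField X₁ X₂ μ₁ μ₂ κ σ (φ x) := fun σ => by
    rw [hY]
    simp only [map_smul]
    rw [coordDeriv_pullField hφ hx]
  have hunit : ∀ σ : ℝ, σ ^ 2 = 1 →
      (g.inner x : Plane →L[ℝ] Plane →L[ℝ] ℝ) (Y σ) (Y σ) = 1 := by
    intro σ hσ
    have h1 : coordForm g.inner φ (φ x) (coordDeriv φ x (Y σ)) (coordDeriv φ x (Y σ)) = 1 := by
      rw [hYd, map_smul, map_smul, smul_apply, nullField, h.metric_eq hxW (hsymm _), smul_eq_mul,
        smul_eq_mul]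
      field_simp
      linear_combination ha2 + σ ^ 2 * hb2 + (κ - μ₁ (φ x)) * hσ
    exact (coordForm_coordDeriv hφ g.inner hx _ _).symm.trans h1
  have hmem : ∀ σ, Y σ ∈ (show Submodule ℝ Plane from
      lineField φ (nullField X₁ X₂ μ₁ μ₂ κ σ) x) := fun σ =>
    mem_lineField_of_coordDeriv hφ hx (hYd σ)
  have hspan : ∀ (k : ℝ) (u v : Plane), k ≠ 0 → u = k • v →
      Submodule.span ℝ {v} = Submodule.span ℝ {u} := by
    rintro k u v hk rfl
    exact (Submodule.span_singleton_smul_eq (IsUnit.mk0 k hk) v).symm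
  have hY₁ : Y 1 + Y (-1) = (2 * √(μ₂ (φ x) - κ) / (μ₂ (φ x) - μ₁ (φ x))) • pullField φ X₁ x := by
    apply hφ.injective hx
    rw [map_add, hYd, hYd, map_smul, coordDeriv_pullField hφ hx, nullField, nullField]
    module
  have hY₂ : Y 1 - Y (-1) = (2 * √(κ - μ₁ (φ x)) / (μ₂ (φ x) - μ₁ (φ x))) • pullField φ X₂ x := by
    apply hφ.injective hx
    rw [map_sub, hYd, hYd, map_smul, coordDeriv_pullField hφ hx, nullField, nullField]
    module
  exact ⟨Y 1, hmem 1, Y (-1), hmem (-1), hunit 1 (by norm_num), hunit (-1) (by norm_num),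
    hspan _ _ _ (by positivity) hY₁, hspan _ _ _ (by positivity) hY₂⟩

/-- Near a point where the integral `b` is not a multiple of the metric, the null directions of
`b - κ g`, for a constant `κ` between the two eigenvalues, form a geodesic net with conformally
flat bisector net. -/
theorem exists_net_of_integral (hU : IsOpen U) (hb : IsQuadraticIntegralOn g b U) {m : M}
    (hm : m ∈ U) (hne : ¬ ∃ k : ℝ, b m = k • g.inner m) :
    CarriesGeodesicNetNear g m fun _ _ N₁ N₂ V => IsConformallyFlatOn g N₁ N₂ V := by
  set φ := chartAt Plane m with hφdef
  have hφ : IsCoord φ := IsManifold.chart_mem_maximalAtlas _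
  have hms : m ∈ φ.source := mem_chart_source Plane m
  have hsymm : ∀ y, ∀ v w, coordForm g.inner φ y v w = coordForm g.inner φ y w v :=
    coordForm_symm g φ
  obtain ⟨W, X₁, X₂, μ₁, μ₂, hW, hmW, hWO, h⟩ := exists_isEigenframe
    (φ.symm.isOpen_inter_preimage hU) (y₀ := φ m)
    ⟨φ.map_source hms, by rwa [mem_preimage, φ.left_inv hms]⟩
    ((hφ.contDiffOn_metric g).mono inter_subset_left) (hφ.contDiffOn_coordForm hb.smooth)
    (fun y _ => hsymm y) (fun y hy v hv => hφ.coordForm_pos g hy.1 hv)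
    (fun y hy => coordForm_symm_of_symm (hb.symm _ hy.2))
    (fun ⟨k, hk⟩ => hne ⟨k, eq_smul_of_coordForm hφ hms hk⟩)
  obtain ⟨κ, hκ₁, hκ₂⟩ := exists_between (h.lt _ hmW)
  -- shrink the domain so that `κ` separates the eigenvalues
  set W' : Set Plane := (W ∩ μ₁ ⁻¹' Iio κ) ∩ (W ∩ μ₂ ⁻¹' Ioi κ) with hW'
  have hW'W : W' ⊆ W := fun y hy => hy.1.1
  have hW'o : IsOpen W' :=
    (h.contDiffOn_eigenvalue₁.continuousOn.isOpen_inter_preimage hW isOpen_Iio).inter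
      (h.contDiffOn_eigenvalue₂.continuousOn.isOpen_inter_preimage hW isOpen_Ioi)
  have h' : IsEigenframe (coordForm g.inner φ) (coordForm b φ) X₁ X₂ μ₁ μ₂ W' := h.mono hW'W
  have hκ : ∀ y ∈ W', μ₁ y < κ ∧ κ < μ₂ y := fun y hy => ⟨hy.1.2, hy.2.2⟩
  have hW'O := hW'W.trans hWO
  have hW't : W' ⊆ φ.target := fun y hy => (hW'O hy).1
  have hfol : ∀ σ, IsFoliationOn (lineField φ (nullField X₁ X₂ μ₁ μ₂ κ σ)) (φ.source ∩ φ ⁻¹' W') :=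
    fun σ => isFoliationOn_lineField hφ hW'o hW't (h'.contDiffOn_nullField hκ)
      fun y hy => h'.nullField_ne_zero hκ hy (hsymm y)
  refine ⟨φ.source ∩ φ ⁻¹' W', φ.isOpen_inter_preimage hW'o, ⟨hms, ⟨hmW, hκ₁⟩, hmW, hκ₂⟩,
    lineField φ (nullField X₁ X₂ μ₁ μ₂ κ 1), lineField φ (nullField X₁ X₂ μ₁ μ₂ κ (-1)),
    lineField φ X₁, lineField φ X₂,
    ⟨hfol 1, hfol (-1), h'.hasGeodesicLeavesOn hb hφ hW'o hW'O hκ (by norm_num),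
      h'.hasGeodesicLeavesOn hb hφ hW'o hW'O hκ (by norm_num), ?_⟩,
    h'.isBisectorNetOn hφ hW'o hW't hκ, h'.isConformallyFlatOn hb hφ hW'o hW'O⟩
  rintro x ⟨hx, hxW⟩ heq
  have heq' : Submodule.span ℝ {pullField φ (nullField X₁ X₂ μ₁ μ₂ κ 1) x} =
    Submodule.span ℝ {pullField φ (nullField X₁ X₂ μ₁ μ₂ κ (-1)) x} := heq
  have hx1 : (pullField φ (nullField X₁ X₂ μ₁ μ₂ κ 1) x : Plane) ∈ Submodule.span ℝ
      {pullField φ (nullField X₁ X₂ μ₁ μ₂ κ (-1)) x} :=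
    heq' ▸ (Submodule.mem_span_singleton_self (R := ℝ) (pullField φ (nullField X₁ X₂ μ₁ μ₂ κ 1) x))
  obtain ⟨k, hk⟩ := Submodule.mem_span_singleton.1 hx1
  have hk' := congrArg (coordDeriv φ x) hk
  rw [map_smul, coordDeriv_pullField hφ hx, coordDeriv_pullField hφ hx] at hk'
  have e := h'.congr_zero hxW (hsymm _) (p := (k - 1) * √(μ₂ (φ x) - κ))
    (q := (-k - 1) * √(κ - μ₁ (φ x))) (by
      rw [← sub_eq_zero] at hk'
      rw [← hk', nullField, nullField]
      module)
  have e1 := (mul_eq_zero.1 e.1).resolve_right (Real.sqrt_pos.2 (sub_pos.2 (hκ _ hxW).2)).ne'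
  have e2 := (mul_eq_zero.1 e.2).resolve_right (Real.sqrt_pos.2 (sub_pos.2 (hκ _ hxW).1)).ne'
  linarith

end

/-! ### Unique continuation of integrals -/

section

variable {M : Type*} [TopologicalSpace M] [ChartedSpace Plane M]
variable {φ : OpenPartialHomeomorph M Plane}

/-- A quadratic form that vanishes on a ball vanishes. -/
theorem bilin_eq_zero_of_ball {B : Plane →L[ℝ] Plane →L[ℝ] ℝ} (hsymm : ∀ v w, B v w = B w v)
    {v₀ : Plane} {r : ℝ} (hr : 0 < r) (h : ∀ v ∈ Metric.closedBall v₀ r, B v v = 0) : B = 0 := by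
  have hq : ∀ w, B w w = 0 := by
    intro w
    set η : ℝ := r / (‖w‖ + 1) with hη
    have hη0 : 0 < η := by positivity
    have hηw : ‖η • w‖ ≤ r := by
      rw [norm_smul, Real.norm_of_nonneg hη0.le, hη, div_mul_eq_mul_div, div_le_iff₀ (by positivity)]
      nlinarith [norm_nonneg w]
    have h0 := h v₀ (Metric.mem_closedBall_self hr.le)
    have h1 := h (v₀ + η • w) (by simpa [Metric.mem_closedBall, dist_eq_norm] using hηw)
    have h2 := h (v₀ - η • w) (by simpa [Metric.mem_closedBall, dist_eq_norm] using hηw)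
    simp only [map_add, map_sub, map_smul, add_apply, sub_apply, smul_apply, smul_eq_mul] at h1 h2
    apply (mul_eq_zero.1 (?_ : η ^ 2 * B w w = 0)).resolve_left (by positivity)
    linear_combination (h1 + h2) / 2 - h0
  ext v w
  have h1 := hq (v + w)
  simp only [map_add, add_apply, hq, hsymm w v] at h1
  simp only [zero_apply]
  linarith

theorem coordForm_eq_smul {k : ℝ} {b b' : BilinField M} {y : Plane}
    (h : b (φ.symm y) = k • b' (φ.symm y)) : coordForm b φ y = k • coordForm b' φ y := by
  ext v w
  exact congrArg (fun L => L (coordDerivSymm φ y v) (coordDerivSymm φ y w))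
    (show (show Plane →L[ℝ] Plane →L[ℝ] ℝ from b (φ.symm y)) =
      k • (show Plane →L[ℝ] Plane →L[ℝ] ℝ from b' (φ.symm y)) from h)

variable [IsManifold 𝓘(ℝ, Plane) ∞ M] {g : Metric M} {b : BilinField M} {U : Set M}

/-- If an integral is proportional to the Hamiltonian at every point of an open set, the factor,
being conserved along all geodesics, is locally constant. -/
theorem IsQuadraticIntegralOn.eventually_eq_smul (hb : IsQuadraticIntegralOn g b U)
    {V : Set M} (hV : IsOpen V) (hVU : V ⊆ U) (hprop : ∀ x ∈ V, ∃ k : ℝ, b x = k • g.inner x)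
    {x₀ : M} (hx₀ : x₀ ∈ V) : ∃ k : ℝ, ∀ᶠ x in 𝓝 x₀, b x = k • g.inner x := by
  set φ := chartAt Plane x₀ with hφdef
  have hφ : IsCoord φ := IsManifold.chart_mem_maximalAtlas _
  have hs : x₀ ∈ φ.source := mem_chart_source Plane x₀
  have hO : IsOpen (φ.target ∩ φ.symm ⁻¹' V) := φ.symm.isOpen_inter_preimage hV
  have hO' : φ.target ∩ φ.symm ⁻¹' V ⊆ φ.target ∩ φ.symm ⁻¹' U := fun y hy => ⟨hy.1, hVU hy.2⟩
  obtain ⟨r, hr, hball⟩ := Metric.isOpen_iff.1 hO (φ x₀)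
    ⟨φ.map_source hs, by rwa [mem_preimage, φ.left_inv hs]⟩
  have hint := hb.isIntegralToFirstOrder hφ hO hO'
  set G := coordForm g.inner φ with hG
  set B := coordForm b φ with hB
  have hGs : ContDiffOn ℝ ∞ G (φ.target ∩ φ.symm ⁻¹' V) :=
    (hφ.contDiffOn_metric g).mono inter_subset_left
  have hBs : ContDiffOn ℝ ∞ B (φ.target ∩ φ.symm ⁻¹' V) :=
    (hφ.contDiffOn_coordForm hb.smooth).mono hO'
  have he : stdVec 0 ≠ 0 := by simp [stdVec]
  have hGpos : ∀ y ∈ φ.target ∩ φ.symm ⁻¹' V, 0 < G y (stdVec 0) (stdVec 0) :=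
    fun y hy => hφ.coordForm_pos g hy.1 he
  set f : Plane → ℝ := fun y => B y (stdVec 0) (stdVec 0) / G y (stdVec 0) (stdVec 0) with hf
  have hfs : ContDiffOn ℝ ∞ f (φ.target ∩ φ.symm ⁻¹' V) :=
    ((hBs.clm_apply contDiffOn_const).clm_apply contDiffOn_const).div
      ((hGs.clm_apply contDiffOn_const).clm_apply contDiffOn_const) fun y hy => (hGpos y hy).ne'
  have hBG : ∀ y ∈ φ.target ∩ φ.symm ⁻¹' V, B y = f y • G y := by
    intro y hy
    obtain ⟨k, hk⟩ := hprop _ hy.2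
    have h1 : B y = k • G y := coordForm_eq_smul hk
    have h2 : f y = k := by
      rw [hf]
      beta_reduce
      rw [h1, smul_apply, smul_apply, smul_eq_mul, mul_div_cancel_right₀ _ (hGpos y hy).ne']
    rw [h2, h1]
  have hfd : ∀ y ∈ φ.target ∩ φ.symm ⁻¹' V, fderiv ℝ f y = 0 := by
    intro y hy
    ext ξ
    by_cases hξ : ξ = 0
    · simp [hξ]
    obtain ⟨x, rfl, rfl, hx, hex, hd⟩ := hint y hy ξ
    have hn := hO.mem_nhds hy
    have h1 := ((hfs.contDiffAt hn).differentiableAt (by simp)).hasFDerivAt.comp_hasDerivAt 0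
      (hx.differentiableAt (by simp)).hasDerivAt
    have h2 := hex.hasDerivAt_energy ((hGs.contDiffAt hn).differentiableAt (by simp)) hx
      (coordForm_symm g φ _)
    have h3 := (h1.mul h2).unique (hd.congr_of_eventuallyEq (by
      filter_upwards [hx.continuousAt.preimage_mem_nhds hn] with t ht
      rw [hBG _ ht]
      rfl))
    rw [mul_zero, add_zero] at h3
    exact (mul_eq_zero.1 h3).resolve_right (hφ.coordForm_pos g hy.1 hξ).ne'
  have hfc : ∀ y ∈ Metric.ball (φ x₀) r, f y = f (φ x₀) := fun y hy =>
    Metric.isOpen_ball.is_const_of_fderiv_eq_zero (convex_ball _ _).isPreconnected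
      (fun z hz => ((hfs.contDiffAt (hO.mem_nhds (hball hz))).differentiableAt
        (by simp)).differentiableWithinAt)
      (fun z hz => hfd z (hball hz)) hy (Metric.mem_ball_self hr)
  refine ⟨f (φ x₀), ?_⟩
  filter_upwards [φ.open_source.mem_nhds hs, (φ.continuousAt hs).preimage_mem_nhds
    (Metric.ball_mem_nhds _ hr)] with x hx hxb
  apply eq_smul_of_coordForm hφ hx
  rw [← hfc _ hxb]
  exact hBG _ (hball hxb)

/-- A geodesic that starts near the boundary point `y₁` of a ball with a velocity close to the
inward normal enters the ball. Hence an integral which is `k g` on the ball is `k g` near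
`y₁`. -/
theorem IsQuadraticIntegralOn.eventually_eq_smul_of_ball (hb : IsQuadraticIntegralOn g b U)
    (hφ : IsCoord φ) {k : ℝ} {z y₁ : Plane} (hy₁ : φ.target ∩ φ.symm ⁻¹' U ∈ 𝓝 y₁)
    (hne : z ≠ y₁)
    (hball : ∀ y ∈ Metric.ball z (dist y₁ z), y ∈ φ.target → b (φ.symm y) = k • g.inner (φ.symm y)) :
    ∀ᶠ y in 𝓝 y₁, coordForm b φ y = k • coordForm g.inner φ y := by
  set R := dist y₁ z with hR
  have hRpos : 0 < R := dist_pos.2 hne.symm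
  obtain ⟨r, hr, ε, hε, hgeo⟩ := hφ.exists_geodesic g (y₀ := y₁) (v₀ := z - y₁)
    (mem_of_mem_nhds hy₁).1 (prod_mem_nhds hy₁ (Metric.ball_mem_nhds (z - y₁)
      (show 0 < R / 4 by positivity)))
  set t₀ := min (ε / 2) 1 with ht₀
  have ht₀pos : 0 < t₀ := lt_min (by linarith) one_pos
  have ht₀ε : t₀ < ε := (min_le_left _ _).trans_lt (by linarith)
  have ht₀1 : t₀ ≤ 1 := min_le_right _ _
  have h0 : (0 : ℝ) ∈ Ioo (-ε) ε := ⟨by linarith, hε⟩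
  have htI : t₀ ∈ Ioo (-ε) ε := ⟨by linarith, ht₀ε⟩
  filter_upwards [hy₁, Metric.closedBall_mem_nhds y₁ hr,
    Metric.ball_mem_nhds y₁ (show 0 < t₀ * R / 2 by positivity)] with y hyO hyr hyt
  rw [← sub_eq_zero]
  refine bilin_eq_zero_of_ball (fun v w => ?_) hr (v₀ := z - y₁) fun v hv => ?_
  · simp only [sub_apply, smul_apply]
    rw [coordForm_symm_of_symm (hb.symm _ hyO.2) v w, coordForm_symm g φ y v w]
  · obtain ⟨c, hc, hc0, hcv, hcW⟩ := hgeo y hyr v hv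
    have hcU : ∀ t ∈ Ioo (-ε) ε, c t ∈ φ.source ∧ c t ∈ U := by
      intro t ht
      refine ⟨(hcW t ht).1, ?_⟩
      have := (hcW t ht).2.1.2
      rwa [mem_preimage, φ.left_inv (hcW t ht).1] at this
    have hc0' : φ (c 0) = y := by rw [hc0, φ.right_inv hyO.1]
    have hconst := hb.coordForm_const hφ hc hcU htI h0
    have hconst' := (isQuadraticIntegralOn_metric g U).coordForm_const hφ hc hcU htI h0
    rw [hcv, hc0'] at hconst hconst'
    -- the velocity stays close to `z - y₁`, so that the geodesic is in the ball at the time `t₀`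
    have hmv : ‖(φ (c t₀) - t₀ • (z - y₁)) - (φ (c 0) - (0 : ℝ) • (z - y₁))‖ ≤ R / 4 * (t₀ - 0) := by
      refine norm_image_sub_le_of_norm_deriv_le_segment' (f := fun t => φ (c t) - t • (z - y₁))
        (f' := fun t => deriv (fun r => φ (c r)) t - (1 : ℝ) • (z - y₁)) ?_ ?_ t₀ ⟨ht₀pos.le, le_rfl⟩
      · intro t ht
        have htI' : t ∈ Ioo (-ε) ε := ⟨by linarith [ht.1], ht.2.trans_lt ht₀ε⟩
        have hd := (contDiffAt_coord_comp hφ isOpen_Ioo hc.1 htI' (hcW t htI').1).differentiableAt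
          (by simp)
        exact (hd.hasDerivAt.sub ((hasDerivAt_id t).smul_const (z - y₁))).hasDerivWithinAt
      · intro t ht
        have htI' : t ∈ Ioo (-ε) ε := ⟨by linarith [ht.1], ht.2.trans ht₀ε⟩
        have := (hcW t htI').2.2
        rw [one_smul, ← dist_eq_norm]
        exact (Metric.mem_ball.1 this).le
    have hmem : φ (c t₀) ∈ Metric.ball z R := by
      rw [Metric.mem_ball, dist_eq_norm]
      have e : φ (c t₀) - z = ((φ (c t₀) - t₀ • (z - y₁)) - (φ (c 0) - (0 : ℝ) • (z - y₁))) +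
          ((y - y₁) + (1 - t₀) • (y₁ - z)) := by
        rw [hc0']; module
      have e2 : ‖y - y₁‖ < t₀ * R / 2 := by rw [← dist_eq_norm]; exact hyt
      have e3 : ‖(1 - t₀) • (y₁ - z)‖ = (1 - t₀) * R := by
        rw [norm_smul, Real.norm_of_nonneg (by linarith), hR, dist_eq_norm]
      rw [e]
      calc _ ≤ R / 4 * (t₀ - 0) + (‖y - y₁‖ + ‖(1 - t₀) • (y₁ - z)‖) :=
            (norm_add_le _ _).trans (add_le_add hmv (norm_add_le _ _))
        _ < R := by rw [e3]; nlinarith [mul_pos ht₀pos hRpos]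
    -- as `b` and `g` are conserved, `b - k g` vanishes on the initial velocity
    have hz := coordForm_eq_smul (hball _ hmem (φ.map_source (hcW t₀ htI).1))
    rw [sub_apply, sub_apply, ← hconst, smul_apply, smul_apply, ← hconst', hz]
    simp

/-- Unique continuation: on a connected open set, an integral that is a constant multiple of the
metric near one point is so everywhere. -/
theorem IsQuadraticIntegralOn.eq_smul_of_eventually (hb : IsQuadraticIntegralOn g b U)
    (hU : IsOpen U) (hUc : IsPreconnected U) {x₀ : M} (hx₀ : x₀ ∈ U) {k : ℝ}
    (h : ∀ᶠ x in 𝓝 x₀, b x = k • g.inner x) : ∀ x ∈ U, b x = k • g.inner x := by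
  set Z := interior {x | b x = k • g.inner x} with hZ
  have hZs : Z ⊆ {x | b x = k • g.inner x} := interior_subset
  suffices hUZ : U ⊆ Z from fun x hx => hZs (hUZ hx)
  refine hUc.subset_of_closure_inter_subset isOpen_interior
    ⟨x₀, hx₀, mem_interior_iff_mem_nhds.2 h⟩ ?_
  rintro x ⟨hxZ, hxU⟩
  by_contra hx
  set φ := chartAt Plane x with hφdef
  have hφ : IsCoord φ := IsManifold.chart_mem_maximalAtlas _
  have hs : x ∈ φ.source := mem_chart_source Plane x
  have hO : IsOpen (φ.target ∩ φ.symm ⁻¹' U) := φ.symm.isOpen_inter_preimage hU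
  have hZo : IsOpen (φ.target ∩ φ.symm ⁻¹' Z) := φ.symm.isOpen_inter_preimage isOpen_interior
  obtain ⟨r, hr, hball⟩ := Metric.isOpen_iff.1 hO (φ x)
    ⟨φ.map_source hs, by rwa [mem_preimage, φ.left_inv hs]⟩
  -- a point `z` of `Z` close to `x`, and the point `y₁` outside `Z` nearest to it
  obtain ⟨z', hz'r, hz'Z⟩ := mem_closure_iff_nhds.1 hxZ _ (inter_mem (φ.open_source.mem_nhds hs)
    ((φ.continuousAt hs).preimage_mem_nhds (Metric.ball_mem_nhds _ (half_pos hr))))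
  set z := φ z' with hz
  have hzZ : z ∈ φ.target ∩ φ.symm ⁻¹' Z :=
    ⟨φ.map_source hz'r.1, by rwa [mem_preimage, φ.left_inv hz'r.1]⟩
  have hxc : φ x ∈ (φ.target ∩ φ.symm ⁻¹' Z)ᶜ := fun h' => hx (by
    have := h'.2
    rwa [mem_preimage, φ.left_inv hs] at this)
  obtain ⟨y₁, hy₁c, hy₁⟩ := hZo.isClosed_compl.exists_infDist_eq_dist ⟨_, hxc⟩ z
  have hzr : dist z (φ x) < r / 2 := hz'r.2
  have hle : dist z y₁ ≤ dist z (φ x) := hy₁ ▸ Metric.infDist_le_dist_of_mem hxc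
  have hy₁O : φ.target ∩ φ.symm ⁻¹' U ∈ 𝓝 y₁ := by
    refine hO.mem_nhds (hball ?_)
    rw [Metric.mem_ball]
    calc dist y₁ (φ x) ≤ dist y₁ z + dist z (φ x) := dist_triangle _ _ _
      _ < r := by rw [dist_comm y₁ z]; linarith
  have hne : z ≠ y₁ := by
    rintro h'
    rw [← h'] at hy₁c
    exact hy₁c hzZ
  have hev := hb.eventually_eq_smul_of_ball hφ (k := k) hy₁O hne (fun y hy _ => by
    have : y ∈ φ.target ∩ φ.symm ⁻¹' Z := by
      by_contra hyc
      have h1 := Metric.infDist_le_dist_of_mem (x := z) (mem_compl hyc)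
      rw [hy₁, dist_comm z y, dist_comm z y₁] at h1
      exact absurd (Metric.mem_ball.1 hy) (not_lt.2 h1)
    exact hZs this.2)
  have hy₁t : y₁ ∈ φ.target := (mem_of_mem_nhds hy₁O).1
  refine hy₁c ⟨hy₁t, mem_interior_iff_mem_nhds.2 ?_⟩
  have hcont : Tendsto φ (𝓝 (φ.symm y₁)) (𝓝 y₁) := by
    have := φ.continuousAt (φ.map_target hy₁t)
    rwa [ContinuousAt, φ.right_inv hy₁t] at this
  filter_upwards [hcont.eventually hev, φ.open_source.mem_nhds (φ.map_target hy₁t)] with w hw hws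
  exact eq_smul_of_coordForm hφ hws hw

/-- The points where the integral is not proportional to the metric are dense: on an open set of
proportionality the factor would be locally constant, hence constant on all of `U`. -/
theorem IsQuadraticIntegralOn.subset_closure (hb : IsQuadraticIntegralOn g b U) (hU : IsOpen U)
    (hUc : IsPreconnected U) (hne : ¬ ∃ k : ℝ, ∀ x ∈ U, b x = k • g.inner x) :
    U ⊆ closure {x ∈ U | ¬ ∃ k : ℝ, b x = k • g.inner x} := by
  intro x₀ hx₀
  by_contra hcl
  set V := U ∩ (closure {x ∈ U | ¬ ∃ k : ℝ, b x = k • g.inner x})ᶜ with hV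
  have hprop : ∀ x ∈ V, ∃ k : ℝ, b x = k • g.inner x := by
    intro x hx
    by_contra h
    exact hx.2 (_root_.subset_closure ⟨hx.1, h⟩)
  obtain ⟨k, hk⟩ := hb.eventually_eq_smul (hU.inter isClosed_closure.isOpen_compl)
    inter_subset_left hprop ⟨hx₀, hcl⟩
  exact hne ⟨k, hb.eq_smul_of_eventually hU hUc hx₀ hk⟩

end

/-! ### Equivalence of the conditions on a geodesic net -/

section

variable {M : Type*} [TopologicalSpace M] [ChartedSpace Plane M]
variable [IsManifold 𝓘(ℝ, Plane) ∞ M] {g : Metric M} {G₁ G₂ N₁ N₂ : DirField M} {U : Set M}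

theorem isConformallyFlatOn_of_isHexagonalOn (hG : IsGeodesicNetOn g G₁ G₂ U)
    (hN : IsBisectorNetOn g G₁ G₂ N₁ N₂ U) {k : Fin 4}
    (hk : IsHexagonalOn (subweb G₁ G₂ N₁ N₂ k) U) : IsConformallyFlatOn g N₁ N₂ U := by
  intro x hx
  obtain ⟨ψ, hψ, hxψ, hψU, hp⟩ := exists_parallelized_of_isHexagonalOn hG hN hk hx
  exact isConformallyFlat_of_parallelized hG hN hψ hxψ hψU hp

theorem isHexagonalOn_of_isConformallyFlatOn (hG : IsGeodesicNetOn g G₁ G₂ U)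
    (hN : IsBisectorNetOn g G₁ G₂ N₁ N₂ U) (hc : IsConformallyFlatOn g N₁ N₂ U) (k : Fin 4) :
    IsHexagonalOn (subweb G₁ G₂ N₁ N₂ k) U := by
  refine isHexagonalOn_subweb_of_parallelized (fun x hx => ?_) k
  obtain ⟨ψ, Λ, T, h, hxψ, hψU⟩ := exists_isAdaptedCoord hG hN hc hx
  exact h.exists_parallelized hG hψU hxψ

theorem CarriesGeodesicNetNear.mono {m : M}
    {P Q : DirField M → DirField M → DirField M → DirField M → Set M → Prop}
    (h : CarriesGeodesicNetNear g m P)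
    (hPQ : ∀ {G₁ G₂ N₁ N₂ U}, IsGeodesicNetOn g G₁ G₂ U → IsBisectorNetOn g G₁ G₂ N₁ N₂ U →
      P G₁ G₂ N₁ N₂ U → Q G₁ G₂ N₁ N₂ U) : CarriesGeodesicNetNear g m Q := by
  obtain ⟨U, hU, hm, G₁, G₂, N₁, N₂, hG, hN, hP⟩ := h
  exact ⟨U, hU, hm, G₁, G₂, N₁, N₂, hG, hN, hPQ hG hN hP⟩

end

end GeodesicNets

end

open GeodesicNets in
theorem theorem3 {M : Type*} [TopologicalSpace M] [T2Space M] [SecondCountableTopology M]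
    [ChartedSpace Plane M] [IsManifold 𝓘(ℝ, Plane) ∞ M] (g : Metric M) :
    -- a quadratic integral exists iff there is a geodesic net as described
    (∀ m : M, List.TFAE [
      AdmitsQuadraticIntegralNear g m,
      CarriesGeodesicNetNear g m fun G₁ G₂ N₁ N₂ U =>
        ∃ k : Fin 4, IsHexagonalOn (subweb G₁ G₂ N₁ N₂ k) U,
      CarriesGeodesicNetNear g m fun G₁ G₂ N₁ N₂ U =>
        ∀ k : Fin 4, IsHexagonalOn (subweb G₁ G₂ N₁ N₂ k) U,
      CarriesGeodesicNetNear g m fun _ _ N₁ N₂ U =>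
        IsConformallyFlatOn g N₁ N₂ U]) ∧
    -- an integral which is linearly independent of the Hamiltonian gives such nets near generic
    -- points
    (∀ (U : Set M) (b : BilinField M), IsOpen U → IsPreconnected U →
      IsQuadraticIntegralOn g b U → (¬ ∃ k : ℝ, ∀ x ∈ U, b x = k • g.inner x) →
      U ⊆ closure {x ∈ U | CarriesGeodesicNetNear g x fun G₁ G₂ N₁ N₂ V =>
        (∀ k : Fin 4, IsHexagonalOn (subweb G₁ G₂ N₁ N₂ k) V) ∧
          IsConformallyFlatOn g N₁ N₂ V}) ∧
    -- for every geodesic net the three conditions on it are equivalent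
    (∀ (U : Set M) (G₁ G₂ N₁ N₂ : DirField M), IsOpen U →
      IsGeodesicNetOn g G₁ G₂ U → IsBisectorNetOn g G₁ G₂ N₁ N₂ U → List.TFAE [
        ∃ k : Fin 4, IsHexagonalOn (subweb G₁ G₂ N₁ N₂ k) U,
        ∀ k : Fin 4, IsHexagonalOn (subweb G₁ G₂ N₁ N₂ k) U,
        IsConformallyFlatOn g N₁ N₂ U]) := by
  refine ⟨fun m => ?_, fun U b hU hUc hb hne => ?_, fun U G₁ G₂ N₁ N₂ _ hG hN => ?_⟩
  · tfae_have 1 → 4 := fun ⟨U, hU, hm, b, hb, hne⟩ => exists_net_of_integral hU hb hm hne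
    tfae_have 4 → 3 := fun h => h.mono fun hG hN hc =>
      isHexagonalOn_of_isConformallyFlatOn hG hN hc
    tfae_have 3 → 2 := fun h => h.mono fun _ _ hk => ⟨0, hk 0⟩
    tfae_have 2 → 4 := fun h => h.mono fun hG hN ⟨_, hk⟩ =>
      isConformallyFlatOn_of_isHexagonalOn hG hN hk
    tfae_have 4 → 1 := by
      rintro ⟨U, hU, hm, G₁, G₂, N₁, N₂, hG, hN, hc⟩
      obtain ⟨ψ, Λ, T, h, hmψ, hψU⟩ := exists_isAdaptedCoord hG hN hc hm
      exact h.admitsQuadraticIntegralNear hG hψU hmψ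
    tfae_finish
  · refine (hb.subset_closure hU hUc hne).trans (closure_mono fun x hx => ⟨hx.1, ?_⟩)
    exact (exists_net_of_integral hU hb hx.1 hx.2).mono fun hG hN hc =>
      ⟨isHexagonalOn_of_isConformallyFlatOn hG hN hc, hc⟩
  · tfae_have 1 → 3 := fun ⟨_, hk⟩ => isConformallyFlatOn_of_isHexagonalOn hG hN hk
    tfae_have 3 → 2 := isHexagonalOn_of_isConformallyFlatOn hG hN
    tfae_have 2 → 1 := fun hk => ⟨0, hk 0⟩
    tfae_finish
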